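/- Let $p$ be a prime, $q=p^r$ a power of $p$, $\mathbb{F}_q$ the field with $q$ elements, and $\ell\ge 1$ an integer. For monic $f\in\mathbb{F}_q[T]$ let $\Lambda_q(f)=\deg P$ if $f=P^k$ with $P$ monic irreducible and $k\ge 1$, and $\Lambda_q(f)=0$ otherwise. The $j$-th next-to-leading coefficient of a monic polynomial $f$ of degree $n$ is its coefficient of $T^{n-j}$, and is taken to be $0$ if $j>n$. For $n\ge 1$ let $$\psi_q(n,\underbrace{0,\ldots,0}_{\ell})=\sum_{f}\Lambda_q(f),\qquad f_{q,\ell}(n)=\frac{\psi_q(n,\overbrace{0,\ldots,0}^{\ell})-q^{n-\ell}}{q^{n/2}},$$ where the sum is over all monic $f\in\mathbb{F}_q[T]$ of degree $n$ whose first $\ell$ next-to-leading coefficients are all $0$. Call a function $g$ on the positive integers periodic if there is an integer $N\ge1$ with $g(n+N)=g(n)$ for all $n\ge1$; the least such $N$ is its period. Then $f_{q,\ell}(n)$ is periodic in $n\in\mathbb{N}_{>0}$ if and only if one of the following conditions holds: 1. $\ell=1$, in which case the period is $1$; 2. $\ell=2$, in which case the period divides $4p$; 3. $\ell=3$ and $p\in\{2,5\}$,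 in which case the period divides $12p$. -/

import Mathlib

open Polynomial

noncomputable section

namespace ShortInterval

/-- The `j`-th next-to-leading coefficient of a polynomial `f`: the coefficient of
`T ^ (deg f - j)`, and `0` by convention when `j > deg f`. -/
def nextToLeading {F : Type*} [Field F] (f : F[X]) (j : ℕ) : F :=
  if j ≤ f.natDegree then f.coeff (f.natDegree - j) else 0

/-- `f` is a positive power of the monic irreducible polynomial `P`. -/
def IsPowerOfPrime {F : Type*} [Field F] (f P : F[X]) : Prop :=
  P.Monic ∧ Irreducible P ∧ ∃ k : ℕ, 0 < k ∧ f = P ^ k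

open Classical in
/-- The von Mangoldt function on `F[T]`: it is `deg P` if `f = P ^ k` with `k ≥ 1` and `P`
monic irreducible (such a `P` is unique, see `vonMangoldt_pow`), and `0` otherwise. -/
def vonMangoldt {F : Type*} [Field F] (f : F[X]) : ℝ :=
  if h : ∃ P : F[X], IsPowerOfPrime f P then (h.choose.natDegree : ℝ) else 0

theorem IsPowerOfPrime.unique {F : Type*} [Field F] {f P Q : F[X]}
    (hP : IsPowerOfPrime f P) (hQ : IsPowerOfPrime f Q) : P = Q := by
  obtain ⟨hPm, hPi, k, hk, rfl⟩ := hP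
  obtain ⟨hQm, hQi, m, -, h⟩ := hQ
  have hdvd : P ∣ Q := by
    apply hPi.prime.dvd_of_dvd_pow (n := m)
    rw [← h]
    exact dvd_pow_self P hk.ne'
  exact eq_of_monic_of_associated hPm hQm (hPi.associated_of_dvd hQi hdvd)

theorem vonMangoldt_pow {F : Type*} [Field F] {P : F[X]} (hm : P.Monic) (hi : Irreducible P)
    {k : ℕ} (hk : 0 < k) : vonMangoldt (P ^ k) = P.natDegree := by
  have hP : IsPowerOfPrime (P ^ k) P := ⟨hm, hi, k, hk, rfl⟩
  have h : ∃ Q : F[X], IsPowerOfPrime (P ^ k) Q := ⟨P, hP⟩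
  rw [vonMangoldt, dif_pos h, h.choose_spec.unique hP]

/-- The monic polynomials of degree `n` whose first `ℓ` next-to-leading coefficients are
`t 0, …, t (ℓ - 1)`. -/
def monicPrescribed {F : Type*} [Field F] (n : ℕ) {ℓ : ℕ} (t : Fin ℓ → F) : Set F[X] :=
  {f | f.Monic ∧ f.natDegree = n ∧ ∀ i : Fin ℓ, nextToLeading f (i + 1) = t i}

theorem finite_monicPrescribed {F : Type*} [Field F] [Finite F] (n : ℕ) {ℓ : ℕ}
    (t : Fin ℓ → F) : (monicPrescribed n t).Finite := by
  refine Set.Finite.of_finite_image (f := fun f : F[X] => fun i : Fin (n + 1) => f.coeff i)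
    (Set.toFinite _) ?_
  intro f hf g hg hfg
  ext i
  rcases lt_or_ge i (n + 1) with hi | hi
  · exact congrFun hfg ⟨i, hi⟩
  · rw [coeff_eq_zero_of_natDegree_lt (by rw [hf.2.1]; omega),
      coeff_eq_zero_of_natDegree_lt (by rw [hg.2.1]; omega)]

/-- `ψ_q(n, t₁, …, t_ℓ)`: the sum of the von Mangoldt function over the monic polynomials of
degree `n` with first `ℓ` next-to-leading coefficients `t₁, …, t_ℓ`. -/
def psi {F : Type*} [Field F] [Finite F] (n : ℕ) {ℓ : ℕ} (t : Fin ℓ → F) : ℝ :=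
  ∑ f ∈ (finite_monicPrescribed n t).toFinset, vonMangoldt f

/-- `f_{q,ℓ}(n) = (ψ_q(n, 0, …, 0) - q ^ (n - ℓ)) / q ^ (n / 2)` for `n ≥ 1`, where `q = #F`;
the exponent `n - ℓ` is an integer, possibly negative, and `n / 2` is a real number. -/
def normalizedPsi (F : Type*) [Field F] [Finite F] (ℓ : ℕ) (n : ℕ+) : ℝ :=
  (psi (n : ℕ) (fun _ : Fin ℓ => (0 : F)) - (Nat.card F : ℝ) ^ (((n : ℕ) : ℤ) - (ℓ : ℤ))) /
    (Nat.card F : ℝ) ^ (((n : ℕ) : ℝ) / 2)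

/-- A function on the positive integers is periodic if `g (n + N) = g n` for all `n ≥ 1`,
for some positive integer `N`. -/
def IsPeriodic (g : ℕ+ → ℝ) : Prop :=
  ∃ N : ℕ+, Function.Periodic g N

/-- `N` is the (least) period of `g`. -/
def IsThePeriod (g : ℕ+ → ℝ) (N : ℕ+) : Prop :=
  IsLeast {M : ℕ+ | Function.Periodic g M} N

end ShortInterval

end

noncomputable section
namespace ShortInterval

variable {F : Type*} [Field F]

/-! ### Monic polynomials up to their leading coefficients -/

/-! After reversal, monic polynomials modulo agreement in the first ℓ next-to-leading coefficients
become power series with constant term 1 modulo `t ^ (ℓ + 1)`, a finite abelian group of order `q ^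
ℓ`. By orthogonality, `q ^ ℓ` times `psi` is the sum over its characters χ of `mangoldtSum χ n`. The
trivial character gives `q ^ n`, which is the main term. For nontrivial χ the L-function is a
polynomial of degree less than ℓ, and its logarithmic derivative shows that `mangoldtSum χ n` is
minus the sum of the `α ^ n` over its inverse roots α. So `normalizedPsi` is `-q ^ (-ℓ)` times the
sum of all `(α / √q) ^ n`. All terms have the same sign, nothing cancels, and N is a period if and
only if every `(α / √q) ^ N` is 1 (`periodic_normalizedPsi_iff`).

Non-periodicity: a character over the prime field pulls back along the norm to `F`, and its inverse
roots are raised to the power r (`mangoldtSum_comp_normPoly`). Periodicity over `F` therefore makes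
each degree one character sum over `ZMod p` equal to √p times an algebraic integer. This fails for
suitable cubic sums if p ≥ 7, for a quartic sum if p = 5 and ℓ ≥ 4, and for characters with values
of order 8 or 9 if p = 2, ℓ ≥ 4 or p = 3, ℓ ≥ 3.

Periodicity: there are no roots for ℓ = 1. For ℓ = 2 there is at most one, essentially a quadratic
Gauss sum in odd characteristic and a Gaussian integer of norm q in characteristic 2. For ℓ = 3 a
primitive character has `α ^ 2 + c₁ α + c₂ = 0`, where `c₂` is q times a root of unity and `c₂ *
conj c₁ = q c₁`, so everything depends on `|c₁| ^ 2 / q`. For p = 2 this is an integer among 0, 1,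
2, 4, by a Frobenius linearization and arithmetic in `ℤ[i]`. For p = 5, `c₁` is, up to a root of
unity, an odd cubic sum in `ℤ[φ]`. Its square involves its own Galois conjugate, a Gauss sum and a
sextic sum that Frobenius makes quadratic. Dividing by powers of √5 leaves finitely many
possibilities. -/

theorem nextToLeading_eq_coeff_reverse (f : F[X]) (j : ℕ) :
    nextToLeading f j = f.reverse.coeff j := by
  rw [nextToLeading, coeff_reverse]
  split_ifs with h
  · rw [revAt_le h]
  · rw [revAt_eq_self_of_lt (by omega), coeff_eq_zero_of_natDegree_lt (by omega)]

/-- Two polynomials agree in their leading and first `ℓ` next-to-leading coefficients. -/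
def Agree (ℓ : ℕ) (f g : F[X]) : Prop := X ^ (ℓ + 1) ∣ f.reverse - g.reverse

theorem agree_iff {ℓ : ℕ} {f g : F[X]} :
    Agree ℓ f g ↔ ∀ j ≤ ℓ, f.reverse.coeff j = g.reverse.coeff j := by
  simp only [Agree, X_pow_dvd_iff, coeff_sub, sub_eq_zero, Nat.lt_succ_iff]

theorem Agree.refl {ℓ : ℕ} (f : F[X]) : Agree ℓ f f := by simp [Agree]

theorem Agree.symm {ℓ : ℕ} {f g : F[X]} (h : Agree ℓ f g) : Agree ℓ g f := by
  rw [agree_iff] at *; exact fun j hj => (h j hj).symm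

theorem Agree.trans {ℓ : ℕ} {f g k : F[X]} (h : Agree ℓ f g) (h' : Agree ℓ g k) :
    Agree ℓ f k := by
  rw [agree_iff] at *; exact fun j hj => (h j hj).trans (h' j hj)

theorem Agree.mono {ℓ m : ℕ} {f g : F[X]} (h : Agree ℓ f g) (hm : m ≤ ℓ) : Agree m f g :=
  (pow_dvd_pow X (by omega)).trans h

theorem Agree.mul {ℓ : ℕ} {f g f' g' : F[X]} (h : Agree ℓ f f') (h' : Agree ℓ g g') :
    Agree ℓ (f * g) (f' * g') := by
  rw [Agree, reverse_mul_of_domain, reverse_mul_of_domain]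
  have e : f.reverse * g.reverse - f'.reverse * g'.reverse =
    f.reverse * (g.reverse - g'.reverse) + (f.reverse - f'.reverse) * g'.reverse := by ring
  rw [e]
  exact dvd_add (h'.mul_left _) (Dvd.dvd.mul_right h _)

/-- The reversal of a monic polynomial has constant term 1, so it is prime to `X` and can be
cancelled modulo a power of `X`. -/
theorem Agree.of_mul_right {ℓ : ℕ} {f g h : F[X]} (hh : h.Monic)
    (H : Agree ℓ (f * h) (g * h)) : Agree ℓ f g := by
  rw [Agree, reverse_mul_of_domain, reverse_mul_of_domain, ← sub_mul] at H
  refine (prime_X.pow_dvd_of_dvd_mul_right _ ?_ H)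
  rw [X_dvd_iff, coeff_zero_reverse, hh.leadingCoeff]
  exact one_ne_zero

theorem reverse_map {K : Type*} [Field K] (σ : F →+* K) (f : F[X]) :
    (f.map σ).reverse = f.reverse.map σ := by
  ext j
  rw [coeff_reverse, coeff_map, coeff_map, coeff_reverse, natDegree_map]

theorem Agree.map {K : Type*} [Field K] (σ : F →+* K) {ℓ : ℕ} {f g : F[X]} :
    Agree ℓ (f.map σ) (g.map σ) ↔ Agree ℓ f g := by
  simp [agree_iff, reverse_map, σ.injective.eq_iff]

theorem agree_X_pow_mul (ℓ n : ℕ) (f : F[X]) : Agree ℓ (X ^ n * f) f := by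
  rw [Agree, reverse_mul_of_domain]
  have : (X ^ n : F[X]).reverse = 1 := by
    induction n with
    | zero => simpa using reverse_C (1 : F)
    | succ n ih => rw [pow_succ, reverse_mul_X, ih]
  simp [this]

/-- Polynomials of the same degree `n` agree if their difference has degree `< n - ℓ`. -/
theorem agree_of_degree_sub_lt {ℓ n : ℕ} {f g : F[X]} (hf : f.natDegree = n)
    (hg : g.natDegree = n) (h : ∀ j ≤ ℓ, j ≤ n → f.coeff (n - j) = g.coeff (n - j)) :
    Agree ℓ f g := by
  rw [agree_iff]
  intro j hj
  simp only [coeff_reverse, hf, hg]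
  rcases le_or_gt j n with hjn | hjn
  · rw [revAt_le hjn]; exact h j hj hjn
  · rw [revAt_eq_self_of_lt hjn, coeff_eq_zero_of_natDegree_lt (by omega),
      coeff_eq_zero_of_natDegree_lt (by omega)]

theorem Agree.coeff_eq {ℓ n : ℕ} {f g : F[X]} (H : Agree ℓ f g) (hf : f.natDegree = n)
    (hg : g.natDegree = n) (j : ℕ) (hj : j ≤ ℓ) (hjn : j ≤ n) :
    f.coeff (n - j) = g.coeff (n - j) := by
  have := agree_iff.1 H j hj
  simpa only [coeff_reverse, hf, hg, revAt_le hjn] using this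

/-! ### The finite group of coefficient classes and its characters -/

variable (F) in
/-- The submonoid of monic polynomials. -/
def monicSubmonoid : Submonoid F[X] where
  carrier := {f | f.Monic}
  mul_mem' := fun hf hg => hf.mul hg
  one_mem' := monic_one

variable (F) in
/-- Agreement of the first `ℓ` next-to-leading coefficients, as a congruence on the monoid of
monic polynomials. -/
def agreeCon (ℓ : ℕ) : Con (monicSubmonoid F) where
  r f g := Agree ℓ (f : F[X]) (g : F[X])
  iseqv := ⟨fun _ => Agree.refl _, Agree.symm, Agree.trans⟩
  mul' := fun h h' => h.mul h'

variable (F) in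
/-- The group of monic polynomials modulo agreement of the first `ℓ` next-to-leading
coefficients. -/
def ClassGrp (ℓ : ℕ) : Type _ := (agreeCon F ℓ).Quotient

namespace ClassGrp

variable {ℓ : ℕ}

instance : CommMonoid (ClassGrp F ℓ) := inferInstanceAs (CommMonoid (agreeCon F ℓ).Quotient)

/-- The class of a monic polynomial. -/
def mk (ℓ : ℕ) : monicSubmonoid F →* ClassGrp F ℓ := (agreeCon F ℓ).mk'

theorem mk_surjective : Function.Surjective (mk (F := F) ℓ) := Con.mk'_surjective

theorem mk_eq_iff {f g : monicSubmonoid F} :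
    mk ℓ f = mk ℓ g ↔ Agree ℓ (f : F[X]) (g : F[X]) := (agreeCon F ℓ).eq

instance [Finite F] : Finite (ClassGrp F ℓ) := by
  refine Finite.of_surjective (α := Set.range
    (fun (f : monicSubmonoid F) (i : Fin (ℓ + 1)) => (f : F[X]).reverse.coeff i))
    (fun v => mk ℓ v.2.choose) ?_
  intro x
  obtain ⟨f, rfl⟩ := mk_surjective x
  refine ⟨⟨_, f, rfl⟩, ?_⟩
  rw [mk_eq_iff, agree_iff]
  intro j hj
  have h : ∃ y : monicSubmonoid F, (fun (i : Fin (ℓ + 1)) => (y : F[X]).reverse.coeff i) =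
    (fun (i : Fin (ℓ + 1)) => (f : F[X]).reverse.coeff i) := ⟨f, rfl⟩
  exact congrFun h.choose_spec ⟨j, by omega⟩

/-- A finite cancellative commutative monoid is a group; cancellation is `Agree.of_mul_right`. -/
theorem isUnit_of_finite [Finite F] (x : ClassGrp F ℓ) : IsUnit x := by
  have inj : Function.Injective (fun y : ClassGrp F ℓ => y * x) := by
    intro a b hab
    obtain ⟨f, rfl⟩ := mk_surjective a
    obtain ⟨g, rfl⟩ := mk_surjective b
    obtain ⟨h, rfl⟩ := mk_surjective x
    simp only [← map_mul, mk_eq_iff] at hab ⊢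
    exact Agree.of_mul_right h.2 hab
  obtain ⟨y, hy⟩ := (Finite.injective_iff_surjective.1 inj) 1
  exact IsUnit.of_mul_eq_one y (by rw [mul_comm]; exact hy)

instance [Finite F] : CommGroup (ClassGrp F ℓ) :=
  { (inferInstance : CommMonoid (ClassGrp F ℓ)) with
    inv := fun x => ((isUnit_of_finite x).unit⁻¹ : (ClassGrp F ℓ)ˣ)
    inv_mul_cancel := fun x => (isUnit_of_finite x).val_inv_mul }

end ClassGrp

/-- `χ` is multiplicative on monic polynomials and depends only on their first `ℓ`
next-to-leading coefficients. -/
structure IsLevelChar (ℓ : ℕ) (χ : F[X] → ℂ) : Prop where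
  map_one : χ 1 = 1
  map_mul : ∀ {f g : F[X]}, f.Monic → g.Monic → χ (f * g) = χ f * χ g
  congr : ∀ {f g : F[X]}, f.Monic → g.Monic → Agree ℓ f g → χ f = χ g

theorem IsLevelChar.mono {ℓ m : ℕ} {χ : F[X] → ℂ} (h : IsLevelChar ℓ χ) (hm : ℓ ≤ m) :
    IsLevelChar m χ :=
  ⟨h.map_one, h.map_mul, fun hf hg H => h.congr hf hg (H.mono hm)⟩

theorem IsLevelChar.map_pow {ℓ : ℕ} {χ : F[X] → ℂ} (h : IsLevelChar ℓ χ) {f : F[X]}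
    (hf : f.Monic) (n : ℕ) : χ (f ^ n) = χ f ^ n := by
  induction n with
  | zero => simp [h.map_one]
  | succ n ih => rw [pow_succ, h.map_mul (hf.pow n) hf, ih, pow_succ]

theorem IsLevelChar.exists_pow_eq_one [Finite F] {ℓ : ℕ} {χ : F[X] → ℂ} (h : IsLevelChar ℓ χ)
    {f : F[X]} (hf : f.Monic) : ∃ n, 0 < n ∧ χ f ^ n = 1 := by
  refine ⟨_, orderOf_pos (ClassGrp.mk ℓ ⟨f, hf⟩), ?_⟩
  set n := orderOf (ClassGrp.mk ℓ ⟨f, hf⟩)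
  rw [← h.map_pow hf, ← h.map_one]
  refine h.congr (hf.pow _) monic_one ?_
  have := pow_orderOf_eq_one (ClassGrp.mk ℓ ⟨f, hf⟩)
  have e : ClassGrp.mk ℓ ((⟨f, hf⟩ : monicSubmonoid F) ^ n) = ClassGrp.mk ℓ 1 := by
    rw [_root_.map_pow, _root_.map_one]; exact this
  have e' := ClassGrp.mk_eq_iff.1 e
  rwa [SubmonoidClass.coe_pow, OneMemClass.coe_one] at e'

theorem IsLevelChar.norm_eq_one [Finite F] {ℓ : ℕ} {χ : F[X] → ℂ} (h : IsLevelChar ℓ χ)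
    {f : F[X]} (hf : f.Monic) : ‖χ f‖ = 1 := by
  obtain ⟨n, hn, e⟩ := h.exists_pow_eq_one hf
  exact Complex.norm_eq_one_of_pow_eq_one e hn.ne'

open Classical in
/-- The function on polynomials given by a character of `ClassGrp F ℓ`. -/
def levelChar [Finite F] {ℓ : ℕ} (ψ : AddChar (Additive (ClassGrp F ℓ)) ℂ) (f : F[X]) : ℂ :=
  if h : f.Monic then ψ (Additive.ofMul (ClassGrp.mk ℓ ⟨f, h⟩)) else 0

theorem levelChar_apply [Finite F] {ℓ : ℕ} (ψ : AddChar (Additive (ClassGrp F ℓ)) ℂ) {f : F[X]}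
    (h : f.Monic) : levelChar ψ f = ψ (Additive.ofMul (ClassGrp.mk ℓ ⟨f, h⟩)) := dif_pos h

theorem isLevelChar_levelChar [Finite F] {ℓ : ℕ} (ψ : AddChar (Additive (ClassGrp F ℓ)) ℂ) :
    IsLevelChar ℓ (levelChar ψ) where
  map_one := by
    rw [levelChar_apply ψ monic_one]
    have : (⟨1, monic_one⟩ : monicSubmonoid F) = 1 := rfl
    rw [this, map_one, ofMul_one, AddChar.map_zero_eq_one]
  map_mul := by
    intro f g hf hg
    rw [levelChar_apply ψ hf, levelChar_apply ψ hg, levelChar_apply ψ (hf.mul hg)]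
    have : (⟨f * g, hf.mul hg⟩ : monicSubmonoid F) = ⟨f, hf⟩ * ⟨g, hg⟩ := rfl
    rw [this, _root_.map_mul, ofMul_mul, AddChar.map_add_eq_mul]
  congr := by
    intro f g hf hg h
    rw [levelChar_apply ψ hf, levelChar_apply ψ hg]
    congr 2
    exact ClassGrp.mk_eq_iff.2 h

/-- Sums over the dual of `ClassGrp F ℓ` thus account for every level character, including those
built by hand or by pullback. -/
theorem IsLevelChar.exists_levelChar [Finite F] {ℓ : ℕ} {χ : F[X] → ℂ} (h : IsLevelChar ℓ χ) :
    ∃ ψ : AddChar (Additive (ClassGrp F ℓ)) ℂ, ∀ f : F[X], f.Monic → levelChar ψ f = χ f := by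
  let φ : monicSubmonoid F →* ℂ :=
    { toFun := fun f => χ f
      map_one' := h.map_one
      map_mul' := fun f g => h.map_mul f.2 g.2 }
  let φ' : ClassGrp F ℓ →* ℂ := (agreeCon F ℓ).lift φ fun f g H => h.congr f.2 g.2 H
  refine ⟨AddChar.toMonoidHomEquiv.symm
    (φ'.comp (MulEquiv.toMultiplicative_toAdditive : _ ≃* ClassGrp F ℓ).toMonoidHom), ?_⟩
  intro f hf
  rw [levelChar_apply _ hf]
  rfl

theorem levelChar_eq_one_iff [Finite F] {ℓ : ℕ} (ψ : AddChar (Additive (ClassGrp F ℓ)) ℂ) :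
    (∀ f : F[X], f.Monic → levelChar ψ f = 1) ↔ ψ = 1 := by
  constructor
  · intro h
    ext x
    obtain ⟨f, hf⟩ := ClassGrp.mk_surjective (Additive.toMul x)
    have := h f f.2
    rw [levelChar_apply ψ f.2] at this
    rw [AddChar.one_apply, ← this]
    congr 1
    exact hf.symm
  · rintro rfl f hf
    rw [levelChar_apply _ hf, AddChar.one_apply]

open Classical in
theorem sum_levelChar [Finite F] (ℓ : ℕ) {f : F[X]} (hf : f.Monic) :
    ∑ ψ : AddChar (Additive (ClassGrp F ℓ)) ℂ, levelChar ψ f =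
      if Agree ℓ f 1 then (Nat.card (ClassGrp F ℓ) : ℂ) else 0 := by
  have : Fintype (Additive (ClassGrp F ℓ)) := Fintype.ofFinite _
  simp only [levelChar_apply _ hf]
  rw [AddChar.sum_apply_eq_ite]
  have h : Additive.ofMul (ClassGrp.mk ℓ ⟨f, hf⟩) = 0 ↔ Agree ℓ f 1 := by
    rw [ofMul_eq_zero, ← map_one (ClassGrp.mk ℓ), ClassGrp.mk_eq_iff]
    rfl
  simp only [h, ← Nat.card_eq_fintype_card]
  rfl

end ShortInterval
end

noncomputable section
namespace ShortInterval

variable {F : Type*} [Field F] [Finite F]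

/-! ### Sums over monic polynomials -/

variable (F) in
/-- The finite set of monic polynomials of degree `n`. -/
def monics (n : ℕ) : Finset F[X] :=
  (finite_monicPrescribed n (Fin.elim0 : Fin 0 → F)).toFinset

theorem mem_monics {n : ℕ} {f : F[X]} : f ∈ monics F n ↔ f.Monic ∧ f.natDegree = n := by
  simp [monics, monicPrescribed]

theorem monics_zero : monics F 0 = {1} := by
  ext f
  rw [mem_monics, Finset.mem_singleton]
  constructor
  · rintro ⟨h, h'⟩
    exact h.natDegree_eq_zero.1 h'
  · rintro rfl
    simp

theorem sum_monics_succ [Fintype F] {A : Type*} [AddCommMonoid A] (n : ℕ) (h : F[X] → A) :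
    ∑ f ∈ monics F (n + 1), h f = ∑ g ∈ monics F n, ∑ a : F, h (X * g + C a) := by
  rw [← Finset.sum_product']
  refine (Finset.sum_bij' (fun x _ => X * x.1 + C x.2) (fun f _ => (f.divX, f.coeff 0))
    ?_ ?_ ?_ ?_ ?_).symm
  · rintro ⟨g, a⟩ hx
    simp only [Finset.mem_product, mem_monics, Finset.mem_univ, and_true] at hx ⊢
    have hd : (X * g).natDegree = n + 1 := by
      rw [natDegree_X_mul hx.1.ne_zero, hx.2]
    have hlt : (C a).degree < (X * g).degree := by
      refine lt_of_le_of_lt degree_C_le ?_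
      rw [degree_eq_natDegree (monic_X.mul hx.1).ne_zero, hd]
      exact_mod_cast Nat.succ_pos n
    exact ⟨(monic_X.mul hx.1).add_of_left hlt, by rw [natDegree_add_C, hd]⟩
  · intro f hf
    simp only [Finset.mem_product, mem_monics, Finset.mem_univ, and_true] at hf ⊢
    have hd : f.divX.natDegree = n := by rw [natDegree_divX_eq_natDegree_tsub_one, hf.2]; rfl
    refine ⟨?_, hd⟩
    rw [Monic, leadingCoeff, hd, coeff_divX, ← hf.2]
    exact hf.1
  · rintro ⟨g, a⟩ hx
    refine Prod.ext ?_ (by simp)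
    ext i
    simp [coeff_divX]
  · intro f hf
    exact X_mul_divX_add f
  · intro x _
    rfl

/-- The sum of `χ` over monic polynomials of degree `n`. -/
def charSum (χ : F[X] → ℂ) (n : ℕ) : ℂ := ∑ f ∈ monics F n, χ f

/-- The sum of `χ` over monic polynomials of degree `n`, weighted by the von Mangoldt
function. -/
def mangoldtSum (χ : F[X] → ℂ) (n : ℕ) : ℂ := ∑ f ∈ monics F n, (vonMangoldt f : ℂ) * χ f

theorem card_monics (n : ℕ) : (monics F n).card = Nat.card F ^ n := by
  have := Fintype.ofFinite F
  induction n with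
  | zero => simp [monics_zero]
  | succ n ih =>
    rw [Finset.card_eq_sum_ones, sum_monics_succ]
    simp [ih, pow_succ]


theorem vonMangoldt_one {F : Type*} [Field F] : vonMangoldt (1 : F[X]) = 0 := by
  rw [vonMangoldt, dif_neg]
  rintro ⟨P, hm, hi, k, hk, h⟩
  exact hi.not_isUnit (isUnit_of_dvd_one (h ▸ dvd_pow_self P hk.ne'))

variable (F) in
/-- The finite set of monic polynomials of degree at most `n`. -/
def monicsLE (n : ℕ) : Finset F[X] := by
  classical exact (Finset.range (n + 1)).biUnion (monics F)

theorem mem_monicsLE {n : ℕ} {f : F[X]} : f ∈ monicsLE F n ↔ f.Monic ∧ f.natDegree ≤ n := by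
  classical
  simp only [monicsLE, Finset.mem_biUnion, Finset.mem_range, mem_monics]
  constructor
  · rintro ⟨i, hi, hf, rfl⟩
    exact ⟨hf, by omega⟩
  · rintro ⟨hf, h⟩
    exact ⟨_, by omega, hf, rfl⟩

-- This is the identity `Λ * 1 = deg`. Removing one prime factor `P` from `P * g`, with `P ^ v`
-- exactly dividing `g`, loses only one prime power divisor, `P ^ (v + 1)`, of weight `deg P`. The
-- bound `n` only keeps the range of summation finite and fixed through the induction.
open Classical in
theorem sum_vonMangoldt_divisors {f : F[X]} (hf : f.Monic) {n : ℕ} (hn : f.natDegree ≤ n) :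
    ∑ d ∈ (monicsLE F n).filter (· ∣ f), vonMangoldt d = f.natDegree := by
  induction hm : f.natDegree using Nat.strong_induction_on generalizing f with
  | _ m ih =>
  rcases Nat.eq_zero_or_pos m with h0 | hpos
  · subst h0
    obtain rfl := hf.natDegree_eq_zero.1 hm
    rw [Nat.cast_zero]
    refine Finset.sum_eq_zero fun d hd => ?_
    rw [Finset.mem_filter, mem_monicsLE] at hd
    rw [hd.1.1.eq_one_of_isUnit (isUnit_of_dvd_one hd.2), vonMangoldt_one]
  obtain ⟨P, hPi, hPm, g, rfl⟩ : ∃ P : F[X], Irreducible P ∧ P.Monic ∧ P ∣ f := by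
    obtain ⟨P, h1, h2, h3⟩ := exists_monic_irreducible_factor f
      (fun hu => by have := natDegree_eq_zero_of_isUnit hu; omega)
    exact ⟨P, h2, h1, h3⟩
  have hg : g.Monic := hPm.of_mul_monic_left hf
  have hdeg : (P * g).natDegree = P.natDegree + g.natDegree := hPm.natDegree_mul hg
  have hPpos : 0 < P.natDegree := hPi.natDegree_pos
  have IH := ih g.natDegree (by omega) hg (by omega) rfl
  have hsub : (monicsLE F n).filter (· ∣ g) ⊆ (monicsLE F n).filter (· ∣ P * g) := by
    intro d hd
    rw [Finset.mem_filter] at hd ⊢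
    exact ⟨hd.1, hd.2.mul_left P⟩
  rw [← Finset.sum_sdiff hsub, IH]
  obtain ⟨v, hv, hv'⟩ : ∃ v, P ^ v ∣ g ∧ ¬ P ^ (v + 1) ∣ g := by
    obtain ⟨c, h1, h2⟩ := (FiniteMultiplicity.of_not_isUnit hPi.not_isUnit
      hg.ne_zero).exists_eq_pow_mul_and_not_dvd
    refine ⟨_, ⟨c, h1⟩, ?_⟩
    exact (FiniteMultiplicity.of_not_isUnit hPi.not_isUnit hg.ne_zero).not_pow_dvd_of_multiplicity_lt
      (Nat.lt_succ_self _)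
  rw [Finset.sum_eq_single (P ^ (v + 1))]
  · rw [vonMangoldt_pow hPm hPi (Nat.succ_pos v), ← hm, hdeg]
    push_cast
    ring
  · intro d hd hne
    rw [Finset.mem_sdiff, Finset.mem_filter, Finset.mem_filter] at hd
    obtain ⟨⟨h1, h2⟩, h3⟩ := hd
    have h4 : ¬ d ∣ g := fun h => h3 ⟨h1, h⟩
    rw [vonMangoldt, dif_neg]
    rintro ⟨Q, hQm, hQi, k, hk, rfl⟩
    by_cases hQP : Q = P
    · subst hQP
      obtain ⟨k, rfl⟩ : ∃ j, k = j + 1 := ⟨k - 1, by omega⟩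
      have h5 : Q ^ k ∣ g := by
        rw [pow_succ'] at h2
        exact (mul_dvd_mul_iff_left hQi.ne_zero).1 h2
      have h6 : k = v := by
        apply le_antisymm
        · by_contra h
          exact hv' ((pow_dvd_pow Q (by omega)).trans h5)
        · by_contra h
          exact h4 ((pow_dvd_pow Q (by omega)).trans hv)
      exact hne (by rw [h6])
    · have hc : IsCoprime Q P := by
        rw [hQi.coprime_iff_not_dvd]
        intro hd
        exact hQP (eq_of_monic_of_associated hQm hPm (hQi.associated_of_dvd hPi hd))
      exact h4 (hc.pow_left.dvd_of_dvd_mul_left h2)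
  · intro h
    exfalso
    apply h
    have h5 : P ^ (v + 1) ∣ P * g := by rw [pow_succ']; exact mul_dvd_mul_left P hv
    rw [Finset.mem_sdiff, Finset.mem_filter, Finset.mem_filter, mem_monicsLE]
    refine ⟨⟨⟨hPm.pow _, (natDegree_le_of_dvd h5 hf.ne_zero).trans hn⟩, h5⟩, fun h => hv' h.2⟩

/-- The logarithmic derivative of the `L`-function of `χ`, coefficientwise. -/
theorem sum_antidiagonal_mangoldtSum {ℓ : ℕ} {χ : F[X] → ℂ} (hχ : IsLevelChar ℓ χ) (n : ℕ) :
    ∑ ij ∈ Finset.HasAntidiagonal.antidiagonal n, mangoldtSum χ ij.1 * charSum χ ij.2 = n * charSum χ n := by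
  classical
  -- A pair of monic polynomials of degrees i and j is the same as a polynomial of degree n with a
  -- chosen divisor of degree i.
  have key : ∀ i j, i + j = n → mangoldtSum χ i * charSum χ j =
      ∑ d ∈ monics F i, ∑ f ∈ monics F n, if d ∣ f then (vonMangoldt d : ℂ) * χ f else 0 := by
    intro i j hij
    rw [mangoldtSum, Finset.sum_mul]
    refine Finset.sum_congr rfl fun d hd => ?_
    rw [mem_monics] at hd
    rw [← Finset.sum_filter, charSum, Finset.mul_sum]
    refine Finset.sum_bij (fun e _ => d * e) ?_ ?_ ?_ ?_
    · intro e he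
      rw [mem_monics] at he
      rw [Finset.mem_filter, mem_monics]
      exact ⟨⟨hd.1.mul he.1, by rw [hd.1.natDegree_mul he.1]; omega⟩, dvd_mul_right _ _⟩
    · intro e he e' he' h
      exact mul_left_cancel₀ hd.1.ne_zero h
    · intro f hf
      rw [Finset.mem_filter, mem_monics] at hf
      obtain ⟨⟨hf, hfn⟩, e, rfl⟩ := hf
      have he := hd.1.of_mul_monic_left hf
      refine ⟨e, ?_, rfl⟩
      rw [hd.1.natDegree_mul he] at hfn
      exact mem_monics.2 ⟨he, by omega⟩
    · intro e he
      rw [mem_monics] at he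
      rw [hχ.map_mul hd.1 he.1, mul_assoc]
  rw [Finset.sum_congr rfl fun ij hij => key ij.1 ij.2 (Finset.HasAntidiagonal.mem_antidiagonal.1 hij)]
  rw [Finset.Nat.sum_antidiagonal_eq_sum_range_succ
    (fun i _ => ∑ d ∈ monics F i, ∑ f ∈ monics F n,
      if d ∣ f then (vonMangoldt d : ℂ) * χ f else 0)]
  have : ∑ i ∈ Finset.range (n + 1), ∑ d ∈ monics F i, ∑ f ∈ monics F n,
      (if d ∣ f then (vonMangoldt d : ℂ) * χ f else 0) =
      ∑ d ∈ monicsLE F n, ∑ f ∈ monics F n,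
      (if d ∣ f then (vonMangoldt d : ℂ) * χ f else 0) := by
    rw [monicsLE, Finset.sum_biUnion]
    intro i _ j _ hij
    rw [Function.onFun, Finset.disjoint_left]
    intro f hf hf'
    rw [mem_monics] at hf hf'
    exact hij (hf.2.symm.trans hf'.2)
  rw [this, Finset.sum_comm, charSum, Finset.mul_sum]
  refine Finset.sum_congr rfl fun f hf => ?_
  rw [mem_monics] at hf
  rw [← Finset.sum_filter, ← Finset.sum_mul, ← Complex.ofReal_sum,
    sum_vonMangoldt_divisors hf.1 hf.2.le, hf.2]
  push_cast
  rfl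

theorem mangoldtSum_zero (χ : F[X] → ℂ) : mangoldtSum χ 0 = 0 := by
  simp [mangoldtSum, monics_zero, vonMangoldt_one]

theorem charSum_zero {ℓ : ℕ} {χ : F[X] → ℂ} (hχ : IsLevelChar ℓ χ) : charSum χ 0 = 1 := by
  simp [charSum, monics_zero, hχ.map_one]

theorem mangoldtSum_one {ℓ : ℕ} {χ : F[X] → ℂ} (hχ : IsLevelChar ℓ χ) :
    mangoldtSum χ 1 = charSum χ 1 := by
  have := sum_antidiagonal_mangoldtSum hχ 1
  simpa [Finset.Nat.antidiagonal_succ, mangoldtSum_zero, charSum_zero hχ] using this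

/-- The character sums of a nontrivial character of level `ℓ` vanish in degrees `≥ ℓ`. -/
theorem charSum_eq_zero {ℓ : ℕ} {χ : F[X] → ℂ} (hχ : IsLevelChar ℓ χ) {g : F[X]}
    (hg : g.Monic) (hne : χ g ≠ 1) {n : ℕ} (hn : ℓ ≤ n) : charSum χ n = 0 := by
  classical
  set m := g.natDegree with hm
  have hXm : (X ^ m : F[X]).Monic := monic_X_pow m
  -- Multiplying by `g` and discarding the `m` lowest coefficients permutes the monic polynomials of
  -- degree `n`. As `ℓ ≤ n`, the discarded remainder, of degree below `m`, does not reach the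
  -- coefficients that determine the class. Hence the sum equals `χ g` times itself.
  have hquot : ∀ f ∈ monics F n, (f * g /ₘ X ^ m).Monic ∧ (f * g /ₘ X ^ m).natDegree = n ∧
      Agree ℓ (f * g /ₘ X ^ m) (f * g) := by
    intro f hf
    rw [mem_monics] at hf
    have hfg : (f * g).natDegree = n + m := by rw [hf.1.natDegree_mul hg, hf.2]
    have hd : (f * g /ₘ X ^ m).natDegree = n := by
      rw [natDegree_divByMonic _ hXm, hfg, natDegree_X_pow]; omega
    have hmon : (f * g /ₘ X ^ m).Monic := by
      rw [Monic, leadingCoeff_divByMonic_of_monic hXm, (hf.1.mul hg).leadingCoeff]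
      rw [degree_X_pow, degree_eq_natDegree (hf.1.mul hg).ne_zero, hfg]
      exact_mod_cast Nat.le_add_left m n
    refine ⟨hmon, hd, ?_⟩
    refine (agree_X_pow_mul ℓ m _).symm.trans ?_
    refine agree_of_degree_sub_lt (n := n + m) ?_ hfg ?_
    · rw [(hXm).natDegree_mul hmon, hd, natDegree_X_pow, add_comm]
    · intro j hj _
      have e := congrArg (fun p => coeff p (n + m - j)) (modByMonic_add_div (f * g) (X ^ m))
      simp only [coeff_add] at e
      have h0 : (f * g %ₘ X ^ m).coeff (n + m - j) = 0 := by
        refine coeff_eq_zero_of_degree_lt ((degree_modByMonic_lt _ hXm).trans_le ?_)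
        rw [degree_X_pow]
        exact_mod_cast (by omega)
      rw [← e, h0, zero_add]
  have hinj : ∀ f ∈ monics F n, ∀ f' ∈ monics F n, f * g /ₘ X ^ m = f' * g /ₘ X ^ m → f = f' := by
    intro f hf f' hf' h
    by_contra hff
    have e := modByMonic_add_div (f * g) (X ^ m)
    have e' := modByMonic_add_div (f' * g) (X ^ m)
    have hsub : (f - f') * g = f * g %ₘ X ^ m - f' * g %ₘ X ^ m := by
      rw [h] at e
      linear_combination e' - e
    have hlt : ((f - f') * g).degree < m := by
      rw [hsub]
      refine (degree_sub_le _ _).trans_lt (max_lt ?_ ?_)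
      · simpa using degree_modByMonic_lt (f * g) hXm
      · simpa using degree_modByMonic_lt (f' * g) hXm
    rw [degree_mul, degree_eq_natDegree (sub_ne_zero.2 hff), degree_eq_natDegree hg.ne_zero] at hlt
    norm_cast at hlt
    omega
  have hbij : charSum χ n = χ g * charSum χ n := by
    have himg : (monics F n).image (fun f => f * g /ₘ X ^ m) = monics F n := by
      apply Finset.eq_of_subset_of_card_le
      · intro f hf
        rw [Finset.mem_image] at hf
        obtain ⟨f, hf, rfl⟩ := hf
        exact mem_monics.2 ⟨(hquot f hf).1, (hquot f hf).2.1⟩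
      · rw [Finset.card_image_of_injOn (fun f hf f' hf' => hinj f hf f' hf')]
    conv_lhs => rw [charSum, ← himg]
    rw [Finset.sum_image (fun f hf f' hf' => hinj f hf f' hf'), charSum, Finset.mul_sum]
    refine Finset.sum_congr rfl fun f hf => ?_
    have hfm := (mem_monics.1 hf).1
    rw [hχ.congr (hquot f hf).1 (hfm.mul hg) (hquot f hf).2.2, hχ.map_mul hfm hg, mul_comm]
  have : (1 - χ g) * charSum χ n = 0 := by linear_combination hbij
  rcases mul_eq_zero.1 this with h | h
  · exact absurd (sub_eq_zero.1 h).symm hne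
  · exact h

end ShortInterval
end

noncomputable section
namespace ShortInterval

/-! ### Power sums and factorization of `L`-polynomials -/

theorem exists_multiset_prod_one_sub (n : ℕ) : ∀ L : ℂ[X], L.natDegree = n → L.coeff 0 = 1 →
    ∃ s : Multiset ℂ, (∀ α ∈ s, α ≠ 0 ∧ L.eval α⁻¹ = 0) ∧
      L = (s.map fun α => 1 - C α * X).prod := by
  induction n with
  | zero =>
    intro L hL h0
    refine ⟨0, by simp, ?_⟩
    rw [eq_C_of_natDegree_eq_zero hL, h0]
    simp
  | succ n ih =>
    intro L hL h0
    obtain ⟨r, hr⟩ := IsAlgClosed.exists_root L (by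
      intro h
      have := natDegree_eq_of_degree_eq_some (n := 0) h
      omega)
    have hr0 : r ≠ 0 := by
      rintro rfl
      rw [IsRoot, ← coeff_zero_eq_eval_zero, h0] at hr
      exact one_ne_zero hr
    obtain ⟨L', rfl⟩ := dvd_iff_isRoot.2 hr
    have hne : (X - C r) * L' ≠ 0 := fun h => by rw [h] at h0; simp at h0
    have hfac : (X - C r) * L' = (1 - C r⁻¹ * X) * (C (-r) * L') := by
      have : (C r⁻¹ * C r : ℂ[X]) = 1 := by rw [← C_mul, inv_mul_cancel₀ hr0, C_1]
      rw [C_neg]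
      linear_combination (-X * L') * this
    have hd : (C (-r) * L').natDegree = n := by
      rw [natDegree_C_mul (neg_ne_zero.2 hr0)]
      rw [natDegree_mul (X_sub_C_ne_zero r) (right_ne_zero_of_mul hne), natDegree_X_sub_C] at hL
      omega
    have h0' : (C (-r) * L').coeff 0 = 1 := by
      rw [mul_coeff_zero] at h0 ⊢
      simpa using h0
    obtain ⟨s, hs, hprod⟩ := ih _ hd h0'
    refine ⟨r⁻¹ ::ₘ s, ?_, ?_⟩
    · intro α hα
      rcases Multiset.mem_cons.1 hα with rfl | hα
      · exact ⟨inv_ne_zero hr0, by simp⟩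
      · refine ⟨(hs α hα).1, ?_⟩
        rw [hfac, eval_mul, (hs α hα).2, mul_zero]
    · rw [Multiset.map_cons, Multiset.prod_cons, ← hprod, hfac]

/-- The power series of power sums of a multiset, without constant term. -/
def powerSumSeries (s : Multiset ℂ) : PowerSeries ℂ :=
  PowerSeries.mk fun n => if n = 0 then 0 else (s.map (· ^ n)).sum

theorem powerSumSeries_cons (α : ℂ) (s : Multiset ℂ) :
    powerSumSeries (α ::ₘ s) = powerSumSeries {α} + powerSumSeries s := by
  ext n
  by_cases h : n = 0 <;> simp [powerSumSeries, h]

theorem powerSumSeries_singleton_mul (α : ℂ) :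
    powerSumSeries {α} * (1 - PowerSeries.C α * PowerSeries.X) =
      PowerSeries.C α * PowerSeries.X := by
  ext n
  have e : powerSumSeries {α} * (1 - PowerSeries.C α * PowerSeries.X) =
    powerSumSeries {α} - PowerSeries.C α * (powerSumSeries {α} * PowerSeries.X) := by ring
  rw [e, map_sub, PowerSeries.coeff_C_mul, PowerSeries.coeff_C_mul, PowerSeries.coeff_X]
  rcases n with _ | _ | n
  · simp [powerSumSeries]
  · rw [PowerSeries.coeff_succ_mul_X]
    simp [powerSumSeries]
  · rw [PowerSeries.coeff_succ_mul_X]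
    simp [powerSumSeries]
    ring

/-- Logarithmic differentiation: each factor `1 - α X` contributes minus the geometric series of the
`α ^ n X ^ n`, and the contributions add. -/
theorem X_mul_derivative_prod (s : Multiset ℂ) :
    PowerSeries.X * PowerSeries.derivative ℂ
        (s.map fun α => 1 - PowerSeries.C α * PowerSeries.X).prod =
      -powerSumSeries s * (s.map fun α => 1 - PowerSeries.C α * PowerSeries.X).prod := by
  induction s using Multiset.induction with
  | empty =>
    have : powerSumSeries 0 = 0 := by ext n; simp [powerSumSeries]
    simp [this]
  | cons α s ih =>
    rw [Multiset.map_cons, Multiset.prod_cons, Derivation.leibniz, powerSumSeries_cons]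
    have h1 : PowerSeries.derivative ℂ (1 - PowerSeries.C α * PowerSeries.X) =
        -PowerSeries.C α := by
      rw [map_sub, Derivation.leibniz, PowerSeries.derivative_C, PowerSeries.derivative_X]
      simp
    rw [h1, smul_eq_mul, smul_eq_mul]
    linear_combination (1 - PowerSeries.C α * PowerSeries.X) * ih +
      (s.map fun α => 1 - PowerSeries.C α * PowerSeries.X).prod * powerSumSeries_singleton_mul α

/-- Vandermonde independence: pass from powers to polynomials without constant term and test against
one vanishing at all other elements. What survives is `w α` times a positive multiplicity and a
nonzero value. -/
theorem weight_eq_zero_of_forall_sum_pow {s : Multiset ℂ} {w : ℂ → ℂ}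
    (h : ∀ n, 0 < n → (s.map fun α => w α * α ^ n).sum = 0) {α : ℂ} (hα : α ∈ s) (h0 : α ≠ 0) :
    w α = 0 := by
  classical
  have hP : ∀ P : ℂ[X], (s.map fun α => w α * (α * P.eval α)).sum = 0 := by
    intro P
    induction P using Polynomial.induction_on' with
    | add P Q hP hQ =>
      simp only [eval_add, mul_add, Multiset.sum_map_add, hP, hQ, add_zero]
    | monomial n a =>
      have := congrArg (a * ·) (h (n + 1) n.succ_pos)
      simp only [mul_zero, ← Multiset.sum_map_mul_left] at this
      rw [← this]
      congr 1
      refine Multiset.map_congr rfl fun β _ => ?_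
      rw [eval_monomial]
      ring
  have := hP (∏ β ∈ s.toFinset.erase α, (X - C β))
  rw [Finset.sum_multiset_map_count, Finset.sum_eq_single_of_mem α (Multiset.mem_toFinset.2 hα)]
    at this
  · rw [eval_prod, nsmul_eq_mul] at this
    have h1 : (s.count α : ℂ) ≠ 0 := by
      exact_mod_cast (Multiset.count_pos.2 hα).ne'
    have h2 : ∏ β ∈ s.toFinset.erase α, (X - C β).eval α ≠ 0 := by
      rw [Finset.prod_ne_zero_iff]
      intro β hβ
      rw [eval_sub, eval_X, eval_C, sub_ne_zero]
      exact (Finset.ne_of_mem_erase hβ).symm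
    exact (mul_eq_zero.1 ((mul_eq_zero.1 this).resolve_left h1)).resolve_right (mul_ne_zero h0 h2)
  · intro β hβ hne
    have : (∏ β ∈ s.toFinset.erase α, (X - C β)).eval β = 0 := by
      rw [eval_prod]
      exact Finset.prod_eq_zero (Finset.mem_erase.2 ⟨hne, hβ⟩) (by simp)
    rw [this]
    simp

variable {F : Type*} [Field F] [Finite F]

/-- `charSum_eq_zero` truncates the L-series to a polynomial with constant term 1. The von Mangoldt
identity says that `X L' = B L`, with `B` the generating series of the `mangoldtSum χ n`, and
`X_mul_derivative_prod` computes the same logarithmic derivative from the factorization. -/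
theorem exists_inverse_roots {ℓ : ℕ} {χ : F[X] → ℂ} (hχ : IsLevelChar ℓ χ)
    (hne : ∃ g : F[X], g.Monic ∧ χ g ≠ 1) :
    ∃ s : Multiset ℂ, (∀ α ∈ s, α ≠ 0 ∧ ∑ i ∈ Finset.range ℓ, charSum χ i * α⁻¹ ^ i = 0) ∧
      ∀ n, 0 < n → mangoldtSum χ n = -(s.map (· ^ n)).sum := by
  obtain ⟨g, hg, hg1⟩ := hne
  have hvan : ∀ n, ℓ ≤ n → charSum χ n = 0 := fun n hn => charSum_eq_zero hχ hg hg1 hn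
  set L : ℂ[X] := ∑ i ∈ Finset.range ℓ, monomial i (charSum χ i) with hL
  have hcoeff : ∀ n, L.coeff n = charSum χ n := by
    intro n
    simp only [hL, finsetSum_coeff, coeff_monomial, Finset.sum_ite_eq', Finset.mem_range]
    split_ifs with h
    · rfl
    · exact (hvan n (by omega)).symm
  obtain ⟨s, hs, hprod⟩ := exists_multiset_prod_one_sub _ L rfl
    (by rw [hcoeff, charSum_zero hχ])
  refine ⟨s, fun α hα => ⟨(hs α hα).1, ?_⟩, ?_⟩
  · have := (hs α hα).2
    simpa [hL, eval_finsetSum] using this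
  · have hps : (L : PowerSeries ℂ) =
        (s.map fun α => 1 - PowerSeries.C α * PowerSeries.X).prod := by
      conv_lhs => rw [hprod]
      rw [← Polynomial.coeToPowerSeries.ringHom_apply, map_multiset_prod, Multiset.map_map]
      congr 1
      refine Multiset.map_congr rfl fun α _ => ?_
      simp
    have hB : PowerSeries.mk (mangoldtSum χ) * (L : PowerSeries ℂ) =
        PowerSeries.X * PowerSeries.derivative ℂ (L : PowerSeries ℂ) := by
      ext n
      rw [PowerSeries.coeff_mul]
      simp only [PowerSeries.coeff_mk, Polynomial.coeff_coe, hcoeff]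
      rw [sum_antidiagonal_mangoldtSum hχ n]
      cases n with
      | zero => simp
      | succ n =>
        rw [PowerSeries.coeff_succ_X_mul, PowerSeries.coeff_derivative, Polynomial.coeff_coe,
          hcoeff]
        push_cast
        ring
    rw [hps, X_mul_derivative_prod] at hB
    have hL0 : (s.map fun α => 1 - PowerSeries.C α * PowerSeries.X).prod ≠ 0 := by
      rw [← hps]
      intro h
      have h1 := congrArg (PowerSeries.coeff 0) h
      rw [Polynomial.coeff_coe, hcoeff, charSum_zero hχ] at h1
      simp at h1
    have hB' := mul_right_cancel₀ hL0 hB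
    intro n hn
    have h1 := congrArg (PowerSeries.coeff n) hB'
    simpa [powerSumSeries, hn.ne'] using h1

/-- The prime polynomial theorem. Here `charSum χ m` is `q ^ m`, and subtracting q times the von
Mangoldt identity in degree m from the one in degree m + 1 leaves `(m + 1) q ^ (m + 1) - m q ^ (m +
1)`. -/
theorem mangoldtSum_of_trivial {χ : F[X] → ℂ} (h : ∀ f : F[X], f.Monic → χ f = 1) {n : ℕ}
    (hn : 0 < n) : mangoldtSum χ n = (Nat.card F : ℂ) ^ n := by
  have hχ : IsLevelChar 0 χ := ⟨h 1 monic_one, fun hf hg => by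
    rw [h _ hf, h _ hg, h _ (hf.mul hg), one_mul], fun hf hg _ => by rw [h _ hf, h _ hg]⟩
  have hc : ∀ m, charSum χ m = (Nat.card F : ℂ) ^ m := by
    intro m
    rw [charSum, Finset.sum_congr rfl fun f hf => h f (mem_monics.1 hf).1]
    simp [card_monics]
  obtain ⟨m, rfl⟩ : ∃ m, n = m + 1 := ⟨n - 1, by omega⟩
  have h1 := sum_antidiagonal_mangoldtSum hχ (m + 1)
  have h2 := sum_antidiagonal_mangoldtSum hχ m
  simp only [hc] at h1 h2
  rw [Finset.Nat.sum_antidiagonal_succ'] at h1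
  simp only [pow_zero, mul_one] at h1
  have h3 : ∑ p ∈ Finset.HasAntidiagonal.antidiagonal m,
      mangoldtSum χ p.1 * (Nat.card F : ℂ) ^ (p.2 + 1) = (Nat.card F : ℂ) * (m * Nat.card F ^ m) := by
    rw [← h2, Finset.mul_sum]
    refine Finset.sum_congr rfl fun p _ => by ring
  rw [h3] at h1
  push_cast at h1
  linear_combination h1

-- Sum `charSum (levelChar ψ) ℓ` over all ψ in two ways. Only the trivial character contributes,
-- giving `q ^ ℓ`; by orthogonality only `X ^ ℓ` contributes, giving the order of the group.
variable (F) in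
theorem card_classGrp (ℓ : ℕ) : (Nat.card (ClassGrp F ℓ) : ℂ) = (Nat.card F : ℂ) ^ ℓ := by
  classical
  have h : ∑ ψ : AddChar (Additive (ClassGrp F ℓ)) ℂ, charSum (levelChar ψ) ℓ =
      (Nat.card F : ℂ) ^ ℓ := by
    rw [Finset.sum_eq_single 1]
    · rw [charSum, Finset.sum_congr rfl fun f hf =>
        (levelChar_eq_one_iff 1).2 rfl f (mem_monics.1 hf).1]
      simp [card_monics]
    · intro ψ _ hψ
      have : ¬ ∀ f : F[X], f.Monic → levelChar ψ f = 1 := fun h =>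
        hψ ((levelChar_eq_one_iff ψ).1 h)
      push Not at this
      obtain ⟨g, hg, hg1⟩ := this
      exact charSum_eq_zero (isLevelChar_levelChar ψ) hg hg1 le_rfl
    · simp
  rw [← h]
  simp only [charSum]
  rw [Finset.sum_comm, Finset.sum_congr rfl fun f hf => sum_levelChar ℓ (mem_monics.1 hf).1,
    Finset.sum_eq_single (X ^ ℓ)]
  · rw [if_pos]
    simpa using agree_X_pow_mul ℓ ℓ (1 : F[X])
  · intro f hf hne
    rw [if_neg]
    intro hag
    apply hne
    rw [mem_monics] at hf
    have := (hag.trans (agree_X_pow_mul ℓ ℓ (1 : F[X])).symm)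
    rw [mul_one] at this
    ext i
    rcases le_or_gt i ℓ with hi | hi
    · have := this.coeff_eq hf.2 (natDegree_X_pow ℓ) (ℓ - i) (by omega) (by omega)
      rwa [Nat.sub_sub_self hi] at this
    · rw [coeff_eq_zero_of_natDegree_lt (by omega),
        coeff_eq_zero_of_natDegree_lt (by rw [natDegree_X_pow]; omega)]
  · intro h
    exact absurd (mem_monics.2 ⟨monic_X_pow ℓ, natDegree_X_pow ℓ⟩) h

open Classical in
theorem psi_zero_eq_sum (ℓ n : ℕ) :
    psi n (fun _ : Fin ℓ => (0 : F)) =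
      ∑ f ∈ monics F n, if Agree ℓ f 1 then vonMangoldt f else 0 := by
  rw [psi, ← Finset.sum_filter]
  congr 1
  ext f
  simp only [Set.Finite.mem_toFinset, monicPrescribed, Set.mem_ofPred_eq, Finset.mem_filter,
    mem_monics, and_assoc]
  refine and_congr_right fun hf => and_congr_right fun _ => ?_
  have h1 : (1 : F[X]).reverse = 1 := by simpa using reverse_C (1 : F)
  simp only [agree_iff, nextToLeading_eq_coeff_reverse, h1, coeff_one]
  constructor
  · intro h j hj
    rcases j with _ | j
    · simp [hf.leadingCoeff]
    · simpa using h ⟨j, by omega⟩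
  · intro h i
    simpa using h (i + 1) (by omega)

theorem sum_mangoldtSum (ℓ n : ℕ) :
    ∑ ψ : AddChar (Additive (ClassGrp F ℓ)) ℂ, mangoldtSum (levelChar ψ) n =
      (Nat.card F : ℂ) ^ ℓ * psi n (fun _ : Fin ℓ => (0 : F)) := by
  classical
  simp only [mangoldtSum]
  rw [Finset.sum_comm, psi_zero_eq_sum, Complex.ofReal_sum, Finset.mul_sum]
  refine Finset.sum_congr rfl fun f hf => ?_
  rw [← Finset.mul_sum, sum_levelChar ℓ (mem_monics.1 hf).1, card_classGrp]
  split_ifs <;> push_cast <;> ring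

-- The trivial character contributes exactly the subtracted main term, so only nontrivial characters
-- remain.
open Classical in
theorem normalizedPsi_eq (ℓ : ℕ) (n : ℕ+) :
    (normalizedPsi F ℓ n : ℂ) = ((Nat.card F : ℂ) ^ ℓ)⁻¹ *
      ∑ ψ ∈ (Finset.univ : Finset (AddChar (Additive (ClassGrp F ℓ)) ℂ)).erase 1,
        mangoldtSum (levelChar ψ) n / ((√(Nat.card F) : ℝ) : ℂ) ^ (n : ℕ) := by
  have hq : (0 : ℝ) < Nat.card F := by exact_mod_cast Nat.card_pos
  have hq' : (Nat.card F : ℂ) ≠ 0 := by exact_mod_cast hq.ne'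
  have h1 := sum_mangoldtSum (F := F) ℓ n
  rw [← Finset.add_sum_erase _ _ (Finset.mem_univ 1),
    mangoldtSum_of_trivial ((levelChar_eq_one_iff 1).2 rfl) n.pos] at h1
  have h2 : (Nat.card F : ℝ) ^ (((n : ℕ) : ℝ) / 2) = √(Nat.card F) ^ (n : ℕ) := by
    rw [Real.sqrt_eq_rpow, ← Real.rpow_natCast, ← Real.rpow_mul hq.le]
    congr 1
    ring
  rw [← Finset.sum_div, eq_sub_iff_add_eq'.2 h1, normalizedPsi, h2]
  push_cast
  rw [zpow_sub₀ hq', zpow_natCast, zpow_natCast]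
  field_simp

/-- Periodicity of the total is equivalent to a recurrence for each character separately. The
inverse roots of different characters all enter with the same coefficient, so they cannot cancel,
and each normalized root must be an N-th root of unity. -/
theorem periodic_normalizedPsi_iff (ℓ : ℕ) (N : ℕ+) :
    Function.Periodic (normalizedPsi F ℓ) N ↔
      ∀ χ : F[X] → ℂ, IsLevelChar ℓ χ → (∃ g : F[X], g.Monic ∧ χ g ≠ 1) → ∀ n, 0 < n →
        mangoldtSum χ (n + N) = ((√(Nat.card F) : ℝ) : ℂ) ^ (N : ℕ) * mangoldtSum χ n := by
  classical
  have hq : (0 : ℝ) < Nat.card F := by exact_mod_cast Nat.card_pos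
  have hs : ((√(Nat.card F) : ℝ) : ℂ) ≠ 0 := by exact_mod_cast (Real.sqrt_pos.2 hq).ne'
  have hq' : ((Nat.card F : ℂ) ^ ℓ)⁻¹ ≠ 0 :=
    inv_ne_zero (pow_ne_zero _ (by exact_mod_cast hq.ne'))
  have hnontriv : ∀ ψ : AddChar (Additive (ClassGrp F ℓ)) ℂ, ψ ≠ 1 →
      ∃ g : F[X], g.Monic ∧ levelChar ψ g ≠ 1 := by
    intro ψ hψ
    by_contra h
    push Not at h
    exact hψ ((levelChar_eq_one_iff ψ).1 h)
  constructor
  · intro hper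
    choose! s hs0 hsum using fun (ψ : AddChar (Additive (ClassGrp F ℓ)) ℂ) (hψ : ψ ≠ 1) =>
      exists_inverse_roots (isLevelChar_levelChar ψ) (hnontriv ψ hψ)
    set E := (Finset.univ : Finset (AddChar (Additive (ClassGrp F ℓ)) ℂ)).erase 1 with hE
    set β : ℂ → ℂ := fun α => α / ((√(Nat.card F) : ℝ) : ℂ) with hβ
    -- All normalized inverse roots of all nontrivial characters, pooled with multiplicity.
    set S : Multiset ℂ := ∑ ψ ∈ E, (s ψ).map β with hS
    have hmapsum : ∀ g : ℂ → ℂ, (S.map g).sum = ∑ ψ ∈ E, ((s ψ).map (g ∘ β)).sum := by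
      intro g
      have := map_sum ((Multiset.sumAddMonoidHom (M := ℂ)).comp (Multiset.mapAddMonoidHom g))
        (fun ψ => (s ψ).map β) E
      simp only [AddMonoidHom.comp_apply, Multiset.coe_sumAddMonoidHom,
        Multiset.coe_mapAddMonoidHom, Multiset.map_map] at this
      exact this
    have hval : ∀ n : ℕ+, (S.map (· ^ (n : ℕ))).sum =
        -((Nat.card F : ℂ) ^ ℓ) * normalizedPsi F ℓ n := by
      intro n
      rw [normalizedPsi_eq, ← mul_assoc, neg_mul, mul_inv_cancel₀ (by simpa using hq'), hmapsum,
        neg_one_mul, ← Finset.sum_neg_distrib]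
      refine Finset.sum_congr rfl fun ψ hψ => ?_
      rw [hsum ψ (Finset.ne_of_mem_erase hψ) n n.pos, neg_div, neg_neg, div_eq_mul_inv,
        ← Multiset.sum_map_mul_right]
      congr 1
      refine Multiset.map_congr rfl fun α _ => ?_
      simp only [Function.comp, hβ, div_pow]
      rw [div_eq_mul_inv]
    have hroot : ∀ b ∈ S, b ^ (N : ℕ) - 1 = 0 := by
      intro b hb
      refine weight_eq_zero_of_forall_sum_pow (s := S) (w := fun b => b ^ (N : ℕ) - 1) ?_ hb ?_
      · intro n hn
        obtain ⟨m, rfl⟩ : ∃ m : ℕ+, (m : ℕ) = n := ⟨⟨n, hn⟩, rfl⟩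
        have h1 := hval (m + N)
        rw [hper m, ← hval m] at h1
        rw [← sub_eq_zero, ← Multiset.sum_map_sub] at h1
        rw [← h1]
        congr 1
        refine Multiset.map_congr rfl fun b _ => ?_
        rw [PNat.add_coe]
        ring
      · rw [hS, Multiset.mem_sum] at hb
        obtain ⟨ψ, hψ, hb⟩ := hb
        obtain ⟨α, hα, rfl⟩ := Multiset.mem_map.1 hb
        exact div_ne_zero (hs0 ψ (Finset.ne_of_mem_erase hψ) α hα).1 hs
    intro χ hχ hne n hn
    obtain ⟨ψ, hψ⟩ := hχ.exists_levelChar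
    have hψ1 : ψ ≠ 1 := by
      rintro rfl
      obtain ⟨g, hg, hg1⟩ := hne
      exact hg1 ((hψ g hg).symm.trans ((levelChar_eq_one_iff 1).2 rfl g hg))
    have hsame : ∀ m, mangoldtSum χ m = mangoldtSum (levelChar ψ) m := by
      intro m
      refine Finset.sum_congr rfl fun f hf => ?_
      rw [hψ f (mem_monics.1 hf).1]
    rw [hsame, hsame, hsum ψ hψ1 _ (by omega), hsum ψ hψ1 n hn, mul_neg, neg_inj,
      ← Multiset.sum_map_mul_left]
    congr 1
    refine Multiset.map_congr rfl fun α hα => ?_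
    have := hroot (β α) (by
      rw [hS, Multiset.mem_sum]
      exact ⟨ψ, Finset.mem_erase.2 ⟨hψ1, Finset.mem_univ _⟩, Multiset.mem_map_of_mem _ hα⟩)
    simp only [hβ, div_pow] at this
    rw [sub_eq_zero, div_eq_one_iff_eq (pow_ne_zero _ hs)] at this
    rw [pow_add, this, mul_comm]
  · intro h n
    rw [← Complex.ofReal_inj, normalizedPsi_eq, normalizedPsi_eq]
    congr 1
    refine Finset.sum_congr rfl fun ψ hψ => ?_
    rw [PNat.add_coe, h _ (isLevelChar_levelChar ψ) (hnontriv ψ (Finset.ne_of_mem_erase hψ)) n n.pos,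
      pow_add]
    field_simp

/-- Differences of periods are periods, so the Euclidean argument shows that the least one divides
all. -/
theorem exists_isThePeriod_dvd {g : ℕ+ → ℝ} {M : ℕ+} (h : Function.Periodic g M) :
    ∃ N : ℕ+, IsThePeriod g N ∧ (N : ℕ) ∣ M := by
  classical
  have hex : ∃ N : ℕ+, Function.Periodic g N := ⟨M, h⟩
  refine ⟨PNat.find hex, ⟨PNat.find_spec hex, fun m hm => PNat.find_min' hex hm⟩, ?_⟩
  set N := PNat.find hex
  have hN : Function.Periodic g N := PNat.find_spec hex
  induction hk : (M : ℕ) using Nat.strong_induction_on generalizing M with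
  | _ k ih =>
  have hle : N ≤ M := PNat.find_min' hex h
  rcases hle.eq_or_lt with heq | hlt
  · rw [← hk, heq]
  · have h1 : (M - N : ℕ+) + N = M := PNat.sub_add_of_lt hlt
    have h2 : Function.Periodic g ((M - N : ℕ+)) := by
      intro x
      rw [← hN, add_assoc, h1, h]
    have h3 : ((M - N : ℕ+) : ℕ) + N = M := by rw [← PNat.add_coe, h1]
    have := ih ((M - N : ℕ+) : ℕ) (by have := N.pos; omega) h2 rfl
    rw [← hk, ← h3]
    exact Nat.dvd_add this dvd_rfl

end ShortInterval
end

noncomputable section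
namespace ShortInterval

/-! ### Base change of characters -/

section Frobenius

variable (k K : Type*) [Field k] [Finite k] [Field K] [Algebra k K]

/-- The map `x ↦ x ^ #k` on an extension `K` of the finite field `k`. -/
def frobHom : K →+* K :=
  haveI := Fintype.ofFinite k
  (FiniteField.frobeniusAlgHom k K : K →+* K)

theorem frobHom_apply (x : K) : frobHom k K x = x ^ Nat.card k := by
  rw [@Nat.card_eq_fintype_card k (Fintype.ofFinite k)]
  rfl

theorem frobHom_pow_apply (j : ℕ) (x : K) : (frobHom k K ^ j) x = x ^ Nat.card k ^ j := by
  induction j with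
  | zero => simp
  | succ j ih => rw [pow_succ', RingHom.mul_def, RingHom.comp_apply, ih, frobHom_apply, ← pow_mul, pow_succ]

variable {k K}

/-- `X ^ #k - X` already splits over `k`, so it acquires no new roots in `K`. -/
theorem mem_range_of_pow_card_eq {x : K} (hx : x ^ Nat.card k = x) :
    x ∈ Set.range (algebraMap k K) := by
  have hne : (X ^ Nat.card k - X : k[X]) ≠ 0 :=
    FiniteField.X_pow_card_sub_X_ne_zero k Finite.one_lt_card
  have h1 := (splits_X_pow_nat_card_sub_X (K := k)).map (algebraMap k K)
  have h2 : x ∈ ((X ^ Nat.card k - X : k[X]).map (algebraMap k K)).roots := by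
    rw [mem_roots (map_ne_zero hne)]
    simp only [Polynomial.map_sub, Polynomial.map_pow, map_X, IsRoot, eval_sub, eval_pow, eval_X,
      hx, sub_self]
  rw [(splits_X_pow_nat_card_sub_X (K := k)).roots_map] at h2
  obtain ⟨a, _, rfl⟩ := Multiset.mem_map.1 h2
  exact ⟨a, rfl⟩

theorem exists_map_eq_of_map_frobHom_eq {f : K[X]} (hf : f.map (frobHom k K) = f) :
    ∃ g : k[X], g.map (algebraMap k K) = f := by
  rw [← mem_lifts, lifts_iff_coeff_lifts]
  intro n
  apply mem_range_of_pow_card_eq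
  rw [← frobHom_apply, ← coeff_map, hf]

end Frobenius

theorem pow_card_of_card_eq {k K : Type*} [Field K] [Finite K] {n : ℕ}
    (hK : Nat.card K = Nat.card k ^ n) (x : K) : x ^ Nat.card k ^ n = x := by
  have := Fintype.ofFinite K
  rw [← hK, Nat.card_eq_fintype_card, FiniteField.pow_card]

theorem exists_eq_pow_of_forall_irreducible {k : Type*} [Field k] {P : k[X]} (hPm : P.Monic) : ∀ (d : ℕ) {f : k[X]},
    f.Monic → f.natDegree = d → (∀ Q : k[X], Q.Monic → Irreducible Q → Q ∣ f → Q = P) →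
    ∃ m, f = P ^ m := by
  intro d
  induction d using Nat.strong_induction_on with
  | _ d ih =>
  intro f hf hd h
  rcases Nat.eq_zero_or_pos d with rfl | hpos
  · exact ⟨0, by rw [pow_zero]; exact hf.natDegree_eq_zero.1 hd⟩
  obtain ⟨Q, hQm, hQi, hQf⟩ := exists_monic_irreducible_factor f
      (fun hu => by have := natDegree_eq_zero_of_isUnit hu; omega)
  obtain rfl := h Q hQm hQi hQf
  obtain ⟨g, rfl⟩ := hQf
  have hg := hQm.of_mul_monic_left hf
  rw [hQm.natDegree_mul hg] at hd
  have := hQi.natDegree_pos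
  obtain ⟨m, rfl⟩ := ih g.natDegree (by omega) hg rfl
    (fun R hRm hRi hR => h R hRm hRi (hR.mul_left Q))
  exact ⟨m + 1, by rw [pow_succ']⟩

/-! ### Von Mangoldt sums as sums over the points of an extension field -/

section Count

variable {k K : Type*} [Field k] [Finite k] [Field K] [Finite K] [Algebra k K]

theorem exists_map_eq_prod_frob {n : ℕ} (hK : Nat.card K = Nat.card k ^ n) (x : K) :
    ∃ g : k[X], g.map (algebraMap k K) =
      ∏ i ∈ Finset.range n, (X - C (x ^ Nat.card k ^ i)) := by
  apply exists_map_eq_of_map_frobHom_eq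
  rw [Polynomial.map_prod]
  have h : ∀ i ∈ Finset.range n, (X - C (x ^ Nat.card k ^ i)).map (frobHom k K) =
      X - C (x ^ Nat.card k ^ (i + 1)) := by
    intro i _
    rw [Polynomial.map_sub, map_X, map_C, frobHom_apply, ← pow_mul, ← pow_succ]
  rw [Finset.prod_congr rfl h]
  cases n with
  | zero => simp
  | succ n =>
    rw [Finset.prod_range_succ, Finset.prod_range_succ' (fun i => X - C (x ^ Nat.card k ^ i)),
      pow_card_of_card_eq hK, pow_zero, pow_one]

variable (k) in
/-- The characteristic polynomial over `k` of an element of the degree `n` extension `K`. -/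
def frobPoly {n : ℕ} (hK : Nat.card K = Nat.card k ^ n) (x : K) : k[X] :=
  (exists_map_eq_prod_frob hK x).choose

theorem map_frobPoly {n : ℕ} (hK : Nat.card K = Nat.card k ^ n) (x : K) :
    (frobPoly k hK x).map (algebraMap k K) =
      ∏ i ∈ Finset.range n, (X - C (x ^ Nat.card k ^ i)) :=
  (exists_map_eq_prod_frob hK x).choose_spec

theorem frobPoly_mem_monics {n : ℕ} (hK : Nat.card K = Nat.card k ^ n) (x : K) :
    frobPoly k hK x ∈ monics k n := by
  rw [mem_monics]
  constructor
  · have : ((frobPoly k hK x).map (algebraMap k K)).Monic := by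
      rw [map_frobPoly]
      exact monic_prod_of_monic _ _ fun i _ => monic_X_sub_C _
    exact (Function.Injective.monic_map_iff (algebraMap k K).injective).2 this
  · rw [← natDegree_map (algebraMap k K), map_frobPoly, natDegree_prod_of_monic _ _
      fun i _ => monic_X_sub_C _]
    simp only [natDegree_X_sub_C, Finset.sum_const, Finset.card_range, smul_eq_mul, mul_one]

theorem aeval_frobPoly {n : ℕ} (hn : 0 < n) (hK : Nat.card K = Nat.card k ^ n) (x : K) :
    aeval x (frobPoly k hK x) = 0 := by
  rw [← eval_map_algebraMap, map_frobPoly, eval_prod]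
  exact Finset.prod_eq_zero (Finset.mem_range.2 hn) (by simp)

/-- All roots are Frobenius conjugates of `x`, so every irreducible factor over `k` vanishes at `x`
and is its minimal polynomial. -/
theorem frobPoly_eq_pow {n : ℕ} (hK : Nat.card K = Nat.card k ^ n) (x : K) :
    ∃ m, frobPoly k hK x = minpoly k x ^ m := by
  have hint : IsIntegral k x := IsIntegral.of_finite k x
  obtain ⟨hmon, hdeg⟩ := mem_monics.1 (frobPoly_mem_monics (k := k) hK x)
  refine exists_eq_pow_of_forall_irreducible (minpoly.monic hint) _ hmon rfl ?_
  intro Q hQm hQi hQ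
  have h1 := Polynomial.map_dvd (algebraMap k K) hQ
  rw [map_frobPoly] at h1
  have hQdeg : (Q.map (algebraMap k K)).degree ≠ 0 := by
    rw [degree_map]
    exact (degree_pos_of_irreducible hQi).ne'
  have hsplit : (Q.map (algebraMap k K)).Splits := by
    refine Splits.of_dvd ?_ ?_ h1
    · exact Splits.prod fun i _ => Splits.X_sub_C _
    · exact (monic_prod_of_monic _ _ fun i _ => monic_X_sub_C _).ne_zero
  obtain ⟨y, hy⟩ := hsplit.exists_eval_eq_zero hQdeg
  have h2 := eval_dvd (x := y) h1
  rw [hy, zero_dvd_iff, eval_prod, Finset.prod_eq_zero_iff] at h2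
  obtain ⟨i, _, hi⟩ := h2
  rw [eval_sub, eval_X, eval_C, sub_eq_zero] at hi
  subst hi
  have h3 : (frobHom k K ^ i) (aeval x Q) = 0 := by
    have h4 : ((frobHom k K ^ i).comp (algebraMap k K)) = algebraMap k K := by
      ext a
      have := Fintype.ofFinite k
      rw [RingHom.comp_apply, frobHom_pow_apply, ← map_pow, Nat.card_eq_fintype_card,
        FiniteField.pow_card_pow]
    rw [aeval_def, hom_eval₂, h4, frobHom_pow_apply, ← eval_map]
    exact hy
  have h5 : aeval x Q = 0 := (map_eq_zero _).1 h3
  exact minpoly.eq_of_irreducible_of_monic hQi h5 hQm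

theorem card_filter_aeval_eq_zero [Fintype K] [DecidableEq K] {n : ℕ} (hn : 0 < n)
    (hK : Nat.card K = Nat.card k ^ n) {P : k[X]} (hPm : P.Monic) (hPi : Irreducible P) (hd : P.natDegree ∣ n) :
    (Finset.univ.filter fun x : K => aeval x P = 0).card = P.natDegree := by
  have hsep : P.Separable := PerfectField.separable_of_irreducible hPi
  have hsplit : (P.map (algebraMap k K)).Splits := by
    refine Splits.of_dvd ?_ ?_ (Polynomial.map_dvd (algebraMap k K)
      (hPi.natDegree_dvd_iff_dvd_X_pow_card_pow_sub_X.1 hd))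
    · rw [← hK]
      simpa using splits_X_pow_nat_card_sub_X (K := K)
    · exact map_ne_zero (FiniteField.X_pow_card_pow_sub_X_ne_zero _ hn.ne' Finite.one_lt_card)
  rw [← card_rootSet_eq_natDegree hsep hsplit, ← Set.toFinset_card]
  congr 1
  ext x
  simp [mem_rootSet, hPm.ne_zero]

/-- The weight `vonMangoldt f` counts the `x` in `K` with characteristic polynomial `f`: for `f = P
^ m` these are the roots of `P`, which are distinct and all in `K`; for other `f` there are none. -/
theorem sum_vonMangoldt_mul_eq_sum_frobPoly [Fintype K] {n : ℕ} (hn : 0 < n)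
    (hK : Nat.card K = Nat.card k ^ n) (h : k[X] → ℂ) :
    ∑ f ∈ monics k n, (vonMangoldt f : ℂ) * h f = ∑ x : K, h (frobPoly k hK x) := by
  classical
  rw [← Finset.sum_fiberwise_of_maps_to (g := frobPoly k hK) (t := monics k n)
    (fun x _ => frobPoly_mem_monics hK x)]
  refine Finset.sum_congr rfl fun f hf => ?_
  rw [Finset.sum_congr rfl fun x hx => by rw [(Finset.mem_filter.1 hx).2], Finset.sum_const,
    nsmul_eq_mul]
  congr 1
  rw [mem_monics] at hf
  by_cases hP : ∃ P : k[X], IsPowerOfPrime f P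
  · obtain ⟨P, hPm, hPi, m, hm, rfl⟩ := hP
    rw [vonMangoldt_pow hPm hPi hm, ← card_filter_aeval_eq_zero (K := K) hn hK hPm hPi
      ⟨m, by rw [← hf.2, hPm.natDegree_pow, mul_comm]⟩]
    push_cast
    congr 2
    ext x
    simp only [Finset.mem_filter, Finset.mem_univ, true_and]
    constructor
    · intro hx
      obtain ⟨j, hj⟩ := frobPoly_eq_pow (k := k) hK x
      rw [← minpoly.eq_of_irreducible_of_monic hPi hx hPm] at hj
      have h1 := (mem_monics.1 (frobPoly_mem_monics (k := k) hK x)).2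
      rw [hj, hPm.natDegree_pow, ← hf.2, hPm.natDegree_pow] at h1
      rw [hj, Nat.eq_of_mul_eq_mul_right hPi.natDegree_pos h1]
    · intro hx
      have := aeval_frobPoly hn hK x
      rw [hx, map_pow] at this
      exact eq_zero_of_pow_eq_zero this
  · rw [vonMangoldt, dif_neg hP, Complex.ofReal_zero, eq_comm, Nat.cast_eq_zero,
      Finset.card_eq_zero, Finset.filter_eq_empty_iff]
    intro x _ hx
    apply hP
    obtain ⟨j, hj⟩ := frobPoly_eq_pow (k := k) hK x
    have hint : IsIntegral k x := IsIntegral.of_finite k x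
    refine ⟨minpoly k x, minpoly.monic hint, minpoly.irreducible hint, j, ?_, by rw [← hx, hj]⟩
    rcases Nat.eq_zero_or_pos j with rfl | hj0
    · exfalso
      have h1 := (mem_monics.1 (frobPoly_mem_monics (k := k) hK x)).2
      rw [hj, pow_zero, natDegree_one] at h1
      omega
    · exact hj0

end Count

/-! ### Pullback of characters along the norm -/

section Norm

variable {k F : Type*} [Field k] [Finite k] [Field F] [Finite F] [Algebra k F]

theorem exists_map_eq_prod_map_frob {r : ℕ} (hF : Nat.card F = Nat.card k ^ r) (g : F[X]) :
    ∃ h : k[X], h.map (algebraMap k F) = ∏ j ∈ Finset.range r, g.map (frobHom k F ^ j) := by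
  apply exists_map_eq_of_map_frobHom_eq
  rw [Polynomial.map_prod]
  have h : ∀ j ∈ Finset.range r, (g.map (frobHom k F ^ j)).map (frobHom k F) =
      g.map (frobHom k F ^ (j + 1)) := by
    intro j _
    rw [Polynomial.map_map, pow_succ', RingHom.mul_def]
  rw [Finset.prod_congr rfl h]
  cases r with
  | zero => simp
  | succ r =>
    have h1 : frobHom k F ^ (r + 1) = frobHom k F ^ 0 := by
      ext x
      rw [frobHom_pow_apply, frobHom_pow_apply, pow_card_of_card_eq hF, pow_zero, pow_one]
    rw [Finset.prod_range_succ, Finset.prod_range_succ' (fun j => g.map (frobHom k F ^ j)), h1]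

variable (k) in
/-- The norm to `k[X]` of a polynomial over the degree `r` extension `F`. -/
def normPoly {r : ℕ} (hF : Nat.card F = Nat.card k ^ r) (g : F[X]) : k[X] :=
  (exists_map_eq_prod_map_frob hF g).choose

theorem map_normPoly {r : ℕ} (hF : Nat.card F = Nat.card k ^ r) (g : F[X]) :
    (normPoly k hF g).map (algebraMap k F) = ∏ j ∈ Finset.range r, g.map (frobHom k F ^ j) :=
  (exists_map_eq_prod_map_frob hF g).choose_spec

theorem monic_normPoly {r : ℕ} (hF : Nat.card F = Nat.card k ^ r) {g : F[X]} (hg : g.Monic) :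
    (normPoly k hF g).Monic := by
  have : ((normPoly k hF g).map (algebraMap k F)).Monic := by
    rw [map_normPoly]
    exact monic_prod_of_monic _ _ fun i _ => hg.map _
  exact (Function.Injective.monic_map_iff (algebraMap k F).injective).2 this

theorem IsLevelChar.comp_normPoly {ℓ r : ℕ} {χ : k[X] → ℂ} (hχ : IsLevelChar ℓ χ)
    (hF : Nat.card F = Nat.card k ^ r) : IsLevelChar ℓ fun g : F[X] => χ (normPoly k hF g) where
  map_one := by
    have : normPoly k hF (1 : F[X]) = 1 := by
      apply map_injective _ (algebraMap k F).injective
      rw [map_normPoly]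
      simp
    rw [this, hχ.map_one]
  map_mul := by
    intro f g hf hg
    rw [← hχ.map_mul (monic_normPoly hF hf) (monic_normPoly hF hg)]
    congr 1
    apply map_injective _ (algebraMap k F).injective
    rw [Polynomial.map_mul, map_normPoly, map_normPoly, map_normPoly, ← Finset.prod_mul_distrib]
    simp only [Polynomial.map_mul]
  congr := by
    intro f g hf hg h
    refine hχ.congr (monic_normPoly hF hf) (monic_normPoly hF hg) ?_
    rw [← Agree.map (algebraMap k F), map_normPoly, map_normPoly]
    induction Finset.range r using Finset.induction_on with
    | empty => exact Agree.refl _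
    | insert a s ha ih =>
      rw [Finset.prod_insert ha, Finset.prod_insert ha]
      exact ((Agree.map _).2 h).mul ih

/-- A Hasse–Davenport relation. Both sides are sums over the same field, of degree n over `F` and r
n over `k`, and the norm of the characteristic polynomial over `F` is the one over `k`: the
exponents `r * i + j` run once through `range (r * n)`. -/
theorem mangoldtSum_comp_normPoly {r : ℕ} (hr : 0 < r) (hF : Nat.card F = Nat.card k ^ r) (χ : k[X] → ℂ)
    {n : ℕ} (hn : 0 < n) :
    mangoldtSum (fun g : F[X] => χ (normPoly k hF g)) n = mangoldtSum χ (r * n) := by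
  obtain ⟨p, hp⟩ := CharP.exists F
  have : Fact p.Prime := ⟨CharP.char_is_prime F p⟩
  have : NeZero n := ⟨hn.ne'⟩
  let K := FiniteField.Extension F p n
  have hKF : Nat.card K = Nat.card F ^ n := FiniteField.natCard_extension F p n
  let _ : Algebra k K := ((algebraMap F K).comp (algebraMap k F)).toAlgebra
  have hKk : Nat.card K = Nat.card k ^ (r * n) := by rw [hKF, hF, pow_mul]
  have := Fintype.ofFinite K
  rw [mangoldtSum, mangoldtSum, sum_vonMangoldt_mul_eq_sum_frobPoly (K := K) hn hKF,
    sum_vonMangoldt_mul_eq_sum_frobPoly (K := K) (Nat.mul_pos hr hn) hKk]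
  refine Finset.sum_congr rfl fun x _ => ?_
  congr 1
  apply map_injective _ (algebraMap k K).injective
  rw [map_frobPoly]
  change Polynomial.map ((algebraMap F K).comp (algebraMap k F)) _ = _
  rw [← Polynomial.map_map, map_normPoly, Polynomial.map_prod]
  have hcomm : ∀ j, ((frobPoly F hKF x).map (frobHom k F ^ j)).map (algebraMap F K) =
      ∏ i ∈ Finset.range n, (X - C (x ^ Nat.card k ^ (r * i + j))) := by
    intro j
    have h1 : (algebraMap F K).comp (frobHom k F ^ j) = (frobHom k K ^ j).comp (algebraMap F K) := by
      ext a
      rw [RingHom.comp_apply, RingHom.comp_apply, frobHom_pow_apply, frobHom_pow_apply, map_pow]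
    rw [Polynomial.map_map, h1, ← Polynomial.map_map, map_frobPoly, Polynomial.map_prod]
    refine Finset.prod_congr rfl fun i _ => ?_
    rw [Polynomial.map_sub, map_X, map_C, frobHom_pow_apply, ← pow_mul, hF, ← pow_mul, ← pow_add]
  simp only [hcomm]
  rw [Finset.prod_comm]
  clear hcomm
  have : ∀ m, ∏ i ∈ Finset.range m, ∏ j ∈ Finset.range r, (X - C (x ^ Nat.card k ^ (r * i + j))) =
      ∏ i ∈ Finset.range (r * m), (X - C (x ^ Nat.card k ^ i)) := by
    intro m
    induction m with
    | zero => simp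
    | succ m ih => rw [Finset.prod_range_succ, ih, Nat.mul_succ, Finset.prod_range_add]
  exact this n

end Norm

end ShortInterval
end

noncomputable section
namespace ShortInterval

/-! ### Integrality of normalized character sums -/

theorem not_isIntegral_of_natCast_mul_eq_one {m : ℕ} (hm : 2 ≤ m) {w : ℂ} (h : (m : ℂ) * w = 1)
    (hw : IsIntegral ℤ w) : False := by
  have hm0 : (m : ℂ) ≠ 0 := by exact_mod_cast (by omega)
  have e : w = algebraMap ℚ ℂ ((m : ℚ)⁻¹) := by
    rw [map_inv₀, map_natCast, eq_inv_of_mul_eq_one_right h]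
  rw [e, isIntegral_algebraMap_iff (algebraMap ℚ ℂ).injective] at hw
  obtain ⟨z, hz⟩ := IsIntegrallyClosed.isIntegral_iff.1 hw
  have h1 : (m : ℚ) * z = 1 := by
    have : (z : ℚ) = (m : ℚ)⁻¹ := by simpa using hz
    rw [this, mul_inv_cancel₀ (by exact_mod_cast (by omega))]
  have h2 : (m : ℤ) * z = 1 := by exact_mod_cast h1
  have := Int.eq_one_or_neg_one_of_mul_eq_one h2
  omega

theorem isIntegral_of_pow_eq_one {z : ℂ} {n : ℕ} (hn : 0 < n) (h : z ^ n = 1) :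
    IsIntegral ℤ z :=
  IsIntegral.of_pow hn (h ▸ isIntegral_one)

theorem exists_one_add_pow_eq {R : Type*} [CommRing R] (x : R) (k m : ℕ) :
    ∃ E, (1 + x) ^ m = ∑ j ∈ Finset.range (k + 1), (m.choose j : R) * x ^ j + x ^ (k + 1) * E := by
  have h : (1 + x) ^ m = ∑ j ∈ Finset.range (k + 1 + (m + 1)), (m.choose j : R) * x ^ j := by
    rw [add_comm 1 x, add_pow]
    simp only [one_pow, mul_one]
    rw [Finset.sum_subset (Finset.range_mono (by omega : m + 1 ≤ k + 1 + (m + 1)))]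
    · exact Finset.sum_congr rfl fun j _ => mul_comm _ _
    · intro j _ hj
      rw [Finset.mem_range, not_lt] at hj
      rw [Nat.choose_eq_zero_of_lt (by omega)]
      simp
  refine ⟨∑ i ∈ Finset.range (m + 1), (m.choose (k + 1 + i) : R) * x ^ i, ?_⟩
  rw [h, Finset.sum_range_add, Finset.mul_sum]
  congr 1
  refine Finset.sum_congr rfl fun i _ => ?_
  ring

/-- `j!` times the binomial coefficient is a monic polynomial of degree j in `f x`. When the lower
power moments vanish, only its leading term survives the summation. -/
theorem factorial_mul_sum_choose {p : ℕ} [Fact p.Prime] (f : ZMod p → ZMod p) {k : ℕ}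
    (h : ∀ i < k, ∑ x, f x ^ i = 0) {j : ℕ} (hj : j ≤ k) :
    ((j.factorial * ∑ x, (f x).val.choose j : ℕ) : ZMod p) = if j = k then ∑ x, f x ^ k else 0 := by
  have h1 : ((j.factorial * ∑ x, (f x).val.choose j : ℕ) : ZMod p) =
      ∑ x, (descPochhammer (ZMod p) j).eval (f x) := by
    rw [Finset.mul_sum, Nat.cast_sum]
    refine Finset.sum_congr rfl fun x _ => ?_
    rw [← Nat.descFactorial_eq_factorial_mul_choose, ← descPochhammer_eval_eq_descFactorial,
      ZMod.natCast_rightInverse]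
  have hmon := monic_descPochhammer (ZMod p) j
  have hdeg : (descPochhammer (ZMod p) j).natDegree = j := descPochhammer_natDegree _ j
  rw [h1]
  simp only [eval_eq_sum_range, hdeg]
  rw [Finset.sum_comm, Finset.sum_range_succ]
  rw [Finset.sum_eq_zero]
  · have : (descPochhammer (ZMod p) j).coeff j = 1 := by
      have := hmon.coeff_natDegree
      rwa [hdeg] at this
    rw [zero_add, this]
    simp only [one_mul]
    split_ifs with hjk
    · rw [hjk]
    · exact h j (by omega)
  · intro i hi
    rw [Finset.mem_range] at hi
    rw [← Finset.mul_sum, h i (by omega), mul_zero]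

/-- Expand in powers of `π = ζ - 1`. The coefficient of `π ^ j` is divisible by p for `j < k` and
prime to p for `j = k`, so the sum has π-adic valuation exactly k. But √p has valuation `(p - 1) / 2
> k`. The argument is phrased as divisibility in the ring of all algebraic integers. -/
theorem not_isIntegral_of_charSum {p : ℕ} [hp : Fact p.Prime] {ψ : AddChar (ZMod p) ℂ} (hψ : ψ ≠ 1)
    (f : ZMod p → ZMod p) {k : ℕ} (hk : 2 * k < p - 1) (hp2 : p ≠ 2)
    (h0 : ∀ i < k, ∑ x, f x ^ i = 0) (h1 : ∑ x, f x ^ k ≠ 0) {s : ℂ} (hs : IsIntegral ℤ s)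
    {R : ℂ} (hR : R ^ 2 = p) (h : ∑ x, ψ (f x) = R * s) : False := by
  have hζp : (ψ 1) ^ p = 1 := by
    rw [← AddChar.map_nsmul_eq_pow]
    simp
  have hζ1 : ψ 1 ≠ 1 := (AddChar.zmod_char_ne_one_iff p ψ).1 hψ
  have hψval : ∀ y, ψ y = ψ 1 ^ y.val := by
    intro y
    rw [← AddChar.map_nsmul_eq_pow]
    simp
  set ζ := ψ 1 with hζ
  let O := integralClosure ℤ ℂ
  let z : O := ⟨ζ, isIntegral_of_pow_eq_one hp.out.pos hζp⟩
  have hzp : z ^ p = 1 := Subtype.ext hζp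
  have hz1 : z ≠ 1 := fun e => hζ1 (congrArg Subtype.val e)
  have hprim : IsPrimitiveRoot z p := by
    rw [← orderOf_eq_prime hzp hz1]
    exact IsPrimitiveRoot.orderOf z
  set π : O := z - 1 with hπ
  have hπ0 : π ≠ 0 := sub_ne_zero.2 hz1
  have hp_dvd : ∀ j < p, π ^ j ∣ (p : O) := by
    intro j hj
    obtain ⟨u, _, hu⟩ := hprim.self_sub_one_pow_dvd_order hj
    exact ⟨u, by rw [hu, mul_comm]⟩
  have hdvd_p : (p : O) ∣ π ^ p := by
    obtain ⟨r, hr⟩ := exists_add_pow_prime_eq hp.out π 1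
    refine ⟨-(π * r), ?_⟩
    have : π + 1 = z := by rw [hπ]; ring
    rw [this, hzp, one_pow] at hr
    linear_combination -hr
  -- Both sides of `2 * k < p - 1` are even, which gains one more factor π in √p.
  have hodd : 2 * k + 2 ≤ p - 1 := by
    obtain ⟨m, hm⟩ := hp.out.odd_of_ne_two hp2
    omega
  have hRint : IsIntegral ℤ R := IsIntegral.of_pow two_pos (hR ▸ isIntegral_natCast p)
  let Ro : O := ⟨R, hRint⟩
  let so : O := ⟨s, hs⟩
  -- The quotient is integral because its square is `p / π ^ (2 * k + 2)`.
  have hRdvd : π ^ (k + 1) ∣ Ro := by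
    obtain ⟨u, hu⟩ := hp_dvd (2 * k + 2) (by omega)
    have hπ0' : (π : ℂ) ^ (k + 1) ≠ 0 := pow_ne_zero _ (fun e => hπ0 (Subtype.ext e))
    have hu' : (p : ℂ) = (π : ℂ) ^ (2 * k + 2) * u := by
      have := congrArg Subtype.val hu
      simpa using this
    have hT : IsIntegral ℤ (R / (π : ℂ) ^ (k + 1)) := by
      refine IsIntegral.of_pow two_pos ?_
      have : (R / (π : ℂ) ^ (k + 1)) ^ 2 = u := by
        rw [div_pow, hR, hu', ← pow_mul, show (k + 1) * 2 = 2 * k + 2 by ring,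
          mul_div_cancel_left₀]
        exact pow_ne_zero _ (fun e => hπ0 (Subtype.ext e))
      rw [this]
      exact u.2
    refine ⟨⟨_, hT⟩, Subtype.ext ?_⟩
    change R = (π : ℂ) ^ (k + 1) * (R / (π : ℂ) ^ (k + 1))
    field_simp
  set N : ℕ → ℕ := fun j => ∑ x, (f x).val.choose j with hN
  have hfac : ∀ j ≤ k, ¬ p ∣ j.factorial := fun j hj h => by
    have := (hp.out.dvd_factorial).1 h
    omega
  have hNj : ∀ j < k, p ∣ N j := by
    intro j hj
    have := factorial_mul_sum_choose f h0 hj.le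
    rw [if_neg hj.ne, ZMod.natCast_eq_zero_iff] at this
    exact (hp.out.dvd_mul.1 this).resolve_left (hfac j hj.le)
  have hNk : ¬ p ∣ N k := by
    intro hdvd
    have := factorial_mul_sum_choose f h0 le_rfl
    rw [if_pos rfl] at this
    apply h1
    rw [← this, ZMod.natCast_eq_zero_iff]
    exact hdvd.mul_left _
  have hsum : Ro * so = ∑ x, z ^ (f x).val := by
    apply Subtype.ext
    change R * s = _
    rw [← h]
    push_cast
    exact Finset.sum_congr rfl fun x _ => hψval _
  choose E hE using fun m => exists_one_add_pow_eq π k m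
  have hz : 1 + π = z := by rw [hπ]; ring
  rw [hz] at hE
  have hexp : Ro * so = ∑ j ∈ Finset.range k, (N j : O) * π ^ j + N k * π ^ k +
      π ^ (k + 1) * ∑ x, E (f x).val := by
    rw [hsum, Finset.sum_congr rfl fun x _ => hE (f x).val, Finset.sum_add_distrib,
      Finset.sum_comm, ← Finset.mul_sum, Finset.sum_range_succ]
    simp only [← Finset.sum_mul, hN, Nat.cast_sum]
  have hdiv : π ^ (k + 1) ∣ (N k : O) * π ^ k := by
    have e : (N k : O) * π ^ k = Ro * so - ∑ j ∈ Finset.range k, (N j : O) * π ^ j -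
      π ^ (k + 1) * ∑ x, E (f x).val := by rw [hexp]; ring
    rw [e]
    refine dvd_sub (dvd_sub (hRdvd.mul_right _) (Finset.dvd_sum fun j hj => ?_)) (dvd_mul_right _ _)
    obtain ⟨m, hm⟩ := hNj j (Finset.mem_range.1 hj)
    rw [hm, Nat.cast_mul, mul_assoc]
    exact (hp_dvd (k + 1) (by omega)).mul_right _
  have hdiv' : π ∣ (N k : O) := by
    rw [pow_succ', mul_dvd_mul_iff_right (pow_ne_zero k hπ0)] at hdiv
    exact hdiv
  have hdivp : π ∣ (p : O) := by simpa using hp_dvd 1 hp.out.one_lt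
  have hcop : IsCoprime (N k : ℤ) (p : ℤ) :=
    Nat.isCoprime_iff_coprime.2 ((hp.out.coprime_iff_not_dvd.2 hNk).symm)
  obtain ⟨a, b, hab⟩ := hcop
  -- π divides two coprime integers, so it is a unit; then p, which divides `π ^ p`, would be a unit
  -- as well.
  have hone : π ∣ 1 := by
    have : (1 : O) = a * N k + b * p := by exact_mod_cast congrArg (Int.cast : ℤ → O) hab.symm
    rw [this]
    exact dvd_add (hdiv'.mul_left _) (hdivp.mul_left _)
  have hpone : (p : O) ∣ 1 := hdvd_p.trans (by simpa using pow_dvd_pow_of_dvd hone p)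
  obtain ⟨w, hw⟩ := hpone
  refine not_isIntegral_of_natCast_mul_eq_one hp.out.two_le (w := w) ?_ w.2
  have := congrArg Subtype.val hw
  simpa using this.symm

variable {F : Type*} [Field F] [Finite F]

/-- If the normalized prime counting function over `F` is periodic, then all degree one character
sums over the prime field are divisible by `√p` in the ring of algebraic integers. -/
theorem exists_isIntegral_of_periodic {p r ℓ : ℕ} [hp : Fact p.Prime] [Algebra (ZMod p) F] (hr : 0 < r)
    (hF : Nat.card F = p ^ r) {N : ℕ+} (hper : Function.Periodic (normalizedPsi F ℓ) N)
    {χ : (ZMod p)[X] → ℂ} (hχ : IsLevelChar ℓ χ) (hne : ∃ g : (ZMod p)[X], g.Monic ∧ χ g ≠ 1) :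
    ∃ s : ℂ, IsIntegral ℤ s ∧ charSum χ 1 = ((√p : ℝ) : ℂ) * s := by
  have hF' : Nat.card F = Nat.card (ZMod p) ^ r := by rw [hF, Nat.card_zmod]
  obtain ⟨s, hs, hsum⟩ := exists_inverse_roots hχ hne
  set χ' : F[X] → ℂ := fun g => χ (normPoly (ZMod p) hF' g) with hχ'
  have hlev : IsLevelChar ℓ χ' := hχ.comp_normPoly hF'
  have hlift : ∀ n, 0 < n → mangoldtSum χ' n = -((s.map (· ^ r)).map (· ^ n)).sum := by
    intro n hn
    rw [hχ', mangoldtSum_comp_normPoly hr hF' χ hn, hsum _ (Nat.mul_pos hr hn), Multiset.map_map]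
    simp only [Function.comp_def, ← pow_mul]
  have hpR : (0 : ℝ) < p := by exact_mod_cast hp.out.pos
  have hsp : ((√p : ℝ) : ℂ) ≠ 0 := by exact_mod_cast (Real.sqrt_pos.2 hpR).ne'
  have hcard : (Nat.card F : ℂ) ≠ 0 := by exact_mod_cast Nat.card_pos.ne'
  have hsq : ((√(Nat.card F) : ℝ) : ℂ) = ((√p : ℝ) : ℂ) ^ r := by
    rw [hF]
    push_cast
    rw [← Complex.ofReal_pow]
    congr 1
    rw [Real.sqrt_eq_iff_mul_self_eq (by positivity) (by positivity), ← mul_pow,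
      Real.mul_self_sqrt hpR.le]
  by_cases htriv : ∃ g : F[X], g.Monic ∧ χ' g ≠ 1
  · have hrec := (periodic_normalizedPsi_iff ℓ N).1 hper χ' hlev htriv
    have hroot : ∀ α ∈ s, (α ^ r) ^ (N : ℕ) - ((√(Nat.card F) : ℝ) : ℂ) ^ (N : ℕ) = 0 := by
      intro α hα
      refine weight_eq_zero_of_forall_sum_pow (s := s.map (· ^ r))
        (w := fun b => b ^ (N : ℕ) - ((√(Nat.card F) : ℝ) : ℂ) ^ (N : ℕ)) ?_
        (Multiset.mem_map_of_mem _ hα) (pow_ne_zero _ (hs α hα).1)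
      intro n hn
      have h1 := hrec n hn
      rw [hlift _ (by omega), hlift n hn, mul_neg, neg_inj, ← Multiset.sum_map_mul_left,
        ← sub_eq_zero, ← Multiset.sum_map_sub] at h1
      rw [← h1]
      congr 1
      refine Multiset.map_congr rfl fun b _ => ?_
      ring
    -- The degree one sum is minus the sum of the inverse roots, and each of these is √p times a
    -- root of unity.
    refine ⟨-(s.map fun α => α / ((√p : ℝ) : ℂ)).sum, ?_, ?_⟩
    · refine IsIntegral.neg (IsIntegral.multiset_sum ?_)
      intro b hb
      obtain ⟨α, hα, rfl⟩ := Multiset.mem_map.1 hb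
      refine isIntegral_of_pow_eq_one (n := r * N) (Nat.mul_pos hr N.pos) ?_
      have := hroot α hα
      rw [sub_eq_zero, hsq, ← pow_mul, ← pow_mul] at this
      rw [div_pow, this, div_self (pow_ne_zero _ hsp)]
    · rw [← mangoldtSum_one hχ, hsum 1 one_pos, mul_neg, ← Multiset.sum_map_mul_left]
      congr 2
      refine Multiset.map_congr rfl fun α _ => ?_
      rw [pow_one, mul_div_cancel₀ _ hsp]
  · exfalso
    push Not at htriv
    -- A trivial pullback is impossible: all power sums of q together with the `α ^ r` would vanish,
    -- although each of these occurs with weight 1.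
    have : (1 : ℂ) = 0 := by
      refine weight_eq_zero_of_forall_sum_pow (s := (Nat.card F : ℂ) ::ₘ s.map (· ^ r))
        (w := fun _ => 1) ?_ (Multiset.mem_cons_self _ _) hcard
      intro n hn
      have h1 := hlift n hn
      rw [mangoldtSum_of_trivial htriv hn] at h1
      simp only [one_mul]
      rw [Multiset.map_cons, Multiset.sum_cons, h1, neg_add_cancel]
    exact one_ne_zero this

end ShortInterval
end

noncomputable section
namespace ShortInterval

/-! ### Non-periodicity -/

theorem exists_isLevelChar_ne_one {F : Type*} [Field F] [Finite F] {ℓ : ℕ} {f : F[X]}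
    (hf : f.Monic) (h : ¬ Agree ℓ f 1) : ∃ χ : F[X] → ℂ, IsLevelChar ℓ χ ∧ χ f ≠ 1 := by
  have hne : Additive.ofMul (ClassGrp.mk ℓ ⟨f, hf⟩) ≠ 0 := by
    intro h0
    rw [ofMul_eq_zero, ← map_one (ClassGrp.mk ℓ), ClassGrp.mk_eq_iff] at h0
    exact h h0
  obtain ⟨ψ, hψ⟩ := AddChar.exists_apply_ne_zero.2 hne
  exact ⟨levelChar ψ, isLevelChar_levelChar ψ, by rwa [levelChar_apply ψ hf]⟩

theorem charSum_one {F : Type*} [Field F] [Fintype F] (χ : F[X] → ℂ) :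
    charSum χ 1 = ∑ a : F, χ (X + C a) := by
  rw [charSum, sum_monics_succ, monics_zero, Finset.sum_singleton]
  simp only [mul_one]

theorem charSum_one_zmod_two (χ : (ZMod 2)[X] → ℂ) :
    charSum χ 1 = χ (X + C 0) + χ (X + C 1) := by
  rw [charSum_one]
  exact Fin.sum_univ_two _

theorem charSum_one_zmod_three (χ : (ZMod 3)[X] → ℂ) :
    charSum χ 1 = χ (X + C 0) + χ (X + C 1) + χ (X + C 2) := by
  rw [charSum_one]
  exact Fin.sum_univ_three _

theorem IsLevelChar.map_X_pow_mul {F : Type*} [Field F] {ℓ : ℕ} {χ : F[X] → ℂ}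
    (hχ : IsLevelChar ℓ χ) (n : ℕ) {f : F[X]} (hf : f.Monic) : χ (X ^ n * f) = χ f :=
  hχ.congr ((monic_X_pow n).mul hf) hf (agree_X_pow_mul ℓ n f)

theorem IsLevelChar.map_eq_one_of_degree_lt {F : Type*} [Field F] {ℓ n : ℕ} {χ : F[X] → ℂ}
    (hχ : IsLevelChar ℓ χ) {f : F[X]} (hf : f.Monic) (hn : f.natDegree = n)
    (h : ∀ j ≤ ℓ, 0 < j → j ≤ n → f.coeff (n - j) = 0) : χ f = 1 := by
  rw [← hχ.map_one, ← hχ.map_X_pow_mul n monic_one, mul_one]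
  refine hχ.congr hf (monic_X_pow n) (agree_of_degree_sub_lt hn (natDegree_X_pow n) ?_)
  intro j hj hjn
  rcases Nat.eq_zero_or_pos j with rfl | hj0
  · rw [Nat.sub_zero, ← hn, hf.coeff_natDegree, hn, coeff_X_pow, if_pos rfl]
  · rw [h j hj hj0 hjn, coeff_X_pow, if_neg (by omega)]

/-! ### Level characters built from power sums of the roots -/

section PowerSums

variable {F : Type*} [Field F]

theorem coeff_reverse_X_add_C (a : F) (j : ℕ) :
    (X + C a : F[X]).reverse.coeff j = if j = 0 then 1 else if j = 1 then a else 0 := by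
  rw [← nextToLeading_eq_coeff_reverse, nextToLeading, natDegree_X_add_C]
  rcases j with _ | _ | j
  · simp [coeff_X]
  · simp
  · simp

theorem coeff_reverse_mul {f g : F[X]} (hf : f.Monic) (hg : g.Monic) :
    (f * g).reverse.coeff 1 = f.reverse.coeff 1 + g.reverse.coeff 1 ∧
    (f * g).reverse.coeff 2 = f.reverse.coeff 2 + f.reverse.coeff 1 * g.reverse.coeff 1 +
      g.reverse.coeff 2 ∧
    (f * g).reverse.coeff 3 = f.reverse.coeff 3 + f.reverse.coeff 2 * g.reverse.coeff 1 +
      f.reverse.coeff 1 * g.reverse.coeff 2 + g.reverse.coeff 3 ∧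
    (f * g).reverse.coeff 4 = f.reverse.coeff 4 + f.reverse.coeff 3 * g.reverse.coeff 1 +
      f.reverse.coeff 2 * g.reverse.coeff 2 + f.reverse.coeff 1 * g.reverse.coeff 3 +
      g.reverse.coeff 4 := by
  have h0 : f.reverse.coeff 0 = 1 := by rw [coeff_zero_reverse, hf.leadingCoeff]
  have h0' : g.reverse.coeff 0 = 1 := by rw [coeff_zero_reverse, hg.leadingCoeff]
  rw [reverse_mul_of_domain]
  refine ⟨?_, ?_, ?_, ?_⟩ <;>
  · simp only [coeff_mul, Finset.Nat.antidiagonal_succ, Finset.Nat.antidiagonal_zero,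
      Finset.sum_cons, Finset.map_cons, Finset.map_singleton, Finset.sum_singleton,
      Function.Embedding.prodMap, Function.Embedding.coeFn_mk, Prod.map, Nat.succ_eq_add_one,
      Function.Embedding.refl_apply, h0, h0', zero_add]
    simp
    try ring

/-- The combination `b * p₁ + p₃` of power sums of the roots, up to signs. -/
def cubicSum (b : F) (f : F[X]) : F :=
  f.reverse.coeff 1 ^ 3 - 3 * f.reverse.coeff 1 * f.reverse.coeff 2 + 3 * f.reverse.coeff 3 +
    b * f.reverse.coeff 1

/-- The fourth power sum of the roots. -/
def quarticSum (f : F[X]) : F :=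
  f.reverse.coeff 1 ^ 4 - 4 * f.reverse.coeff 1 ^ 2 * f.reverse.coeff 2 +
    2 * f.reverse.coeff 2 ^ 2 + 4 * f.reverse.coeff 1 * f.reverse.coeff 3 -
    4 * f.reverse.coeff 4

/-- Power sums of the roots are additive in products, so an additive character turns them into
multiplicative functions of the polynomial. -/
theorem isLevelChar_of_additive {ℓ : ℕ} (ψ : AddChar F ℂ) {P : F[X] → F}
    (hmul : ∀ {f g : F[X]}, f.Monic → g.Monic → P (f * g) = P f + P g)
    (hcongr : ∀ {f g : F[X]}, Agree ℓ f g → P f = P g) :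
    IsLevelChar ℓ fun f => ψ (P f) where
  map_one := by
    have h := hmul (monic_one (R := F)) monic_one
    rw [mul_one, left_eq_add] at h
    rw [h, AddChar.map_zero_eq_one]
  map_mul := fun hf hg => by rw [hmul hf hg, AddChar.map_add_eq_mul]
  congr := fun _ _ h => by rw [hcongr h]

theorem isLevelChar_cubicSum (ψ : AddChar F ℂ) (b : F) :
    IsLevelChar 3 fun f => ψ (cubicSum b f) := by
  refine isLevelChar_of_additive ψ ?_ ?_
  · intro f g hf hg
    obtain ⟨h1, h2, h3, -⟩ := coeff_reverse_mul hf hg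
    simp only [cubicSum, h1, h2, h3]
    ring
  · intro f g h
    rw [agree_iff] at h
    simp only [cubicSum, h 1 (by omega), h 2 (by omega), h 3 (by omega)]

theorem isLevelChar_quarticSum (ψ : AddChar F ℂ) :
    IsLevelChar 4 fun f => ψ (quarticSum f) := by
  refine isLevelChar_of_additive ψ ?_ ?_
  · intro f g hf hg
    obtain ⟨h1, h2, h3, h4⟩ := coeff_reverse_mul hf hg
    simp only [quarticSum, h1, h2, h3, h4]
    ring
  · intro f g h
    rw [agree_iff] at h
    simp only [quarticSum, h 1 (by omega), h 2 (by omega), h 3 (by omega), h 4 (by omega)]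

theorem cubicSum_X_add_C (a b : F) : cubicSum b (X + C a) = a ^ 3 + b * a := by
  simp only [cubicSum, coeff_reverse_X_add_C]
  simp

theorem quarticSum_X_add_C (a : F) : quarticSum (X + C a) = a ^ 4 := by
  simp only [quarticSum, coeff_reverse_X_add_C]
  simp

end PowerSums

theorem sum_zmod_pow {p : ℕ} [hp : Fact p.Prime] {e : ℕ} (he : e < 2 * (p - 1)) :
    ∑ x : ZMod p, x ^ e = if e = p - 1 then -1 else 0 := by
  have h2 := hp.out.two_le
  rcases lt_trichotomy e (p - 1) with h | h | h
  · rw [if_neg h.ne]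
    exact FiniteField.sum_pow_lt_card_sub_one _ e (by rwa [ZMod.card])
  · rw [if_pos h]
    have : ∀ x : ZMod p, x ^ e = 1 - if x = 0 then 1 else 0 := by
      intro x
      rw [h, ZMod.pow_card_sub_one]
      split_ifs <;> simp_all
    simp [this]
  · rw [if_neg h.ne']
    have : ∀ x : ZMod p, x ^ e = x ^ (e - (p - 1)) := by
      intro x
      rcases eq_or_ne x 0 with rfl | hx
      · rw [zero_pow (by omega), zero_pow (by omega)]
      · conv_lhs => rw [show e = (e - (p - 1)) + (p - 1) by omega, pow_add,
          ZMod.pow_card_sub_one_eq_one hx, mul_one]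
    simp only [this]
    exact FiniteField.sum_pow_lt_card_sub_one _ _ (by rw [ZMod.card]; omega)

variable {F : Type*} [Field F] [Finite F]

/-- Periodicity would make the sum of `ψ (P (X + C x))` divisible by √p. The first nonvanishing
power moment, of order `k < (p - 1) / 2`, shows that it is not. -/
theorem not_periodic_of_additive {p r ℓ m : ℕ} [hp : Fact p.Prime] [Algebra (ZMod p) F]
    (hr : 0 < r) (hF : Nat.card F = p ^ r) (hp2 : p ≠ 2) (hm : m ≤ ℓ) {P : (ZMod p)[X] → ZMod p}
    (hP : ∀ ψ : AddChar (ZMod p) ℂ, IsLevelChar m fun f => ψ (P f)) {k : ℕ} (hk : 0 < k)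
    (hkp : 2 * k < p - 1) (h0 : ∀ i < k, ∑ x, P (X + C x) ^ i = 0)
    (h1 : ∑ x, P (X + C x) ^ k ≠ 0) {N : ℕ+} :
    ¬ Function.Periodic (normalizedPsi F ℓ) N := by
  intro hper
  have hψ := ZMod.isPrimitive_stdAddChar p
  set ψ : AddChar (ZMod p) ℂ := ZMod.stdAddChar
  have hψ1 : ψ ≠ 1 := by
    have := hψ one_ne_zero
    rwa [AddChar.mulShift_one] at this
  obtain ⟨x, hx⟩ : ∃ x, P (X + C x) ≠ 0 := by
    by_contra h
    push Not at h
    apply h1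
    simp [h, hk.ne']
  have hne : ∃ g : (ZMod p)[X], g.Monic ∧ ψ (P g) ≠ 1 :=
    ⟨X + C x, monic_X_add_C x, fun h => hx ((hψ.zmod_char_eq_one_iff p _).1 h)⟩
  obtain ⟨s, hs, h⟩ := exists_isIntegral_of_periodic hr hF hper ((hP ψ).mono hm) hne
  rw [charSum_one] at h
  refine not_isIntegral_of_charSum hψ1 (fun x => P (X + C x)) hkp hp2 h0 h1 hs ?_ h
  rw [← Complex.ofReal_pow, Real.sq_sqrt (Nat.cast_nonneg p)]
  simp

/-- For p ≡ 1 mod 3 the sum of `x ^ 3` has first nonzero moment at `k = (p - 1) / 3`. For p ≡ 2 mod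
3 cubing is a bijection, so `x ^ 3 + x` is used. The exponent p - 1 first occurs in its power `k =
(p + 1) / 3`, with coefficient k. The bound `2 * k < p - 1` then excludes p = 5. -/
theorem not_periodic_of_ge_seven {p r ℓ : ℕ} [hp : Fact p.Prime] [Algebra (ZMod p) F]
    (hr : 0 < r) (hF : Nat.card F = p ^ r) (hp7 : 7 ≤ p) (hℓ : 3 ≤ ℓ) {N : ℕ+} :
    ¬ Function.Periodic (normalizedPsi F ℓ) N := by
  have h3 : p % 3 ≠ 0 := by
    intro h
    have := (Nat.prime_dvd_prime_iff_eq Nat.prime_three hp.out).1 (Nat.dvd_of_mod_eq_zero h)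
    omega
  rcases (by omega : p % 3 = 1 ∨ p % 3 = 2) with h | h
  · obtain ⟨m, hm⟩ : ∃ m, p = 3 * m + 1 := ⟨p / 3, by omega⟩
    refine not_periodic_of_additive hr hF (by omega) hℓ (P := cubicSum 0) (k := m)
      (fun ψ => isLevelChar_cubicSum ψ 0) (by omega) (by omega) ?_ ?_
    · intro i hi
      simp only [cubicSum_X_add_C, zero_mul, add_zero, ← pow_mul]
      rw [sum_zmod_pow (by omega), if_neg (by omega)]
    · simp only [cubicSum_X_add_C, zero_mul, add_zero, ← pow_mul]
      rw [sum_zmod_pow (by omega), if_pos (by omega)]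
      exact neg_ne_zero.2 one_ne_zero
  · obtain ⟨m, hm⟩ : ∃ m, p = 3 * m + 2 := ⟨p / 3, by omega⟩
    have hexp : ∀ i, ∑ x : ZMod p, (x ^ 3 + 1 * x) ^ i =
        ∑ j ∈ Finset.range (i + 1), (∑ x : ZMod p, x ^ (i + 2 * j)) * (i.choose j : ZMod p) := by
      intro i
      simp only [Finset.sum_mul]
      rw [Finset.sum_comm]
      refine Finset.sum_congr rfl fun x _ => ?_
      rw [one_mul, add_pow]
      refine Finset.sum_congr rfl fun j hj => ?_
      rw [← pow_mul, ← pow_add, show 3 * j + (i - j) = i + 2 * j by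
        have := Finset.mem_range.1 hj; omega]
    refine not_periodic_of_additive hr hF (by omega) hℓ (P := cubicSum 1) (k := m + 1)
      (fun ψ => isLevelChar_cubicSum ψ 1) (by omega) (by omega) ?_ ?_
    · intro i hi
      simp only [cubicSum_X_add_C]
      rw [hexp]
      refine Finset.sum_eq_zero fun j hj => ?_
      have := Finset.mem_range.1 hj
      rw [sum_zmod_pow (by omega), if_neg (by omega), zero_mul]
    · simp only [cubicSum_X_add_C]
      rw [hexp, Finset.sum_eq_single m]
      · rw [sum_zmod_pow (by omega), if_pos (by omega), Nat.choose_succ_self_right]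
        refine mul_ne_zero (neg_ne_zero.2 one_ne_zero) ?_
        rw [Ne, ZMod.natCast_eq_zero_iff]
        intro hd
        have := Nat.le_of_dvd (by omega) hd
        omega
      · intro j hj hjm
        have := Finset.mem_range.1 hj
        rw [sum_zmod_pow (by omega), if_neg (by omega), zero_mul]
      · intro hm'
        exact absurd (Finset.mem_range.2 (by omega)) hm'

theorem not_periodic_five {r ℓ : ℕ} [Algebra (ZMod 5) F]
    (hr : 0 < r) (hF : Nat.card F = 5 ^ r) (hℓ : 4 ≤ ℓ) {N : ℕ+} :
    ¬ Function.Periodic (normalizedPsi F ℓ) N := by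
  have : Fact (Nat.Prime 5) := ⟨by norm_num⟩
  refine not_periodic_of_additive hr hF (by omega) hℓ (P := quarticSum) (k := 1)
    isLevelChar_quarticSum (by omega) (by omega) ?_ ?_
  · intro i hi
    simp only [quarticSum_X_add_C, ← pow_mul]
    rw [sum_zmod_pow (by omega), if_neg (by omega)]
  · simp only [quarticSum_X_add_C, ← pow_mul]
    rw [sum_zmod_pow (by omega), if_pos (by omega)]
    exact neg_ne_zero.2 one_ne_zero

/-- As `(X + 1) ^ 4 = X ^ 4 + 1` is a nontrivial class of level 4, some χ takes at `X + 1` a value ζ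
of order 8. The degree one sum is `1 + ζ`, a uniformizer above 2, of valuation half that of √2. -/
theorem not_periodic_two {r ℓ : ℕ} [Algebra (ZMod 2) F]
    (hr : 0 < r) (hF : Nat.card F = 2 ^ r) (hℓ : 4 ≤ ℓ) {N : ℕ+} :
    ¬ Function.Periodic (normalizedPsi F ℓ) N := by
  intro hper
  have hX : (X + C 1 : (ZMod 2)[X]).Monic := monic_X_add_C 1
  have h2 : (2 : (ZMod 2)[X]) = 0 := CharTwo.two_eq_zero
  have e4 : (X + C 1 : (ZMod 2)[X]) ^ 4 = X ^ 4 + C 1 := by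
    rw [C_1]
    linear_combination (2 * X ^ 3 + 3 * X ^ 2 + 2 * X) * h2
  have e8 : (X + C 1 : (ZMod 2)[X]) ^ 8 = X ^ 8 + C 1 := by
    rw [show 8 = 4 * 2 by rfl, pow_mul, e4, C_1]
    linear_combination X ^ 4 * h2
  obtain ⟨χ, hχ, hχ4⟩ := exists_isLevelChar_ne_one (ℓ := 4) (hX.pow 4) (by
    intro h
    have h1 := h.trans (agree_X_pow_mul 4 4 (1 : (ZMod 2)[X])).symm
    rw [mul_one, e4] at h1
    have := h1.coeff_eq (natDegree_X_pow_add_C) (natDegree_X_pow 4) 4 le_rfl le_rfl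
    simp at this)
  have hz8 : χ (X + C 1) ^ 8 = 1 := by
    rw [← hχ.map_pow hX, e8]
    refine hχ.map_eq_one_of_degree_lt (n := 8) (monic_X_pow_add_C _ (by omega))
      natDegree_X_pow_add_C ?_
    intro j hj hj0 _
    rw [coeff_add, coeff_X_pow, if_neg (by omega), coeff_C, if_neg (by omega), add_zero]
  rw [hχ.map_pow hX] at hχ4
  obtain ⟨s, hs, h⟩ := exists_isIntegral_of_periodic hr hF hper (hχ.mono hℓ)
    ⟨_, hX, fun h => hχ4 (by rw [h, one_pow])⟩
  have hX1 : χ (X + C 0) = 1 := by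
    have := hχ.map_X_pow_mul 1 monic_one
    rw [hχ.map_one] at this
    simpa using this
  rw [charSum_one_zmod_two, hX1] at h
  set ζ := χ (X + C 1)
  have hz4 : ζ ^ 4 = -1 := by
    have : (ζ ^ 4 - 1) * (ζ ^ 4 + 1) = 0 := by linear_combination hz8
    rcases mul_eq_zero.1 this with h | h
    · exact absurd (sub_eq_zero.1 h) hχ4
    · exact eq_neg_of_add_eq_zero_left h
  have hsq : (((√(2 : ℕ) : ℝ)) : ℂ) ^ 2 = 2 := by
    rw [← Complex.ofReal_pow, Real.sq_sqrt (Nat.cast_nonneg 2)]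
    simp
  have hζ : IsIntegral ℤ ζ := isIntegral_of_pow_eq_one (by norm_num) hz8
  have h1 : 1 + ζ ^ 2 = 2 * (s ^ 2 - ζ) := by
    have : (1 + ζ) ^ 2 = 2 * s ^ 2 := by rw [h, mul_pow, hsq]
    linear_combination this
  -- Since `(1 + ζ ^ 2) ^ 4 = -4`, the fourth power of `h1` makes 1/4 an algebraic integer.
  refine not_isIntegral_of_natCast_mul_eq_one (m := 4) (by norm_num) (w := -(s ^ 2 - ζ) ^ 4) ?_
    (((hs.pow 2).sub hζ).pow 4).neg
  have h3 : 16 * (s ^ 2 - ζ) ^ 4 = -4 := by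
    have h4 : (1 + ζ ^ 2) ^ 4 = (2 * (s ^ 2 - ζ)) ^ 4 := by rw [h1]
    linear_combination -h4 + (ζ ^ 4 + 4 * ζ ^ 2 + 5) * hz4
  push_cast
  linear_combination (-1 / 4) * h3

/-- Here `ζ = χ (X + 1)` has order 9, and `η = χ (X + 2)` satisfies `(ζ η) ^ 3 = 1`, so `1 + ζ ^ 3 +
η ^ 3 = 0`. Cubing `1 + ζ + η = √3 s` then exhibits the unit `ζ η` as a multiple of √3. -/
theorem not_periodic_three {r ℓ : ℕ} [Algebra (ZMod 3) F]
    (hr : 0 < r) (hF : Nat.card F = 3 ^ r) (hℓ : 3 ≤ ℓ) {N : ℕ+} :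
    ¬ Function.Periodic (normalizedPsi F ℓ) N := by
  intro hper
  have hX : (X + C 1 : (ZMod 3)[X]).Monic := monic_X_add_C 1
  have hX' : (X + C 2 : (ZMod 3)[X]).Monic := monic_X_add_C 2
  have h3 : (3 : (ZMod 3)[X]) = 0 := by
    have := CharP.cast_eq_zero (ZMod 3)[X] 3
    exact_mod_cast this
  have c2 : (C 2 : (ZMod 3)[X]) = 2 := rfl
  have e3 : (X + C 1 : (ZMod 3)[X]) ^ 3 = X ^ 3 + C 1 := by
    rw [C_1]
    linear_combination (X ^ 2 + X) * h3
  have e9 : (X + C 1 : (ZMod 3)[X]) ^ 9 = X ^ 9 + C 1 := by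
    rw [show 9 = 3 * 3 by rfl, pow_mul, e3, C_1]
    linear_combination (X ^ 6 + X ^ 3) * h3
  have e6 : ((X + C 1 : (ZMod 3)[X]) * (X + C 2)) ^ 3 = X ^ 6 + C 2 := by
    rw [C_1, c2]
    linear_combination (3 * X ^ 5 + 11 * X ^ 4 + 21 * X ^ 3 + 22 * X ^ 2 + 12 * X + 2) * h3
  obtain ⟨χ, hχ, hχ3⟩ := exists_isLevelChar_ne_one (ℓ := 3) (hX.pow 3) (by
    intro h
    have h1 := h.trans (agree_X_pow_mul 3 3 (1 : (ZMod 3)[X])).symm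
    rw [mul_one, e3] at h1
    have := h1.coeff_eq (natDegree_X_pow_add_C) (natDegree_X_pow 3) 3 le_rfl le_rfl
    simp at this)
  have hlow : ∀ (n : ℕ) (a : ZMod 3), 3 < n → χ (X ^ n + C a) = 1 := by
    intro n a hn
    refine hχ.map_eq_one_of_degree_lt (n := n) (monic_X_pow_add_C _ (by omega))
      natDegree_X_pow_add_C ?_
    intro j hj hj0 _
    rw [coeff_add, coeff_X_pow, if_neg (by omega), coeff_C, if_neg (by omega), add_zero]
  have hz9 : χ (X + C 1) ^ 9 = 1 := by
    rw [← hχ.map_pow hX, e9, hlow 9 1 (by omega)]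
  have hw : (χ (X + C 1) * χ (X + C 2)) ^ 3 = 1 := by
    rw [← hχ.map_mul hX hX', ← hχ.map_pow (hX.mul hX'), e6, hlow 6 2 (by omega)]
  rw [hχ.map_pow hX] at hχ3
  obtain ⟨s, hs, h⟩ := exists_isIntegral_of_periodic hr hF hper (hχ.mono hℓ)
    ⟨_, hX, fun h => hχ3 (by rw [h, one_pow])⟩
  have hX1 : χ (X + C 0) = 1 := by
    have := hχ.map_X_pow_mul 1 monic_one
    rw [hχ.map_one] at this
    simpa using this
  rw [charSum_one_zmod_three, hX1] at h
  set ζ := χ (X + C 1)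
  set η := χ (X + C 2)
  set R : ℂ := ((√(3 : ℕ) : ℝ) : ℂ) with hR
  have hsq : R ^ 2 = 3 := by
    rw [hR, ← Complex.ofReal_pow, Real.sq_sqrt (Nat.cast_nonneg 3)]
    simp
  have hρ : ζ ^ 6 + ζ ^ 3 + 1 = 0 := by
    have : (ζ ^ 3 - 1) * (ζ ^ 6 + ζ ^ 3 + 1) = 0 := by linear_combination hz9
    exact (mul_eq_zero.1 this).resolve_left (sub_ne_zero.2 hχ3)
  have hη : η ^ 3 = ζ ^ 6 := by linear_combination ζ ^ 6 * hw - η ^ 3 * hz9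
  have hζi : IsIntegral ℤ ζ := isIntegral_of_pow_eq_one (by norm_num) hz9
  have hηi : IsIntegral ℤ η := by
    refine IsIntegral.of_pow (n := 3) (by norm_num) ?_
    rw [hη]
    exact hζi.pow 6
  have hR0 : R ≠ 0 := by
    intro h0
    rw [h0] at hsq
    norm_num at hsq
  -- Once `1 + ζ ^ 3 + η ^ 3` drops out, the cube of `1 + ζ + η` is three times `e₁ e₂ - e₃`, the
  -- elementary symmetric functions of 1, ζ, η.
  have hcube : R ^ 3 * s ^ 3 = 3 * (R * s * (ζ + ζ * η + η) - ζ * η) := by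
    rw [← mul_pow, ← h]
    linear_combination hρ + hη
  have hkey : ζ * η = R * (s * (ζ + ζ * η + η) - s ^ 3) := by
    have : R ^ 2 * (ζ * η) = R ^ 2 * (R * (s * (ζ + ζ * η + η) - s ^ 3)) := by
      rw [hsq]
      linear_combination hcube - R * s ^ 3 * hsq
    exact mul_left_cancel₀ (pow_ne_zero 2 hR0) this
  refine not_isIntegral_of_natCast_mul_eq_one (m := 27) (by norm_num)
    (w := (s * (ζ + ζ * η + η) - s ^ 3) ^ 6) ?_
    (((hs.mul ((hζi.add (hζi.mul hηi)).add hηi)).sub (hs.pow 3)).pow 6)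
  have h6 : (ζ * η) ^ 6 = R ^ 6 * (s * (ζ + ζ * η + η) - s ^ 3) ^ 6 := by
    rw [← mul_pow, ← hkey]
  have hR6 : R ^ 6 = 27 := by
    rw [show 6 = 2 * 3 by rfl, pow_mul, hsq]; norm_num
  rw [hR6, show 6 = 3 * 2 by rfl, pow_mul, hw] at h6
  push_cast
  rw [pow_mul] at *
  linear_combination -h6

end ShortInterval
end

noncomputable section
namespace ShortInterval

/-! ### Additive characters of finite fields -/

section AddChars

variable {F : Type*} [Field F] [Finite F]

theorem exists_eq_mul_left {ψ : AddChar F ℂ} (hψ : ψ ≠ 1) (φ : AddChar F ℂ) :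
    ∃ c, ∀ y, φ y = ψ (c * y) := by
  have := Fintype.ofFinite F
  have hinj := AddChar.to_mulShift_inj_of_isPrimitive (AddChar.IsPrimitive.of_ne_one hψ)
  have hbij := (Fintype.bijective_iff_injective_and_card _).2
    ⟨hinj, (AddChar.card_eq (α := F)).symm⟩
  obtain ⟨c, hc⟩ := hbij.2 φ
  exact ⟨c, fun y => by rw [← hc, AddChar.mulShift_apply]⟩

omit [Finite F] in
theorem sum_addChar_mul [Fintype F] [DecidableEq F] {ψ : AddChar F ℂ} (hψ : ψ ≠ 1) (c : F) :
    ∑ y, ψ (c * y) = if c = 0 then (Nat.card F : ℂ) else 0 := by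
  have h := AddChar.sum_mulShift c (AddChar.IsPrimitive.of_ne_one hψ)
  rw [Nat.cast_ite, Nat.cast_zero] at h
  rw [Nat.card_eq_fintype_card, ← h]
  exact Finset.sum_congr rfl fun y _ => by rw [mul_comm]

-- The trace character. Its Frobenius invariance allows p-th powers inside ψ to be replaced by first
-- powers, which linearizes several sums below.
variable (F) in
theorem exists_frobenius_invariant_addChar (p : ℕ) [hp : Fact p.Prime] [CharP F p] :
    ∃ ψ : AddChar F ℂ, ψ ≠ 1 ∧ (∀ y, ψ (y ^ p) = ψ y) := by
  let _ : Algebra (ZMod p) F := ZMod.algebra F p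
  refine ⟨(ZMod.stdAddChar (N := p)).compAddMonoidHom
    (Algebra.trace (ZMod p) F).toAddMonoidHom, ?_, ?_⟩
  · intro h
    obtain ⟨x, hx⟩ := Algebra.trace_surjective (ZMod p) F 1
    have h1 := DFunLike.congr_fun h x
    simp only [AddChar.compAddMonoidHom_apply, LinearMap.toAddMonoidHom_coe, hx,
      AddChar.one_apply] at h1
    exact one_ne_zero (((ZMod.isPrimitive_stdAddChar p).zmod_char_eq_one_iff p _).1 h1)
  · intro y
    simp only [AddChar.compAddMonoidHom_apply, LinearMap.toAddMonoidHom_coe]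
    congr 1
    have := Algebra.trace_eq_of_algEquiv
      (FiniteField.frobeniusAlgEquivOfAlgebraic (ZMod p) F) y
    rw [FiniteField.coe_frobeniusAlgEquivOfAlgebraic, ZMod.card] at this
    exact this

theorem conj_eq_inv_of_norm_eq_one {z : ℂ} (h : ‖z‖ = 1) : (starRingEnd ℂ) z * z = 1 := by
  rw [mul_comm, Complex.mul_conj, Complex.normSq_eq_norm_sq, h]
  simp

theorem conj_addChar_mul_self (ψ : AddChar F ℂ) (y : F) : (starRingEnd ℂ) (ψ y) * ψ y = 1 :=
  conj_eq_inv_of_norm_eq_one (ψ.norm_apply y)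

end AddChars

/-! ### Characters of level three -/

/-- A unitary character of the group of triples `(a, b, c)`, thought of as
`1 + a t + b t ^ 2 + c t ^ 3` modulo `t ^ 4`. -/
structure IsTripleChar {F : Type*} [Field F] (T : F → F → F → ℂ) : Prop where
  one : T 0 0 0 = 1
  mul : ∀ a b c a' b' c',
    T a b c * T a' b' c' = T (a + a') (b + a * a' + b') (c + a * b' + b * a' + c')
  norm : ∀ a b c, ‖T a b c‖ = 1

/-- The monic cubic polynomial with given coefficients. -/
def cubic {F : Type*} [Field F] (a b c : F) : F[X] := X * (X * (X + C a) + C b) + C c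

section Cubic

variable {F : Type*} [Field F]

theorem cubic_eq (a b c : F) : cubic a b c = X ^ 3 + C a * X ^ 2 + C b * X + C c := by
  rw [cubic]; ring

theorem natDegree_cubic (a b c : F) : (cubic a b c).natDegree = 3 := by
  rw [cubic_eq]; compute_degree!

theorem monic_cubic (a b c : F) : (cubic a b c).Monic := by
  rw [Monic, leadingCoeff, natDegree_cubic, cubic_eq]
  simp

theorem coeff_reverse_cubic (a b c : F) :
    (cubic a b c).reverse.coeff 1 = a ∧ (cubic a b c).reverse.coeff 2 = b ∧
      (cubic a b c).reverse.coeff 3 = c := by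
  simp only [← nextToLeading_eq_coeff_reverse, nextToLeading, natDegree_cubic]
  simp [cubic_eq, coeff_X, coeff_C]

theorem agree_three_iff {f g : F[X]} (hf : f.Monic) (hg : g.Monic) :
    Agree 3 f g ↔ f.reverse.coeff 1 = g.reverse.coeff 1 ∧
      f.reverse.coeff 2 = g.reverse.coeff 2 ∧ f.reverse.coeff 3 = g.reverse.coeff 3 := by
  rw [agree_iff]
  constructor
  · intro h
    exact ⟨h 1 (by omega), h 2 (by omega), h 3 (by omega)⟩
  · rintro ⟨h1, h2, h3⟩ j hj
    interval_cases j
    · rw [coeff_zero_reverse, coeff_zero_reverse, hf.leadingCoeff, hg.leadingCoeff]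
    all_goals assumption

variable {χ : F[X] → ℂ}

theorem IsLevelChar.eq_cubic (hχ : IsLevelChar 3 χ) {f : F[X]} (hf : f.Monic) :
    χ f = χ (cubic (f.reverse.coeff 1) (f.reverse.coeff 2) (f.reverse.coeff 3)) := by
  refine hχ.congr hf (monic_cubic _ _ _) ((agree_three_iff hf (monic_cubic _ _ _)).2 ?_)
  obtain ⟨h1, h2, h3⟩ :=
    coeff_reverse_cubic (f.reverse.coeff 1) (f.reverse.coeff 2) (f.reverse.coeff 3)
  exact ⟨h1.symm, h2.symm, h3.symm⟩

variable [Finite F]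

theorem IsLevelChar.isTripleChar (hχ : IsLevelChar 3 χ) :
    IsTripleChar fun a b c => χ (cubic a b c) where
  one := by
    have : cubic (0 : F) 0 0 = X ^ 3 * 1 := by rw [cubic_eq]; simp
    rw [this, hχ.map_X_pow_mul 3 monic_one, hχ.map_one]
  mul := by
    intro a b c a' b' c'
    rw [← hχ.map_mul (monic_cubic _ _ _) (monic_cubic _ _ _),
      hχ.eq_cubic ((monic_cubic a b c).mul (monic_cubic a' b' c'))]
    obtain ⟨h1, h2, h3, -⟩ := coeff_reverse_mul (monic_cubic a b c) (monic_cubic a' b' c')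
    obtain ⟨e1, e2, e3⟩ := coeff_reverse_cubic a b c
    obtain ⟨e1', e2', e3'⟩ := coeff_reverse_cubic a' b' c'
    rw [h1, h2, h3, e1, e2, e3, e1', e2', e3']
    congr 2
    ring
  norm := fun a b c => hχ.norm_eq_one (monic_cubic a b c)

theorem IsLevelChar.charSum_one_eq [Fintype F] (hχ : IsLevelChar 3 χ) :
    charSum χ 1 = ∑ a : F, χ (cubic a 0 0) := by
  rw [charSum_one]
  refine Finset.sum_congr rfl fun a _ => ?_
  have : cubic a 0 0 = X ^ 2 * (X + C a) := by rw [cubic]; simp; ring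
  rw [this, hχ.map_X_pow_mul 2 (monic_X_add_C a)]

theorem IsLevelChar.charSum_two_eq [Fintype F] (hχ : IsLevelChar 3 χ) :
    charSum χ 2 = ∑ a : F, ∑ b : F, χ (cubic a b 0) := by
  rw [charSum, sum_monics_succ, sum_monics_succ, monics_zero, Finset.sum_singleton]
  refine Finset.sum_congr rfl fun a _ => Finset.sum_congr rfl fun b _ => ?_
  have : cubic a b 0 = X ^ 1 * (X * (X * 1 + C a) + C b) := by rw [cubic]; simp
  rw [this, hχ.map_X_pow_mul 1]
  have h1 : (X * (X * 1 + C a) + C b : F[X]) = X ^ 2 + C a * X + C b := by ring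
  rw [h1, Monic, leadingCoeff]
  have h2 : (X ^ 2 + C a * X + C b : F[X]).natDegree = 2 := by compute_degree!
  rw [h2]
  simp

/-- At level 3 the L-polynomial has degree at most 2, and its inverse roots satisfy the reciprocal
quadratic. The condition `α ≠ 0` covers lower levels, where the quadratic has spurious zero roots.
-/
theorem mangoldtSum_add_of_forall_root (hχ : IsLevelChar 3 χ) (hne : ∃ g : F[X], g.Monic ∧ χ g ≠ 1)
    {M : ℕ} {w : ℂ}
    (h : ∀ α : ℂ, α ≠ 0 → α ^ 2 + charSum χ 1 * α + charSum χ 2 = 0 → α ^ M = w)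
    {n : ℕ} (hn : 0 < n) : mangoldtSum χ (n + M) = w * mangoldtSum χ n := by
  obtain ⟨s, hs, hsum⟩ := exists_inverse_roots hχ hne
  rw [hsum _ (by omega), hsum n hn, mul_neg, neg_inj, ← Multiset.sum_map_mul_left]
  congr 1
  refine Multiset.map_congr rfl fun α hα => ?_
  obtain ⟨h0, h1⟩ := hs α hα
  rw [pow_add, mul_comm, h α h0]
  simp only [Finset.sum_range_succ, Finset.sum_range_zero, charSum_zero hχ] at h1
  field_simp at h1
  linear_combination h1

end Cubic

namespace IsTripleChar

variable {F : Type*} [Field F] {T : F → F → F → ℂ} (hT : IsTripleChar T)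
include hT

/-- The restriction to `1 + b t ^ 2`. -/
def second : AddChar F ℂ where
  toFun b := T 0 b 0
  map_zero_eq_one' := hT.one
  map_add_eq_mul' b b' := by rw [hT.mul]; simp

/-- The restriction to `1 + c t ^ 3`. -/
def third : AddChar F ℂ where
  toFun c := T 0 0 c
  map_zero_eq_one' := hT.one
  map_add_eq_mul' c c' := by rw [hT.mul]; simp

theorem second_apply (b : F) : hT.second b = T 0 b 0 := rfl

theorem third_apply (c : F) : hT.third c = T 0 0 c := rfl

theorem eq_mul (a b c : F) : T a b c = T a 0 0 * (hT.second b * hT.third (c - a * b)) := by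
  rw [second_apply, third_apply, hT.mul, hT.mul]
  congr 1 <;> ring

variable [Fintype F]

/-- Weyl differencing: `(1 + (a + b) t) / (1 + b t)` is `1 + a t - a b t ^ 2 + a b ^ 2 t ^ 3` modulo
`t ^ 4`, and the unitary factor `T b 0 0` cancels its conjugate. -/
theorem sum_mul_conj_sum : (∑ a, T a 0 0) * (starRingEnd ℂ) (∑ a, T a 0 0) =
    ∑ a, T a 0 0 * ∑ b, hT.second (-(b * a)) * hT.third (b ^ 2 * a + b * a ^ 2) := by
  rw [map_sum, Finset.sum_mul_sum, Finset.sum_comm]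
  simp only [Finset.mul_sum]
  rw [Finset.sum_comm (γ := F) (f := fun a b => T a 0 0 *
    (hT.second (-(b * a)) * hT.third (b ^ 2 * a + b * a ^ 2)))]
  refine Finset.sum_congr rfl fun b _ => ?_
  rw [← Equiv.sum_comp (Equiv.addRight b)]
  refine Finset.sum_congr rfl fun a _ => ?_
  have h1 : T (a + b) 0 0 = T b 0 0 * T a (-(b * a)) (b ^ 2 * a) := by
    rw [hT.mul]
    congr 1 <;> ring
  rw [Equiv.coe_addRight, h1, eq_mul hT a]
  have h2 := conj_eq_inv_of_norm_eq_one (hT.norm b 0 0)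
  rw [show b ^ 2 * a - a * -(b * a) = b ^ 2 * a + b * a ^ 2 by ring]
  linear_combination (T a 0 0 * (hT.second (-(b * a)) * hT.third (b ^ 2 * a + b * a ^ 2))) * h2

/-- For fixed `a` the dependence on `b` is an additive character of slope proportional to `a₀ - a`,
so the inner sum vanishes unless `a = a₀`. This gives the constant of the functional equation. -/
theorem exists_sum_sum_eq (h3 : hT.third ≠ 1) :
    ∃ a₀, ∑ a, ∑ b, T a b 0 = Nat.card F * T a₀ 0 0 := by
  classical
  obtain ⟨a₀, ha₀⟩ := exists_eq_mul_left h3 hT.second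
  refine ⟨a₀, ?_⟩
  rw [Finset.sum_eq_single a₀]
  · have : ∀ b, T a₀ b 0 = T a₀ 0 0 := by
      intro b
      rw [hT.eq_mul a₀ b, ha₀, ← AddChar.map_add_eq_mul]
      simp
    simp only [this]
    rw [Finset.sum_const, Finset.card_univ, nsmul_eq_mul, Nat.card_eq_fintype_card]
  · intro a _ ha
    have : ∀ b, T a b 0 = T a 0 0 * hT.third ((a₀ - a) * b) := by
      intro b
      rw [hT.eq_mul a b, ha₀, ← AddChar.map_add_eq_mul]
      congr 2
      ring
    rw [Finset.sum_congr rfl fun b _ => this b, ← Finset.mul_sum, sum_addChar_mul h3,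
      if_neg (sub_ne_zero.2 (Ne.symm ha)), mul_zero]
  · simp

/-- The functional equation relating `c₁` to its conjugate. After factoring out `1 + c t`, the sum
over `c` is that of `hT.third (-b * c)`, which leaves only `b = 0`. -/
theorem sum_sum_mul_conj (h3 : hT.third ≠ 1) :
    (∑ a, ∑ b, T a b 0) * (starRingEnd ℂ) (∑ a, T a 0 0) = Nat.card F * ∑ a, T a 0 0 := by
  classical
  have h1 : (∑ a, ∑ b, T a b 0) * (starRingEnd ℂ) (∑ a, T a 0 0) =
      ∑ c, ∑ a, ∑ b, T a b 0 * (starRingEnd ℂ) (T c 0 0) := by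
    rw [map_sum, Finset.mul_sum]
    simp only [Finset.sum_mul]
  have h2 : ∀ c, ∑ a, ∑ b, T a b 0 * (starRingEnd ℂ) (T c 0 0) =
      ∑ a, ∑ b, T a b 0 * hT.third (-b * c) := by
    intro c
    rw [← Equiv.sum_comp (Equiv.addRight c)]
    refine Finset.sum_congr rfl fun a _ => ?_
    rw [← Equiv.sum_comp (Equiv.addRight (c * a))]
    refine Finset.sum_congr rfl fun b _ => ?_
    have e1 : T (a + c) (b + c * a) 0 = T c 0 0 * (T a b 0 * hT.third (-b * c)) := by
      rw [third_apply, hT.mul, hT.mul]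
      congr 1 <;> ring
    rw [Equiv.coe_addRight, Equiv.coe_addRight, e1]
    have h2 := conj_eq_inv_of_norm_eq_one (hT.norm c 0 0)
    linear_combination (T a b 0 * hT.third (-b * c)) * h2
  rw [h1, Finset.sum_congr rfl fun c _ => h2 c, Finset.sum_comm, Finset.mul_sum]
  refine Finset.sum_congr rfl fun a _ => ?_
  rw [Finset.sum_comm, Finset.sum_eq_single 0]
  · rw [Nat.card_eq_fintype_card]
    simp [mul_comm]
  · intro b _ hb
    rw [← Finset.mul_sum, sum_addChar_mul h3, if_neg (neg_ne_zero.2 hb), mul_zero]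
  · simp

/-- A character of lower level has an L-polynomial of lower degree. -/
theorem sum_sum_eq_zero (h3 : hT.third = 1) (hne : ∃ a b c, T a b c ≠ 1) :
    ∑ a, ∑ b, T a b 0 = 0 ∧ (hT.second = 1 → ∑ a, T a 0 0 = 0) := by
  have key : hT.second = 1 → ∑ a, T a 0 0 = 0 := by
    intro h2
    have hval : ∀ a b c, T a b c = T a 0 0 := by
      intro a b c
      rw [hT.eq_mul a b c, h2, h3]
      simp
    let φ : AddChar F ℂ :=
      { toFun := fun a => T a 0 0
        map_zero_eq_one' := hT.one
        map_add_eq_mul' := fun a a' => by rw [hT.mul]; exact (hval _ _ _).symm }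
    have hφ : φ ≠ 1 := by
      rintro h
      obtain ⟨a, b, c, habc⟩ := hne
      apply habc
      rw [hval]
      exact DFunLike.congr_fun h a
    exact AddChar.sum_eq_zero_of_ne_one hφ
  refine ⟨?_, key⟩
  have h1 : ∀ a b, T a b 0 = T a 0 0 * hT.second b := by
    intro a b
    rw [hT.eq_mul a b 0, h3]
    simp
  rw [Finset.sum_congr rfl fun a _ => Finset.sum_congr rfl fun b _ => h1 a b,
    ← Finset.sum_mul_sum]
  by_cases h2 : hT.second = 1
  · rw [key h2, zero_mul]
  · rw [AddChar.sum_eq_zero_of_ne_one h2, mul_zero]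

theorem sum_mul_conj_of_third_eq_one (h3 : hT.third = 1) (h2 : hT.second ≠ 1) :
    (∑ a, T a 0 0) * (starRingEnd ℂ) (∑ a, T a 0 0) = Nat.card F := by
  classical
  rw [sum_mul_conj_sum hT, Finset.sum_eq_single 0]
  · rw [Nat.card_eq_fintype_card]
    simp [hT.one, h3]
  · intro a _ ha
    have : ∀ b, hT.second (-(b * a)) * hT.third (b ^ 2 * a + b * a ^ 2) = hT.second (-a * b) := by
      intro b
      rw [h3, AddChar.one_apply, mul_one]
      congr 1
      ring
    simp only [this]
    rw [sum_addChar_mul h2, if_neg (neg_ne_zero.2 ha), mul_zero]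
  · simp

end IsTripleChar

end ShortInterval
end

noncomputable section
namespace ShortInterval

/-! ### Characters of level three in characteristic two -/

/-- A Gaussian integer of norm `2 ^ k` is a unit times `(1 + i) ^ k`, and `(1 + i) ^ 4 = -4`. -/
theorem pow_four_of_sq_add_sq (k : ℕ) (x y : ℤ) (h : x ^ 2 + y ^ 2 = 2 ^ k) :
    ((x : ℂ) + y * Complex.I) ^ 4 = (-4) ^ k := by
  have hI := Complex.I_sq
  induction k generalizing x y with
  | zero =>
    rw [pow_zero] at h
    have hx : -1 ≤ x ∧ x ≤ 1 := ⟨by nlinarith [sq_nonneg y], by nlinarith [sq_nonneg y]⟩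
    have hy : -1 ≤ y ∧ y ≤ 1 := ⟨by nlinarith [sq_nonneg x], by nlinarith [sq_nonneg x]⟩
    obtain ⟨hx1, hx2⟩ := hx
    obtain ⟨hy1, hy2⟩ := hy
    interval_cases x <;> interval_cases y <;>
      simp [Even.neg_pow (show Even 4 by decide)] at h ⊢
  | succ k ih =>
    have hpar : Even (x + y) := by
      have h1 : Even (x ^ 2 + y ^ 2) := by
        rw [h, pow_succ]
        exact even_two.mul_left _
      rw [Int.even_add, Int.even_pow' two_ne_zero, Int.even_pow' two_ne_zero] at h1
      exact Int.even_add.2 h1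
    obtain ⟨u, hu⟩ := hpar
    -- Equal parity of x and y is divisibility by `1 + i`, with quotient `u + (u - x) i`.
    obtain rfl : y = u + u - x := by omega
    have h2 := ih u (u - x) (by
      rw [pow_succ (2 : ℤ) k] at h
      linarith)
    rw [pow_succ (-4 : ℂ), ← h2]
    have hfac : ((x : ℂ) + ((u + u - x : ℤ) : ℂ) * Complex.I) =
        (1 + Complex.I) * ((u : ℂ) + ((u - x : ℤ) : ℂ) * Complex.I) := by
      push_cast
      linear_combination (-(u : ℂ) + x) * hI
    have h4 : (1 + Complex.I) ^ 4 = -4 := by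
      linear_combination (Complex.I ^ 2 + 4 * Complex.I + 5) * hI
    rw [hfac, mul_pow, h4, mul_comm]

theorem not_three_dvd_two_pow_sum (k : ℕ) (x y : ℤ) : x ^ 2 + y ^ 2 ≠ 2 ^ k * 3 := by
  intro h
  have key : ∀ a b : ZMod 3, a ^ 2 + b ^ 2 = 0 → a = 0 ∧ b = 0 := by decide
  have h1 := congrArg (Int.cast : ℤ → ZMod 3) h
  push_cast at h1
  rw [show (3 : ZMod 3) = 0 from rfl, mul_zero] at h1
  obtain ⟨hx, hy⟩ := key _ _ h1
  rw [ZMod.intCast_zmod_eq_zero_iff_dvd] at hx hy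
  obtain ⟨x', rfl⟩ := hx
  obtain ⟨y', rfl⟩ := hy
  have h2 : (3 : ℤ) ∣ 2 ^ k := ⟨x' ^ 2 + y' ^ 2, by push_cast at h; linarith⟩
  have h3 := Int.Prime.dvd_pow' (n := 2) (p := 3) (by norm_num) (by exact_mod_cast h2)
  omega

theorem mem_gaussianInt_of_pow_four_eq_one {z : ℂ} (h : z ^ 4 = 1) :
    z ∈ GaussianInt.toComplex.range := by
  have h1 : (z - 1) * (z + 1) * ((z - Complex.I) * (z + Complex.I)) = 0 := by
    linear_combination h - (z ^ 2 - 1) * Complex.I_sq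
  have hI : Complex.I ∈ GaussianInt.toComplex.range :=
    ⟨⟨0, 1⟩, by simp [GaussianInt.toComplex_def]⟩
  rcases mul_eq_zero.1 h1 with h1 | h1 <;> rcases mul_eq_zero.1 h1 with h1 | h1
  · rw [sub_eq_zero.1 h1]
    exact one_mem _
  · rw [eq_neg_of_add_eq_zero_left h1]
    exact neg_mem (one_mem _)
  · rwa [sub_eq_zero.1 h1]
  · rw [eq_neg_of_add_eq_zero_left h1]
    exact neg_mem hI

theorem exists_int_of_mem_gaussianInt {z : ℂ} (h : z ∈ GaussianInt.toComplex.range) :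
    ∃ x y : ℤ, z = x + y * Complex.I := by
  obtain ⟨w, rfl⟩ := h
  exact ⟨w.re, w.im, GaussianInt.toComplex_def w⟩

theorem add_mul_I_mul_conj (x y : ℤ) : ((x : ℂ) + y * Complex.I) *
    (starRingEnd ℂ) ((x : ℂ) + y * Complex.I) = ((x ^ 2 + y ^ 2 : ℤ) : ℂ) := by
  simp only [map_add, map_mul, Complex.conj_I, map_intCast]
  push_cast
  linear_combination (-(y : ℂ) ^ 2) * Complex.I_sq

namespace IsTripleChar

variable {F : Type*} [Field F] {T : F → F → F → ℂ} (hT : IsTripleChar T)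
include hT

/-- In characteristic 2, `(1 + a t) ^ 4` is 1 modulo `t ^ 4`. -/
theorem pow_four_eq_one [CharP F 2] (a : F) : T a 0 0 ^ 4 = 1 := by
  have h2 : (2 : F) = 0 := CharTwo.two_eq_zero
  have h : T a 0 0 ^ 4 = T a 0 0 * T a 0 0 * (T a 0 0 * T a 0 0) := by ring
  rw [h, hT.mul, hT.mul, ← hT.one]
  congr 1
  · linear_combination 2 * a * h2
  · linear_combination (3 * a ^ 2) * h2
  · linear_combination (2 * a ^ 3) * h2

variable [Fintype F]

theorem sum_mem_gaussianInt [CharP F 2] : ∑ a, T a 0 0 ∈ GaussianInt.toComplex.range :=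
  sum_mem fun a _ => mem_gaussianInt_of_pow_four_eq_one (hT.pow_four_eq_one a)

theorem sum_pow_eight [CharP F 2] {k : ℕ}
    (h : (∑ a, T a 0 0) * (starRingEnd ℂ) (∑ a, T a 0 0) = 2 ^ k) :
    (∑ a, T a 0 0) ^ 8 = 16 ^ k := by
  obtain ⟨x, y, hxy⟩ := exists_int_of_mem_gaussianInt hT.sum_mem_gaussianInt
  rw [hxy] at h ⊢
  rw [add_mul_I_mul_conj] at h
  have h1 := pow_four_of_sq_add_sq k x y (by exact_mod_cast h)
  rw [show 8 = 4 * 2 from rfl, pow_mul, h1, ← pow_mul, mul_comm, pow_mul]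
  norm_num

/-- With ψ Frobenius invariant, `ψ (l a b ^ 2) = ψ (e b)` for `e ^ 2 = l a`. The inner sum of
`sum_mul_conj_sum` is then linear in `b` and selects the `a` with `-m a + e + l a ^ 2 = 0`; squaring
this condition gives a quartic in `a`. -/
theorem sum_filter_of_charTwo [CharP F 2] (h3 : hT.third ≠ 1) :
    ∃ S : Finset F, S.card ≤ 4 ∧
      (∑ a, T a 0 0) * (starRingEnd ℂ) (∑ a, T a 0 0) = Nat.card F * ∑ a ∈ S, T a 0 0 := by
  classical
  have h20 : (2 : F) = 0 := CharTwo.two_eq_zero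
  have : Fact (Nat.Prime 2) := ⟨Nat.prime_two⟩
  obtain ⟨ψ, hψ, hfrob⟩ := exists_frobenius_invariant_addChar F 2
  obtain ⟨m, hm⟩ := exists_eq_mul_left hψ hT.second
  obtain ⟨l, hl⟩ := exists_eq_mul_left hψ hT.third
  have hl0 : l ≠ 0 := by
    rintro rfl
    apply h3
    ext y
    simp [hl]
  have hsq : ∀ a : F, ∃ e, e ^ 2 = l * a := fun a =>
    (bijective_frobenius F 2).2 (l * a)
  choose e he using hsq
  let S := Finset.univ.filter fun a : F => -(m * a) + e a + l * a ^ 2 = 0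
  have hS : S ⊆ (C (l ^ 2) * X ^ 4 + C (-m ^ 2) * X ^ 2 + C l * X : F[X]).roots.toFinset := by
    intro a ha
    have ha' := (Finset.mem_filter.1 ha).2
    rw [Multiset.mem_toFinset, mem_roots']
    constructor
    · intro h0
      have := congrArg (coeff · 4) h0
      simp only [coeff_add, coeff_C_mul, coeff_X_pow, coeff_X] at this
      norm_num at this
      exact hl0 this
    · simp only [IsRoot, eval_add, eval_mul, eval_C, eval_pow, eval_X]
      linear_combination (-(e a) + l * a ^ 2 - m * a) * ha' + he a +
        (l * a ^ 3 * m - m ^ 2 * a ^ 2 + l * a) * h20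
  refine ⟨S, ?_, ?_⟩
  · refine (Finset.card_le_card hS).trans ((Multiset.toFinset_card_le _).trans
      ((card_roots' _).trans ?_))
    compute_degree
  · rw [sum_mul_conj_sum hT, Finset.mul_sum, Finset.sum_filter]
    refine Finset.sum_congr rfl fun a _ => ?_
    have h1 : ∀ b, hT.second (-(b * a)) * hT.third (b ^ 2 * a + b * a ^ 2) =
        ψ ((-(m * a) + e a + l * a ^ 2) * b) := by
      intro b
      rw [hm, hl, mul_add l, AddChar.map_add_eq_mul,
        show l * (b ^ 2 * a) = (e a * b) ^ 2 by rw [mul_pow, he]; ring, hfrob,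
        ← AddChar.map_add_eq_mul, ← AddChar.map_add_eq_mul]
      congr 1
      ring
    rw [Finset.sum_congr rfl fun b _ => h1 b, sum_addChar_mul hψ]
    split_ifs
    · ring
    · ring

/-- The sum over `S` is a Gaussian integer of norm at most 4 in absolute value. It is real and
nonnegative because `|c₁| ^ 2` is, and 3 is excluded because `2 ^ r * 3` is not a sum of two
squares. -/
theorem exists_card_mul_of_charTwo [CharP F 2] {r : ℕ} (hF : Nat.card F = 2 ^ r)
    (h3 : hT.third ≠ 1) :
    ∃ m : ℕ, (m = 0 ∨ m = 1 ∨ m = 2 ∨ m = 4) ∧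
      (∑ a, T a 0 0) * (starRingEnd ℂ) (∑ a, T a 0 0) = 2 ^ r * m := by
  obtain ⟨S, hS, hsum⟩ := hT.sum_filter_of_charTwo h3
  obtain ⟨x, y, hxy⟩ := exists_int_of_mem_gaussianInt hT.sum_mem_gaussianInt
  have hSG : ∑ a ∈ S, T a 0 0 ∈ GaussianInt.toComplex.range :=
    sum_mem fun a _ => mem_gaussianInt_of_pow_four_eq_one (hT.pow_four_eq_one a)
  obtain ⟨u, v, huv⟩ := exists_int_of_mem_gaussianInt hSG
  have hnorm : ‖∑ a ∈ S, T a 0 0‖ ≤ 4 := by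
    refine (norm_sum_le _ _).trans ?_
    simp only [hT.norm, Finset.sum_const, nsmul_eq_mul, mul_one]
    exact_mod_cast hS
  have h1 := hsum
  rw [huv, hxy, add_mul_I_mul_conj, hF] at h1
  have hre := congrArg Complex.re h1
  have hq : (((2 ^ r : ℕ) : ℂ)) = (((2 ^ r : ℕ) : ℝ) : ℂ) := by push_cast; rfl
  rw [hq, Complex.re_ofReal_mul] at hre
  have him := congrArg Complex.im h1
  rw [hq, Complex.im_ofReal_mul] at him
  simp only [Complex.intCast_re, Complex.intCast_im, Complex.add_re, Complex.mul_re,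
    Complex.I_re, Complex.I_im, Complex.add_im, Complex.mul_im] at hre him
  have hre' : x ^ 2 + y ^ 2 = 2 ^ r * u := by
    have : ((x ^ 2 + y ^ 2 : ℤ) : ℝ) = ((2 ^ r * u : ℤ) : ℝ) := by rw [hre]; push_cast; ring
    exact_mod_cast this
  have hv : v = 0 := by
    have : (2 ^ r : ℝ) ≠ 0 := by positivity
    have h2 : ((2 ^ r : ℕ) : ℝ) * v = 0 := by linarith
    push_cast at h2
    exact_mod_cast (mul_eq_zero.1 h2).resolve_left this
  have hu0 : 0 ≤ u := by
    have h2 : 0 ≤ 2 ^ r * u := by rw [← hre']; positivity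
    exact nonneg_of_mul_nonneg_right h2 (by positivity)
  have hu4 : u ≤ 4 := by
    rw [huv, hv, Int.cast_zero, zero_mul, add_zero, Complex.norm_intCast] at hnorm
    have := (le_abs_self _).trans hnorm
    exact_mod_cast this
  have hu3 : u ≠ 3 := by
    rintro rfl
    exact not_three_dvd_two_pow_sum r x y hre'
  lift u to ℕ using hu0
  refine ⟨u, by omega, ?_⟩
  rw [hxy, add_mul_I_mul_conj, hre']
  push_cast
  rfl

/-- The inverse roots of the L-function of a primitive character of level three. -/
theorem root_pow_of_charTwo [CharP F 2] {r : ℕ} (hF : Nat.card F = 2 ^ r) (h3 : hT.third ≠ 1)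
    {α : ℂ} (hα : α ^ 2 + (∑ a, T a 0 0) * α + ∑ a, ∑ b, T a b 0 = 0) :
    α ^ 24 = (Nat.card F : ℂ) ^ 12 := by
  obtain ⟨m, hm, hcc⟩ := hT.exists_card_mul_of_charTwo hF h3
  obtain ⟨a₀, ha₀⟩ := hT.exists_sum_sum_eq h3
  have ht := hT.pow_four_eq_one a₀
  have hc2 := hT.sum_sum_mul_conj h3
  have hq0 : (Nat.card F : ℂ) ≠ 0 := by
    rw [hF]
    simp
  have hqq : (2 : ℂ) ^ r = Nat.card F := by rw [hF]; push_cast; rfl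
  have h16 : ∀ j, (16 : ℂ) ^ (r + j) = (Nat.card F : ℂ) ^ 4 * 16 ^ j := by
    intro j
    rw [pow_add, ← hqq, ← pow_mul, mul_comm r, pow_mul]
    norm_num
  have hpow : ∀ j : ℕ, m = 2 ^ j → (∑ a, T a 0 0) ^ 8 = (Nat.card F : ℂ) ^ 4 * 16 ^ j := by
    intro j hj
    rw [← h16]
    apply hT.sum_pow_eight
    rw [hcc, hj, pow_add]
    push_cast
    rfl
  have hm2 : (∑ a, ∑ b, T a b 0) * m = (∑ a, T a 0 0) ^ 2 := by
    rw [hqq] at hcc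
    refine mul_left_cancel₀ hq0 ?_
    linear_combination (∑ a, T a 0 0) * hc2 - (∑ a, ∑ b, T a b 0) * hcc
  clear hc2
  revert hα ha₀ hcc hpow hm2
  generalize (∑ a, T a 0 0) = c, (∑ a, ∑ b, T a b 0) = d, T a₀ 0 0 = t at *
  intro hα hcc ha₀ hpow hm2
  -- Apart from m = 0, where `α ^ 2 = -c₂`, the relation `m c₂ = c₁ ^ 2` determines `α / c₁`: a
  -- primitive cube root of unity, `(-1 ± i) / 2`, or `-1/2`. The exponent 24 covers all four cases.
  rcases hm with rfl | rfl | rfl | rfl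
  · have hc : c = 0 := by simpa using hm2.symm
    have h1 : α ^ 2 = -(Nat.card F * t) := by
      rw [hc, ha₀] at hα
      linear_combination hα
    rw [show 24 = 2 * 12 from rfl, pow_mul, h1]
    linear_combination (Nat.card F : ℂ) ^ 12 * (t ^ 8 + t ^ 4 + 1) * ht
  · have h1 : α ^ 3 = c ^ 3 := by
      push_cast at hm2
      linear_combination (α - c) * hα - (α - c) * hm2
    have h2 := hpow 0 rfl
    rw [show 24 = 3 * 8 from rfl, pow_mul, h1, ← pow_mul, mul_comm 3, pow_mul, h2]
    ring
  · have h1 : α ^ 4 = -c ^ 4 / 4 := by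
      push_cast at hm2
      linear_combination (α ^ 2 - c * α + c ^ 2 / 2) * hα - (α ^ 2 - c * α + c ^ 2 / 2) / 2 * hm2
    have h2 := hpow 1 rfl
    rw [show 24 = 4 * 6 from rfl, pow_mul, h1,
      show (-c ^ 4 / 4) ^ 6 = (c ^ 8) ^ 3 / 4 ^ 6 by ring, h2]
    ring
  · have h1 : (α + c / 2) ^ 2 = 0 := by
      push_cast at hm2
      linear_combination hα - hm2 / 4
    have h1' : α = -(c / 2) := eq_neg_of_add_eq_zero_left (pow_eq_zero_iff two_ne_zero |>.1 h1)
    have h2 := hpow 2 rfl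
    rw [h1', show (-(c / 2)) ^ 24 = (c ^ 8) ^ 3 / 2 ^ 24 by ring, h2]
    ring

/-- The inverse roots of the L-function of a character of level two. -/
theorem root_pow_of_charTwo_of_third_eq_one [CharP F 2] {r : ℕ} (hF : Nat.card F = 2 ^ r)
    (h3 : hT.third = 1) (hne : ∃ a b c, T a b c ≠ 1) {α : ℂ} (h0 : α ≠ 0)
    (hα : α ^ 2 + (∑ a, T a 0 0) * α + ∑ a, ∑ b, T a b 0 = 0) :
    α ^ 8 = (Nat.card F : ℂ) ^ 4 := by
  obtain ⟨hd, hc⟩ := hT.sum_sum_eq_zero h3 hne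
  have hαc : α = -∑ a, T a 0 0 := by
    refine mul_left_cancel₀ h0 ?_
    linear_combination hα - hd
  have h2 : hT.second ≠ 1 := by
    intro h
    rw [hc h, neg_zero] at hαc
    exact h0 hαc
  have hcc := hT.sum_mul_conj_of_third_eq_one h3 h2
  rw [hF, Nat.cast_pow] at hcc
  have h8 := hT.sum_pow_eight (by exact_mod_cast hcc)
  rw [hαc, hF, neg_pow, h8]
  push_cast
  rw [← pow_mul, mul_comm r, pow_mul]
  norm_num

end IsTripleChar

end ShortInterval
end

noncomputable section
namespace ShortInterval

/-! ### Sums over squares, and characters of level two in odd characteristic -/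

section Squares

variable {F : Type*} [Field F] [Fintype F] [DecidableEq F]

/-- An element y has `1 + quadraticChar F y` square roots. -/
theorem sum_comp_sq (hF : ringChar F ≠ 2) (f : F → ℂ) :
    ∑ x, f (x ^ 2) = ∑ y, f y + ∑ y, (quadraticChar F y : ℂ) * f y := by
  rw [← Finset.sum_add_distrib, ← Finset.sum_fiberwise_of_maps_to (g := fun x : F => x ^ 2)
    (fun x _ => Finset.mem_univ (x ^ 2))]
  refine Finset.sum_congr rfl fun y _ => ?_
  have h1 : ∀ x ∈ Finset.univ.filter (fun x : F => x ^ 2 = y), f (x ^ 2) = f y := fun x hx => by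
    rw [(Finset.mem_filter.1 hx).2]
  have h2 := quadraticChar_card_sqrts hF y
  have h3 : ({x : F | x ^ 2 = y} : Set F).toFinset = Finset.univ.filter (fun x : F => x ^ 2 = y) := by
    ext; simp
  rw [h3] at h2
  rw [Finset.sum_congr rfl h1, Finset.sum_const, nsmul_eq_mul]
  have h4 := congrArg (Int.cast : ℤ → ℂ) h2
  push_cast at h4
  rw [h4]
  ring

theorem quadraticChar_mul_self_cast {a : F} (ha : a ≠ 0) :
    (quadraticChar F a : ℂ) * quadraticChar F a = 1 := by
  rw [← sq]
  exact_mod_cast congrArg (Int.cast : ℤ → ℂ) (quadraticChar_sq_one ha)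

theorem sum_addChar_mul_sq (hF : ringChar F ≠ 2) {ψ : AddChar F ℂ} (hψ : ψ ≠ 1) {a : F}
    (ha : a ≠ 0) :
    ∑ x, ψ (a * x ^ 2) = quadraticChar F a * ∑ y, (quadraticChar F y : ℂ) * ψ y := by
  rw [sum_comp_sq hF fun y => ψ (a * y), sum_addChar_mul hψ, if_neg ha, zero_add, Finset.mul_sum]
  refine Fintype.sum_equiv (Equiv.mulLeft₀ a ha) _ _ fun y => ?_
  rw [Equiv.mulLeft₀_apply]
  beta_reduce
  rw [map_mul (quadraticChar F), Int.cast_mul]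
  linear_combination (-(quadraticChar F y : ℂ) * ψ (a * y)) * quadraticChar_mul_self_cast ha

theorem quadraticGaussSum_sq (hF : ringChar F ≠ 2) {ψ : AddChar F ℂ} (hψ : ψ ≠ 1) :
    (∑ y, (quadraticChar F y : ℂ) * ψ y) ^ 2 = quadraticChar F (-1) * Nat.card F := by
  have h := gaussSum_sq (χ := (quadraticChar F).ringHomComp (Int.castRingHom ℂ)) (ψ := ψ)
    ((MulChar.ringHomComp_ne_one_iff Int.cast_injective).2 (quadraticChar_ne_one hF))
    ((quadraticChar_isQuadratic F).comp _) (AddChar.IsPrimitive.of_ne_one hψ)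
  rw [Nat.card_eq_fintype_card]
  exact h

end Squares

namespace IsTripleChar

variable {F : Type*} [Field F] {T : F → F → F → ℂ} (hT : IsTripleChar T)
include hT

/-- The inverse roots of the L-function of a character of level two. -/
theorem root_pow_of_third_eq_one [Fintype F] {p : ℕ} [CharP F p] (h2p : (2 : F) ≠ 0)
    (h3 : hT.third = 1) (hne : ∃ a b c, T a b c ≠ 1) {α : ℂ} (h0 : α ≠ 0)
    (hα : α ^ 2 + (∑ a, T a 0 0) * α + ∑ a, ∑ b, T a b 0 = 0) :
    α ^ (4 * p) = (Nat.card F : ℂ) ^ (2 * p) := by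
  classical
  obtain ⟨hd, hc⟩ := hT.sum_sum_eq_zero h3 hne
  have hαc : α = -∑ a, T a 0 0 := by
    refine mul_left_cancel₀ h0 ?_
    linear_combination hα - hd
  have h2 : hT.second ≠ 1 := by
    intro h
    rw [hc h, neg_zero] at hαc
    exact h0 hαc
  have hF : ringChar F ≠ 2 := by
    intro h
    apply h2p
    exact_mod_cast h ▸ ringChar.Nat.cast_ringChar (R := F)
  have hval : ∀ a b c, T a b c = T a 0 0 * hT.second b := by
    intro a b c
    rw [hT.eq_mul a b c, h3]
    simp
  -- `1 + a t + (a ^ 2 / 2) t ^ 2` is the truncated exponential, hence additive in a. Dividing it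
  -- out makes `T a 0 0` a character of a quadratic polynomial in a, and completing the square
  -- around `e` gives a Gauss sum.
  let φ : AddChar F ℂ :=
    { toFun := fun a => T a (a ^ 2 / 2) 0
      map_zero_eq_one' := by simpa using hT.one
      map_add_eq_mul' := fun a a' => by
        rw [hT.mul, hval, hval _ (_ + _ + _)]
        congr 2
        field_simp
        ring }
  obtain ⟨e, he⟩ := exists_eq_mul_left h2 φ
  have hT0 : ∀ a, T a 0 0 = hT.second (e ^ 2 / 2) * hT.second (-1 / 2 * (a - e) ^ 2) := by
    intro a
    have h1 : φ a = T a 0 0 * hT.second (a ^ 2 / 2) := hval _ _ _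
    rw [he] at h1
    rw [← AddChar.map_add_eq_mul, show e ^ 2 / 2 + -1 / 2 * (a - e) ^ 2 = e * a + -(a ^ 2 / 2) by
      field_simp; ring, AddChar.map_add_eq_mul, h1, mul_assoc, ← AddChar.map_add_eq_mul]
    simp
  have hsum : ∑ a, T a 0 0 = hT.second (e ^ 2 / 2) *
      (quadraticChar F (-1 / 2) * ∑ y, (quadraticChar F y : ℂ) * hT.second y) := by
    have h12 : (-1 / 2 : F) ≠ 0 := by simp [h2p]
    rw [← sum_addChar_mul_sq hF h2 h12, Finset.sum_congr rfl fun a _ => hT0 a, ← Finset.mul_sum,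
      ← Equiv.sum_comp (Equiv.subRight e) fun x => hT.second (-1 / 2 * x ^ 2)]
    rfl
  have hp : hT.second (e ^ 2 / 2) ^ p = 1 := by
    rw [← AddChar.map_nsmul_eq_pow, nsmul_eq_mul, CharP.cast_eq_zero, zero_mul,
      AddChar.map_zero_eq_one]
  have hq1 : (quadraticChar F (-1 / 2) : ℂ) ^ 2 = 1 := by
    rw [sq]
    exact quadraticChar_mul_self_cast (by simp [h2p])
  have hq2 : (quadraticChar F (-1) : ℂ) ^ 2 = 1 := by
    rw [sq]
    exact quadraticChar_mul_self_cast (by simp)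
  have hG : (∑ y, (quadraticChar F y : ℂ) * hT.second y) ^ 4 = (Nat.card F : ℂ) ^ 2 := by
    rw [show 4 = 2 * 2 from rfl, pow_mul, quadraticGaussSum_sq hF h2, mul_pow, hq2, one_mul]
  rw [hαc, hsum, (show Even (4 * p) from (by decide : Even 4).mul_right p).neg_pow, mul_pow,
    mul_comm 4 p, pow_mul, hp, one_pow, one_mul, mul_comm p 4, pow_mul, mul_pow, hG,
    show 4 = 2 * 2 from rfl, pow_mul, hq1, one_pow, one_mul, ← pow_mul]

end IsTripleChar

end ShortInterval
end

noncomputable section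
namespace ShortInterval

/-! ### The ring of integers of `ℚ(√5)` -/

/-- The ring `ℤ[φ]` with `φ ^ 2 = 1 + φ`. -/
abbrev GoldenInt : Type := QuadraticAlgebra ℤ 1 1

namespace GoldenInt

/-- The square root `2 φ - 1` of `5`. -/
def theta : GoldenInt := ⟨-1, 2⟩

theorem theta_sq : theta ^ 2 = 5 := by
  rw [sq]
  ext <;> simp [theta] <;> rfl

theorem star_theta : star theta = -theta := by
  ext <;> simp [theta]

/-- Cancellation of θ without first proving that the ring is a domain: `theta ^ 2 = 5` can be
cancelled in each coordinate. -/
theorem theta_pow_cancel (n : ℕ) {x y : GoldenInt} (h : theta ^ n * x = theta ^ n * y) :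
    x = y := by
  induction n with
  | zero => simpa using h
  | succ n ih =>
    apply ih
    have h1 : theta ^ 2 * (theta ^ n * x) = theta ^ 2 * (theta ^ n * y) := by
      linear_combination theta * h
    rw [theta_sq] at h1
    revert h1
    generalize theta ^ n * x = u, theta ^ n * y = v
    intro h1
    have hre := congrArg QuadraticAlgebra.re h1
    have him := congrArg QuadraticAlgebra.im h1
    rw [QuadraticAlgebra.re_mul, QuadraticAlgebra.re_mul] at hre
    rw [QuadraticAlgebra.im_mul, QuadraticAlgebra.im_mul] at him
    simp only [QuadraticAlgebra.re_ofNat, QuadraticAlgebra.im_ofNat] at hre him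
    ext
    · linarith
    · linarith

/-- The residue field at θ is the field with five elements, where `2 φ = 1` forces φ to be 3. -/
theorem theta_dvd_iff (V : GoldenInt) : theta ∣ V ↔ (5 : ℤ) ∣ V.re + 3 * V.im := by
  constructor
  · rintro ⟨S, rfl⟩
    refine ⟨S.re + S.im, ?_⟩
    simp only [theta, QuadraticAlgebra.re_mul, QuadraticAlgebra.im_mul]
    ring
  · rintro ⟨n, hn⟩
    refine ⟨⟨V.im - n, 2 * n - V.im⟩, ?_⟩
    ext
    · simp only [theta, QuadraticAlgebra.re_mul]
      linarith
    · simp only [theta, QuadraticAlgebra.im_mul]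
      linarith

theorem theta_dvd_of_dvd_sq {V : GoldenInt} (h : theta ∣ V ^ 2) : theta ∣ V := by
  rw [theta_dvd_iff] at h ⊢
  have h1 : (5 : ℤ) ∣ (V.re + 3 * V.im) ^ 2 := by
    obtain ⟨n, hn⟩ := h
    rw [sq, QuadraticAlgebra.re_mul, QuadraticAlgebra.im_mul] at hn
    exact ⟨n + V.im ^ 2, by linarith⟩
  exact (Int.prime_iff_natAbs_prime.2 (by norm_num)).dvd_of_dvd_pow h1

/-- Descent: while a factor θ remains on the right, it divides `W ^ 2`, hence `W`. Each division
preserves the shape of the equation and flips the sign, because `star theta = -theta`. -/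
theorem exists_eq_theta_pow_mul {W E e : GoldenInt} {r : ℕ} (he : e = 1 ∨ e = -1)
    (h : W ^ 2 = theta ^ (2 * r) * E + e * theta ^ r * star W) :
    ∃ V e' : GoldenInt, (e' = 1 ∨ e' = -1) ∧ W = theta ^ r * V ∧ V ^ 2 = E + e' * star V := by
  have key : ∀ j ≤ r, ∃ V e' : GoldenInt, (e' = 1 ∨ e' = -1) ∧ W = theta ^ j * V ∧
      V ^ 2 = theta ^ (2 * (r - j)) * E + e' * theta ^ (r - j) * star V := by
    intro j
    induction j with
    | zero => exact fun _ => ⟨W, e, he, by simp, by simpa using h⟩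
    | succ j ih =>
      intro hj
      obtain ⟨V, e', he', hW, hV⟩ := ih (by omega)
      obtain ⟨k, rfl⟩ : ∃ k, r = j + 1 + k := ⟨r - (j + 1), by omega⟩
      rw [show j + 1 + k - j = k + 1 by omega] at hV
      obtain ⟨S, rfl⟩ := theta_dvd_of_dvd_sq (V := V)
        ⟨theta ^ (2 * k + 1) * E + e' * theta ^ k * star V, by rw [hV]; ring⟩
      rw [star_mul, star_theta] at hV
      refine ⟨S, -e', ?_, by rw [hW]; ring, ?_⟩
      · rcases he' with rfl | rfl <;> simp
      · rw [Nat.add_sub_cancel_left]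
        apply theta_pow_cancel 2
        linear_combination hV
  obtain ⟨V, e', he', hW, hV⟩ := key r le_rfl
  exact ⟨V, e', he', hW, by simpa using hV⟩

/-- In coordinates the equation is a pair of integer quadratics that confine both coordinates to
[-3, 3], leaving a finite check. The irrational squares that occur are `1 + φ` and `2 - φ`, the
roots of `u ^ 2 - 3 u + 1`. -/
theorem sq_mem_of_sq_eq {V e e' : GoldenInt} {k : ℕ} (hk : k ≤ 2) (he : e = 1 ∨ e = -1)
    (he' : e' = 1 ∨ e' = -1) (h : V ^ 2 = 1 + e * theta ^ k + e' * star V) :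
    V ^ 2 = 0 ∨ V ^ 2 = 1 ∨ V ^ 2 = 4 ∨ V ^ 2 = 9 ∨ (V ^ 2) ^ 2 - 3 * V ^ 2 + 1 = 0 := by
  have key : ∀ x y m n s : ℤ, (m = 1 ∧ n = 0 ∨ m = -1 ∧ n = 0 ∨ m = 5 ∧ n = 0 ∨ m = -5 ∧ n = 0 ∨
      m = -1 ∧ n = 2 ∨ m = 1 ∧ n = -2) → (s = 1 ∨ s = -1) →
      x ^ 2 + y ^ 2 = 1 + m + s * (x + y) → 2 * (x * y) + y ^ 2 = n - s * y →
      2 * (x * y) + y ^ 2 = 0 ∧ (x ^ 2 + y ^ 2 = 0 ∨ x ^ 2 + y ^ 2 = 1 ∨ x ^ 2 + y ^ 2 = 4 ∨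
        x ^ 2 + y ^ 2 = 9) ∨ (x ^ 2 + y ^ 2 = 1 ∧ 2 * (x * y) + y ^ 2 = 1 ∨
        x ^ 2 + y ^ 2 = 2 ∧ 2 * (x * y) + y ^ 2 = -1) := by
    intro x y m n s hmn hs h1 h2
    have hm : m ≤ 5 := by omega
    have hx : -3 ≤ x ∧ x ≤ 3 := by
      rcases hs with rfl | rfl <;> constructor <;> nlinarith [sq_nonneg (y - 1), sq_nonneg (y + 1)]
    have hy : -3 ≤ y ∧ y ≤ 3 := by
      rcases hs with rfl | rfl <;> constructor <;> nlinarith [sq_nonneg (x - 1), sq_nonneg (x + 1)]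
    obtain ⟨hx1, hx2⟩ := hx
    obtain ⟨hy1, hy2⟩ := hy
    rcases hs with rfl | rfl <;> interval_cases x <;> interval_cases y <;> omega
  obtain ⟨m, n, hmn, hE⟩ : ∃ m n : ℤ, (m = 1 ∧ n = 0 ∨ m = -1 ∧ n = 0 ∨ m = 5 ∧ n = 0 ∨
      m = -5 ∧ n = 0 ∨ m = -1 ∧ n = 2 ∨ m = 1 ∧ n = -2) ∧ e * theta ^ k = ⟨m, n⟩ := by
    have h1 : theta ^ 2 = ⟨5, 0⟩ := by rw [theta_sq]; rfl
    have h2 : (1 : GoldenInt) = ⟨1, 0⟩ := rfl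
    interval_cases k <;> rcases he with rfl | rfl
    · exact ⟨1, 0, by omega, by rw [pow_zero, one_mul]; rfl⟩
    · exact ⟨-1, 0, by omega, by rw [pow_zero, mul_one]; rfl⟩
    · exact ⟨-1, 2, by omega, by rw [pow_one, one_mul]; rfl⟩
    · exact ⟨1, -2, by omega, by rw [pow_one, neg_one_mul]; rfl⟩
    · exact ⟨5, 0, by omega, by rw [h1, one_mul]⟩
    · exact ⟨-5, 0, by omega, by rw [h1, neg_one_mul]; rfl⟩
  obtain ⟨s, hs, hs'⟩ : ∃ s : ℤ, (s = 1 ∨ s = -1) ∧ e' * star V = s • star V := by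
    rcases he' with rfl | rfl
    · exact ⟨1, by omega, by simp⟩
    · exact ⟨-1, by omega, by simp⟩
  rw [hE, hs'] at h
  have hV : V ^ 2 = ⟨V.re ^ 2 + V.im ^ 2, 2 * (V.re * V.im) + V.im ^ 2⟩ := by
    rw [sq]
    ext
    · rw [QuadraticAlgebra.re_mul]; ring
    · rw [QuadraticAlgebra.im_mul]; ring
  rw [hV] at h ⊢
  have hre := congrArg QuadraticAlgebra.re h
  have him := congrArg QuadraticAlgebra.im h
  simp only [QuadraticAlgebra.re_add, QuadraticAlgebra.im_add, QuadraticAlgebra.re_smul,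
    QuadraticAlgebra.im_smul, QuadraticAlgebra.re_star, QuadraticAlgebra.im_star,
    QuadraticAlgebra.re_one, QuadraticAlgebra.im_one, smul_eq_mul] at hre him
  rcases key V.re V.im m n s hmn hs (by linarith) (by linarith) with
    ⟨h2, h1 | h1 | h1 | h1⟩ | ⟨h1, h2⟩ | ⟨h1, h2⟩ <;> rw [h1, h2]
  · exact Or.inl rfl
  · exact Or.inr (Or.inl rfl)
  · exact Or.inr (Or.inr (Or.inl rfl))
  · exact Or.inr (Or.inr (Or.inr (Or.inl rfl)))
  · exact Or.inr (Or.inr (Or.inr (Or.inr rfl)))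
  · exact Or.inr (Or.inr (Or.inr (Or.inr rfl)))

/-- The embedding in `ℂ` that sends `φ` to a given root of `x ^ 2 = 1 + x`. -/
def toComplex {φ : ℂ} (hφ : φ ^ 2 = 1 + φ) : GoldenInt →+* ℂ where
  toFun z := z.re + z.im * φ
  map_zero' := by simp
  map_one' := by simp [QuadraticAlgebra.re_one, QuadraticAlgebra.im_one]
  map_add' x y := by
    simp only [QuadraticAlgebra.re_add, QuadraticAlgebra.im_add, Int.cast_add]
    ring
  map_mul' x y := by
    simp only [QuadraticAlgebra.re_mul, QuadraticAlgebra.im_mul, Int.cast_add, Int.cast_mul,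
      Int.cast_one]
    linear_combination (-(x.im : ℂ) * y.im) * hφ

theorem toComplex_apply {φ : ℂ} (hφ : φ ^ 2 = 1 + φ) (z : GoldenInt) :
    toComplex hφ z = z.re + z.im * φ := rfl

/-- The norm form has no nontrivial zero, since 5 is not a square. -/
theorem toComplex_injective {φ : ℂ} (hφ : φ ^ 2 = 1 + φ) : Function.Injective (toComplex hφ) := by
  rw [injective_iff_map_eq_zero]
  intro z hz
  rw [toComplex_apply] at hz
  have h1 : ((z.re ^ 2 + z.re * z.im - z.im ^ 2 : ℤ) : ℂ) = 0 := by
    push_cast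
    linear_combination (z.re + z.im * (1 - φ)) * hz + (z.im : ℂ) ^ 2 * hφ
  have h2 : (2 * z.re + z.im) ^ 2 = 5 * z.im ^ 2 := by
    have : z.re ^ 2 + z.re * z.im - z.im ^ 2 = 0 := by exact_mod_cast h1
    linear_combination 4 * this
  have him : z.im = 0 := by
    by_contra h0
    obtain ⟨c, hc⟩ := (Int.pow_dvd_pow_iff two_ne_zero).1 (Dvd.intro_left _ h2.symm)
    rw [hc, mul_pow, mul_comm] at h2
    have h3 : c ^ 2 = 5 := mul_right_cancel₀ (pow_ne_zero 2 h0) h2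
    have h4 : c ≤ 2 := by nlinarith
    have h5 : -2 ≤ c := by nlinarith
    interval_cases c <;> omega
  rw [him] at h2
  ext
  · simpa using h2
  · exact him

end GoldenInt

end ShortInterval
end

noncomputable section
namespace ShortInterval

/-! ### Exponential sums of odd cubic polynomials in characteristic five -/

theorem golden_relation {ζ : ℂ} (hζ : IsPrimitiveRoot ζ 5) :
    1 + ζ + ζ ^ 2 + ζ ^ 3 + ζ ^ 4 = 0 ∧ (1 + ζ + ζ ^ 4) ^ 2 = 1 + (1 + ζ + ζ ^ 4) := by
  have h5 := hζ.pow_eq_one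
  have h0 : 1 + ζ + ζ ^ 2 + ζ ^ 3 + ζ ^ 4 = 0 := by
    simpa [Finset.sum_range_succ] using hζ.geom_sum_eq_zero (by norm_num)
  refine ⟨h0, ?_⟩
  linear_combination h0 + (2 + ζ ^ 3) * h5

/-- Since `g x * g (-x) = 1`, the values `ζ ^ i` and `ζ ^ (5 - i)` occur equally often, so the sum
lies in `ℤ[φ]` with `φ = 1 + ζ + ζ ^ 4`. Squaring the values is the Galois automorphism of `ℚ(√5)`,
that is, `star`. -/
theorem exists_goldenInt_sum {F : Type*} [Field F] [Fintype F] {ζ : ℂ} (hζ : IsPrimitiveRoot ζ 5)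
    {g : F → ℂ} (h5 : ∀ x, g x ^ 5 = 1) (hneg : ∀ x, g x * g (-x) = 1) :
    ∃ W : GoldenInt, ∑ x, g x = GoldenInt.toComplex (golden_relation hζ).2 W ∧
      ∑ x, g x ^ 2 = GoldenInt.toComplex (golden_relation hζ).2 (star W) := by
  have hex : ∀ x, ∃ i < 5, ζ ^ i = g x := fun x => hζ.eq_pow_of_pow_eq_one (h5 x)
  choose j hj hg using hex
  let N : ℕ → ℕ := fun i => (Finset.univ.filter fun x => j x = i).card
  have hsum : ∀ f : ℂ → ℂ, ∑ x, f (g x) = ∑ i ∈ Finset.range 5, N i * f (ζ ^ i) := by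
    intro f
    rw [← Finset.sum_fiberwise_of_maps_to (g := j) (t := Finset.range 5)
      (fun x _ => Finset.mem_range.2 (hj x))]
    refine Finset.sum_congr rfl fun i _ => ?_
    rw [← nsmul_eq_mul, ← Finset.sum_const]
    refine Finset.sum_congr rfl fun x hx => ?_
    rw [← hg, (Finset.mem_filter.1 hx).2]
  have hdvd : ∀ x, 5 ∣ j x + j (-x) := by
    intro x
    rw [← hζ.pow_eq_one_iff_dvd, pow_add, hg, hg, hneg]
  have hN : ∀ i i', 0 < i → 0 < i' → i + i' = 5 → N i = N i' := by
    intro i i' hi hi' hii'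
    refine Finset.card_equiv (Equiv.neg F) fun x => ?_
    simp only [Finset.mem_filter, Finset.mem_univ, true_and, Equiv.neg_apply]
    have h1 := hdvd x
    have h2 := hj x
    have h3 := hj (-x)
    omega
  have h14 := hN 1 4 (by norm_num) (by norm_num) rfl
  have h23 := hN 2 3 (by norm_num) (by norm_num) rfl
  obtain ⟨h0, -⟩ := golden_relation hζ
  have h5' := hζ.pow_eq_one
  refine ⟨⟨(N 0 : ℤ) - N 1, (N 1 : ℤ) - N 2⟩, ?_, ?_⟩
  · have h1 := hsum fun z => z
    rw [h1, GoldenInt.toComplex_apply]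
    simp only [Finset.sum_range_succ, Finset.sum_range_zero, ← h14, ← h23]
    push_cast
    linear_combination (N 2 : ℂ) * h0
  · have h1 := hsum fun z => z ^ 2
    rw [h1, GoldenInt.toComplex_apply]
    simp only [Finset.sum_range_succ, Finset.sum_range_zero, ← h14, ← h23, QuadraticAlgebra.re_star,
      QuadraticAlgebra.im_star]
    push_cast
    linear_combination (N 1 : ℂ) * h0 + ((N 2 : ℂ) * ζ + N 1 * ζ ^ 3) * h5'

section CubicSums

variable {F : Type*} [Field F] [Fintype F]

/-- The change of variables `(u, v) ↦ (u + v, u - v)`. -/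
def sumDiffEquiv (h2 : (2 : F) ≠ 0) : F × F ≃ F × F where
  toFun z := (z.1 + z.2, z.1 - z.2)
  invFun z := ((z.1 + z.2) / 2, (z.1 - z.2) / 2)
  left_inv z := by ext <;> simp <;> field_simp <;> ring
  right_inv z := by ext <;> simp <;> field_simp <;> ring

variable [CharP F 5]

omit [Fintype F] in
theorem five_eq_zero : (5 : F) = 0 := by exact_mod_cast CharP.cast_eq_zero F 5

omit [Fintype F] in
theorem two_ne_zero_of_charP_five : (2 : F) ≠ 0 := by
  intro h
  have h5 := five_eq_zero (F := F)
  exact one_ne_zero (show (1 : F) = 0 by linear_combination h5 - 2 * h)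

omit [Fintype F] in
theorem addChar_pow_five (ψ : AddChar F ℂ) (y : F) : ψ y ^ 5 = 1 := by
  rw [← AddChar.map_nsmul_eq_pow, nsmul_eq_mul, CharP.cast_eq_zero, zero_mul,
    AddChar.map_zero_eq_one]

variable [DecidableEq F]

/-- The inner sum is q at `u = 0` and a twisted Gauss sum elsewhere. The factor `c` distinguishes
the square of the cubic sum over `F` from the sum over the quadratic extension. -/
theorem sum_mul_sum_addChar_mul_sq {ψ : AddChar F ℂ} (hψ : ψ ≠ 1) (a b : F) {c : F}
    (hc : c ≠ 0) :
    ∑ u, ψ (2 * (a * u ^ 3 + b * u)) * ∑ v, ψ (c * u * v ^ 2) = Nat.card F +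
      quadraticChar F c * (∑ y, (quadraticChar F y : ℂ) * ψ y) *
        ∑ u, (quadraticChar F u : ℂ) * ψ (2 * (a * u ^ 3 + b * u)) := by
  have hF : ringChar F ≠ 2 := by
    rw [ringChar.eq F 5]
    norm_num
  have h3 : ∀ u, ∑ v, ψ (c * u * v ^ 2) = (if u = 0 then (Nat.card F : ℂ) else 0) +
      quadraticChar F c * (∑ y, (quadraticChar F y : ℂ) * ψ y) * quadraticChar F u := by
    intro u
    split_ifs with hu
    · rw [hu, Nat.card_eq_fintype_card]
      simp
    · rw [sum_addChar_mul_sq hF hψ (mul_ne_zero hc hu), map_mul]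
      push_cast
      ring
  have h4 : ∀ u, ψ (2 * (a * u ^ 3 + b * u)) * ∑ v, ψ (c * u * v ^ 2) =
      (if u = 0 then (Nat.card F : ℂ) else 0) +
      quadraticChar F c * (∑ y, (quadraticChar F y : ℂ) * ψ y) *
        (quadraticChar F u * ψ (2 * (a * u ^ 3 + b * u))) := by
    intro u
    rw [h3, mul_add]
    congr 1
    · split_ifs with hu
      · simp [hu]
      · rw [mul_zero]
    · ring
  rw [Finset.sum_congr rfl fun u _ => h4 u, Finset.sum_add_distrib, ← Finset.mul_sum]
  simp

/-- With `x = u + v` and `y = u - v`, the exponents add to `2 (a u ^ 3 + b u) + 6 a u v ^ 2`, and 6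
= 1. -/
theorem cubicSum_sq {ψ : AddChar F ℂ} (hψ : ψ ≠ 1) {a b : F} (ha : a ≠ 0) :
    (∑ x, ψ (a * x ^ 3 + b * x)) ^ 2 = Nat.card F +
      quadraticChar F a * (∑ y, (quadraticChar F y : ℂ) * ψ y) *
        ∑ u, (quadraticChar F u : ℂ) * ψ (2 * (a * u ^ 3 + b * u)) := by
  have h5 := five_eq_zero (F := F)
  have h2 := two_ne_zero_of_charP_five (F := F)
  rw [← sum_mul_sum_addChar_mul_sq hψ a b ha, sq, Finset.sum_mul_sum, ← Fintype.sum_prod_type',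
    ← Equiv.sum_comp (sumDiffEquiv h2), Fintype.sum_prod_type]
  refine Finset.sum_congr rfl fun u _ => ?_
  rw [Finset.mul_sum]
  refine Finset.sum_congr rfl fun v _ => ?_
  rw [← AddChar.map_add_eq_mul, ← AddChar.map_add_eq_mul]
  congr 1
  simp only [sumDiffEquiv, Equiv.coe_fn_mk]
  linear_combination (a * u * v ^ 2) * h5

theorem quadraticGaussSum_sq_of_charP_five {ψ : AddChar F ℂ} (hψ : ψ ≠ 1) :
    (∑ y, (quadraticChar F y : ℂ) * ψ y) ^ 2 = Nat.card F := by
  have hF : ringChar F ≠ 2 := by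
    rw [ringChar.eq F 5]
    norm_num
  have h1 : quadraticChar F (-1) = 1 := by
    rw [show (-1 : F) = 2 ^ 2 by linear_combination -five_eq_zero (F := F)]
    exact quadraticChar_sq_one' two_ne_zero_of_charP_five
  rw [quadraticGaussSum_sq hF hψ, h1, Int.cast_one, one_mul]

/-- As `x ^ 6 = x * x ^ 5`, the Frobenius invariance of ψ makes the exponent behave like a quadratic
form: differencing by `h` leaves the linear factor `ψ (L h * y)`. The square of the sum is q times
the order of the kernel of `L`, a subgroup lying in the roots of a polynomial of degree 25. -/
theorem sexticSum_sq {ψ : AddChar F ℂ} (hψ : ψ ≠ 1) (hfrob : ∀ y, ψ (y ^ 5) = ψ y)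
    {r : ℕ} (hF : Nat.card F = 5 ^ r) {a b : F} (ha : a ≠ 0) :
    ∃ k ≤ 2, (∑ x, ψ (a * x ^ 6 + b * x ^ 2)) ^ 2 = 5 ^ (r + k) := by
  have : Fact (Nat.Prime 5) := ⟨by norm_num⟩
  have h5 := five_eq_zero (F := F)
  let e : F →+ F := (frobeniusEquiv F 5).symm.toAddMonoidHom.comp (AddMonoidHom.mulLeft a)
  have he : ∀ h, e h ^ 5 = a * h := fun h => frobenius_apply_frobeniusEquiv_symm F 5 (a * h)
  let L : F →+ F := (AddMonoidHom.mulLeft a).comp (frobenius F 5).toAddMonoidHom + e +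
    AddMonoidHom.mulLeft (2 * b)
  have hL : ∀ h, L h = a * h ^ 5 + e h + 2 * b * h := fun h => rfl
  have hdiff : ∀ y h, ψ (a * (y + h) ^ 6 + b * (y + h) ^ 2) * ψ (-(a * y ^ 6 + b * y ^ 2)) =
      ψ (a * h ^ 6 + b * h ^ 2) * ψ (L h * y) := by
    intro y h
    have h1 : ψ (a * h * y ^ 5) = ψ (e h * y) := by rw [← he, ← mul_pow, hfrob]
    rw [hL, show (a * h ^ 5 + e h + 2 * b * h) * y = a * h ^ 5 * y + 2 * b * h * y + e h * y by ring,
      AddChar.map_add_eq_mul _ _ (e h * y), ← h1, ← AddChar.map_add_eq_mul,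
      ← AddChar.map_add_eq_mul, ← AddChar.map_add_eq_mul]
    congr 1
    linear_combination (a * (y ^ 5 * h + 3 * y ^ 4 * h ^ 2 + 4 * y ^ 3 * h ^ 3 +
      3 * y ^ 2 * h ^ 4 + y * h ^ 5)) * h5
  -- Both `2 ^ 2` and `2 ^ 6` are -1 in characteristic 5, so scaling by 2 negates the exponent;
  -- hence the sum is real and its square can be computed by differencing.
  have hneg : ∀ y, a * (2 * y) ^ 6 + b * (2 * y) ^ 2 = -(a * y ^ 6 + b * y ^ 2) := by
    intro y
    linear_combination (13 * a * y ^ 6 + b * y ^ 2) * h5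
  -- With `y = h` the difference formula gives `ψ (3 z) = 1`, and `ψ z ^ 5 = 1` then forces `ψ z =
  -- 1`.
  have hker : ∀ h, L h = 0 → ψ (a * h ^ 6 + b * h ^ 2) = 1 := by
    intro h hh
    have h1 := hdiff h h
    rw [hh, zero_mul, AddChar.map_zero_eq_one, mul_one, ← two_mul, hneg,
      ← AddChar.map_add_eq_mul] at h1
    generalize a * h ^ 6 + b * h ^ 2 = z at h1
    have h2 : ψ (z + z + z) = 1 := by
      rw [show z + z + z = -(-z + -z) + z by ring, AddChar.map_add_eq_mul, ← h1,
        ← AddChar.map_add_eq_mul, neg_add_cancel, AddChar.map_zero_eq_one]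
    have h3 := addChar_pow_five ψ z
    rw [AddChar.map_add_eq_mul, AddChar.map_add_eq_mul] at h2
    linear_combination (1 + ψ z ^ 3) * h2 - ψ z * h3
  have hsq : (∑ x, ψ (a * x ^ 6 + b * x ^ 2)) ^ 2 =
      ∑ h, ψ (a * h ^ 6 + b * h ^ 2) * ∑ y, ψ (L h * y) := by
    have h1 : ∑ y, ψ (a * y ^ 6 + b * y ^ 2) = ∑ y, ψ (-(a * y ^ 6 + b * y ^ 2)) := by
      rw [← Equiv.sum_comp (Equiv.mulLeft₀ (2 : F) two_ne_zero_of_charP_five)]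
      exact Finset.sum_congr rfl fun y _ => congrArg ψ (hneg y)
    rw [sq]
    nth_rewrite 2 [h1]
    rw [Finset.sum_mul_sum, Finset.sum_comm]
    simp only [Finset.mul_sum]
    rw [Finset.sum_comm (f := fun h y => ψ (a * h ^ 6 + b * h ^ 2) * ψ (L h * y))]
    refine Finset.sum_congr rfl fun y _ => ?_
    rw [← Equiv.sum_comp (Equiv.addLeft y)]
    exact Finset.sum_congr rfl fun h _ => hdiff y h
  have hcard : (∑ x, ψ (a * x ^ 6 + b * x ^ 2)) ^ 2 = Nat.card F * Nat.card L.ker := by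
    rw [hsq]
    have h1 : ∀ h, ψ (a * h ^ 6 + b * h ^ 2) * ∑ y, ψ (L h * y) =
        if L h = 0 then (Nat.card F : ℂ) else 0 := by
      intro h
      rw [sum_addChar_mul hψ]
      split_ifs with hh
      · rw [hker h hh, one_mul]
      · rw [mul_zero]
    rw [Finset.sum_congr rfl fun h _ => h1 h, ← Finset.sum_filter, Finset.sum_const, nsmul_eq_mul,
      mul_comm]
    congr 2
    rw [Nat.card_eq_fintype_card, Fintype.card_subtype]
    simp only [AddMonoidHom.mem_ker]
  have hle : Nat.card L.ker ≤ 25 := by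
    have hsub : (L.ker : Set F) ⊆
        (C (a ^ 5) * X ^ 25 + C ((2 * b) ^ 5) * X ^ 5 + C a * X : F[X]).roots.toFinset := by
      intro h hh
      have hh' : a * h ^ 5 + e h + 2 * b * h = 0 := hh
      rw [Finset.mem_coe, Multiset.mem_toFinset, mem_roots']
      constructor
      · intro h0
        have := congrArg (coeff · 25) h0
        simp only [coeff_add, coeff_C_mul, coeff_X_pow, coeff_X] at this
        norm_num at this
        exact ha this
      · have h1 := congrArg (frobenius F 5) hh'
        simp only [map_add, map_zero, frobenius_def, he] at h1
        simp only [IsRoot, eval_add, eval_mul, eval_C, eval_pow, eval_X]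
        linear_combination h1
    rw [← SetLike.coe_sort_coe, Nat.card_coe_set_eq]
    refine (Set.ncard_le_ncard hsub).trans ?_
    rw [Set.ncard_coe_finset]
    refine (Multiset.toFinset_card_le _).trans ((card_roots' _).trans ?_)
    compute_degree
  obtain ⟨k, -, hk⟩ := (Nat.dvd_prime_pow (by norm_num : Nat.Prime 5)).1
    (hF ▸ AddSubgroup.card_addSubgroup_dvd_card L.ker)
  refine ⟨k, ?_, ?_⟩
  · rw [hk] at hle
    exact (Nat.pow_le_pow_iff_right (by norm_num : 1 < 5)).1 (hle.trans (by norm_num))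
  · rw [hcard, hF, hk]
    push_cast
    ring

theorem cubicSum_sq_mem {ψ : AddChar F ℂ} (hψ : ψ ≠ 1) (hfrob : ∀ y, ψ (y ^ 5) = ψ y)
    {r : ℕ} (hF : Nat.card F = 5 ^ r) {a b : F} (ha : a ≠ 0) :
    ∃ u : ℂ, (∑ x, ψ (a * x ^ 3 + b * x)) ^ 2 = Nat.card F * u ∧
      (u = 0 ∨ u = 1 ∨ u = 4 ∨ u = 9 ∨ u ^ 2 - 3 * u + 1 = 0) := by
  have h2 := two_ne_zero_of_charP_five (F := F)
  have hζ := Complex.isPrimitiveRoot_exp 5 (by norm_num)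
  have hF2 : ringChar F ≠ 2 := by
    rw [ringChar.eq F 5]
    norm_num
  obtain ⟨W, hW, hW'⟩ := exists_goldenInt_sum hζ (g := fun x => ψ (a * x ^ 3 + b * x))
    (fun x => addChar_pow_five ψ _) (fun x => by
      rw [← AddChar.map_add_eq_mul, ← ψ.map_zero_eq_one]
      congr 1
      ring)
  have hW'' : ∑ x, ψ (2 * (a * x ^ 3 + b * x)) =
      GoldenInt.toComplex (golden_relation hζ).2 (star W) := by
    rw [← hW']
    refine Finset.sum_congr rfl fun x _ => ?_
    rw [two_mul, AddChar.map_add_eq_mul, sq]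
  have hinj := GoldenInt.toComplex_injective (golden_relation hζ).2
  revert hW hW'' hinj
  generalize GoldenInt.toComplex (golden_relation hζ).2 = ι
  intro hW hW'' hinj
  have hιθ : ι GoldenInt.theta ^ 2 = 5 := by
    rw [← map_pow, GoldenInt.theta_sq]
    exact map_ofNat ι 5
  have hιpow : ∀ n, ι (GoldenInt.theta ^ n) ^ 2 = 5 ^ n := by
    intro n
    rw [map_pow, ← pow_mul, mul_comm, pow_mul, hιθ]
  obtain ⟨k, hk, hQ⟩ := sexticSum_sq hψ hfrob hF (a := 2 * a) (b := 2 * b) (mul_ne_zero h2 ha)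
  have hS := sum_comp_sq hF2 fun u => ψ (2 * (a * u ^ 3 + b * u))
  have hQ' : ∑ x, ψ (2 * (a * (x ^ 2) ^ 3 + b * x ^ 2)) =
      ∑ x, ψ (2 * a * x ^ 6 + 2 * b * x ^ 2) :=
    Finset.sum_congr rfl fun x _ => by congr 1; ring
  rw [hQ', hW''] at hS
  have hw := cubicSum_sq hψ (b := b) ha
  have hG := quadraticGaussSum_sq_of_charP_five hψ
  rw [hF, Nat.cast_pow, Nat.cast_ofNat] at hG
  rw [← hιpow] at hG hQ
  obtain ⟨e₁, he₁, hG'⟩ : ∃ e : GoldenInt, (e = 1 ∨ e = -1) ∧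
      ∑ y, (quadraticChar F y : ℂ) * ψ y = ι (e * GoldenInt.theta ^ r) := by
    rcases sq_eq_sq_iff_eq_or_eq_neg.1 hG with h | h
    · exact ⟨1, Or.inl rfl, by rw [h, one_mul]⟩
    · exact ⟨-1, Or.inr rfl, by rw [h, neg_one_mul, map_neg]⟩
  obtain ⟨e₂, he₂, hQ''⟩ : ∃ e : GoldenInt, (e = 1 ∨ e = -1) ∧
      ∑ x, ψ (2 * a * x ^ 6 + 2 * b * x ^ 2) = ι (e * GoldenInt.theta ^ (r + k)) := by
    rcases sq_eq_sq_iff_eq_or_eq_neg.1 hQ with h | h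
    · exact ⟨1, Or.inl rfl, by rw [h, one_mul]⟩
    · exact ⟨-1, Or.inr rfl, by rw [h, neg_one_mul, map_neg]⟩
  obtain ⟨e₃, he₃, hη⟩ : ∃ e : GoldenInt, (e = 1 ∨ e = -1) ∧
      (quadraticChar F a : ℂ) = ι e := by
    rcases quadraticChar_dichotomy ha with h | h
    · exact ⟨1, Or.inl rfl, by rw [h]; simp⟩
    · exact ⟨-1, Or.inr rfl, by rw [h]; simp⟩
  have hmul : ∀ {e e' : GoldenInt}, (e = 1 ∨ e = -1) → (e' = 1 ∨ e' = -1) →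
      (e * e' = 1 ∨ e * e' = -1) := by
    rintro e e' (rfl | rfl) (rfl | rfl) <;> simp
  -- In `cubicSum_sq` the twisted cubic sum is the sextic sum minus the conjugate cubic sum.
  -- Moreover q, the Gauss sum and the sextic sum are, up to sign, `theta ^ (2 * r)`, `theta ^ r`
  -- and `theta ^ (r + k)`.
  have hWeq : W ^ 2 = GoldenInt.theta ^ (2 * r) * (1 + e₃ * e₁ * e₂ * GoldenInt.theta ^ k) +
      -1 * (e₃ * e₁) * GoldenInt.theta ^ r * star W := by
    apply hinj
    rw [hQ''] at hS
    rw [hη, hG', hF, Nat.cast_pow, Nat.cast_ofNat, ← hιpow] at hw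
    simp only [map_pow, map_add, map_mul, map_one, map_neg] at hw hS ⊢
    rw [← hW]
    linear_combination hw - ι e₃ * (ι e₁ * ι GoldenInt.theta ^ r) * hS
  obtain ⟨V, e', he', hWV, hV⟩ := GoldenInt.exists_eq_theta_pow_mul
    (hmul (Or.inr rfl) (hmul he₃ he₁)) hWeq
  have hmem := GoldenInt.sq_mem_of_sq_eq hk (hmul (hmul he₃ he₁) he₂) he' hV
  refine ⟨ι (V ^ 2), ?_, ?_⟩
  · rw [hW, hWV, map_mul, mul_pow, hιpow, map_pow, hF]
    push_cast
    rfl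
  · rcases hmem with h | h | h | h | h
    · exact Or.inl (by rw [h, map_zero])
    · exact Or.inr (Or.inl (by rw [h, map_one]))
    · exact Or.inr (Or.inr (Or.inl (by rw [h]; exact map_ofNat ι 4)))
    · exact Or.inr (Or.inr (Or.inr (Or.inl (by rw [h]; exact map_ofNat ι 9))))
    · refine Or.inr (Or.inr (Or.inr (Or.inr ?_)))
      have := congrArg ι h
      rwa [map_add, map_sub, map_mul, map_pow, map_one, map_zero,
        show ι 3 = 3 from map_ofNat ι 3] at this

end CubicSums

end ShortInterval
end

noncomputable section
namespace ShortInterval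

/-! ### Characters of level three in characteristic five -/

/-! ### Comparison with the quadratic extension -/

section QuadraticExtension

variable {F : Type*} [Field F] [CharP F 5]

theorem re_pow_five {d : F} (z : QuadraticAlgebra F d 0) : (z ^ 5).re = z.re ^ 5 := by
  simp only [pow_succ, pow_zero, one_mul, QuadraticAlgebra.re_mul, QuadraticAlgebra.im_mul]
  linear_combination (2 * z.re ^ 3 * z.im ^ 2 * d + z.re * z.im ^ 4 * d ^ 2) *
    five_eq_zero (F := F)

omit [CharP F 5] in
theorem re_cubic {d : F} (a b : F) (z : QuadraticAlgebra F d 0) :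
    (algebraMap F (QuadraticAlgebra F d 0) a * z ^ 3 +
      algebraMap F (QuadraticAlgebra F d 0) b * z).re =
      a * z.re ^ 3 + b * z.re + 3 * (a * d * z.re * z.im ^ 2) := by
  simp only [pow_succ, pow_zero, one_mul, QuadraticAlgebra.re_add, QuadraticAlgebra.re_mul,
    QuadraticAlgebra.im_mul, QuadraticAlgebra.algebraMap_re, QuadraticAlgebra.algebraMap_im]
  ring

variable [Fintype F]

/-- Over `F(√d)`, with ψ composed with the trace, the cubic sum is `q - (w ^ 2 - q)`, where w is the
sum over `F`: the Gauss sum term changes sign because d is a nonsquare. The classification of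
squares applies to this sum too. -/
theorem exists_cubicSum_quadraticExtension {ψ : AddChar F ℂ} (hψ : ψ ≠ 1)
    (hfrob : ∀ y, ψ (y ^ 5) = ψ y) {r : ℕ} (hF : Nat.card F = 5 ^ r) {a b : F} (ha : a ≠ 0) :
    ∃ u : ℂ, (2 * Nat.card F - (∑ x, ψ (a * x ^ 3 + b * x)) ^ 2) ^ 2 = (Nat.card F : ℂ) ^ 2 * u ∧
      (u = 0 ∨ u = 1 ∨ u = 4 ∨ u = 9 ∨ u ^ 2 - 3 * u + 1 = 0) := by
  classical
  have h5 := five_eq_zero (F := F)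
  have h2 := two_ne_zero_of_charP_five (F := F)
  have hF2 : ringChar F ≠ 2 := by
    rw [ringChar.eq F 5]
    norm_num
  obtain ⟨d, hd⟩ := FiniteField.exists_nonsquare hF2
  have hd0 : d ≠ 0 := by
    rintro rfl
    exact hd (IsSquare.zero)
  have hfact : Fact (∀ x : F, x ^ 2 ≠ d + 0 * x) := ⟨fun x hx => hd ⟨x, by
    rw [← sq, hx, zero_mul, add_zero]⟩⟩
  let K := QuadraticAlgebra F d 0
  let _ : Fintype K := Fintype.ofEquiv _ (QuadraticAlgebra.equivProd d (0 : F)).symm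
  have : CharP K 5 := charP_of_injective_algebraMap (algebraMap F K).injective 5
  have hcard : Nat.card K = Nat.card F ^ 2 := by
    rw [Nat.card_congr (QuadraticAlgebra.equivProd d (0 : F)), Nat.card_prod, sq]
  let Ψ : AddChar K ℂ := ψ.compAddMonoidHom
    ((AddMonoidHom.mulLeft 2).comp (QuadraticAlgebra.reₗ d (0 : F)).toAddMonoidHom)
  have hΨ : ∀ z : K, Ψ z = ψ (2 * z.re) := fun z => rfl
  have hΨ1 : Ψ ≠ 1 := by
    intro h
    apply hψ
    ext y
    have h1 := DFunLike.congr_fun h (⟨y / 2, 0⟩ : K)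
    rwa [hΨ, AddChar.one_apply, mul_div_cancel₀ _ h2] at h1
  have hΨfrob : ∀ z : K, Ψ (z ^ 5) = Ψ z := by
    intro z
    rw [hΨ, hΨ, re_pow_five, ← hfrob (2 * z.re)]
    congr 1
    linear_combination (-6 * z.re ^ 5) * h5
  obtain ⟨u, hu, hmem⟩ := cubicSum_sq_mem hΨ1 hΨfrob (r := r * 2)
    (by rw [hcard, hF, ← pow_mul]) (a := algebraMap F K a) (b := algebraMap F K b)
    (by simpa using ha)
  refine ⟨u, ?_, hmem⟩
  rw [hcard, Nat.cast_pow] at hu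
  rw [← hu]
  congr 1
  have h1 : ∑ z, Ψ (algebraMap F K a * z ^ 3 + algebraMap F K b * z) =
      ∑ x, ψ (2 * (a * x ^ 3 + b * x)) * ∑ y, ψ (a * d * x * y ^ 2) := by
    rw [← Equiv.sum_comp (QuadraticAlgebra.equivProd d (0 : F)).symm, Fintype.sum_prod_type]
    refine Finset.sum_congr rfl fun x _ => ?_
    rw [Finset.mul_sum]
    refine Finset.sum_congr rfl fun y _ => ?_
    rw [hΨ, re_cubic, ← AddChar.map_add_eq_mul]
    congr 1
    simp only [QuadraticAlgebra.equivProd, Equiv.coe_fn_symm_mk]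
    linear_combination (a * d * x * y ^ 2) * h5
  rw [h1, sum_mul_sum_addChar_mul_sq hψ a b (mul_ne_zero ha hd0), cubicSum_sq hψ ha, map_mul,
    quadraticChar_neg_one_iff_not_isSquare.2 hd]
  push_cast
  ring

/-- The value 9 would violate the Weil bound. Here it is excluded by the quadratic extension, where
it would produce `(2 - 9) ^ 2 = 49`, which is not an allowed value. -/
theorem cubicSum_sq_mem_of_ne_nine {ψ : AddChar F ℂ} (hψ : ψ ≠ 1)
    (hfrob : ∀ y, ψ (y ^ 5) = ψ y) {r : ℕ} (hF : Nat.card F = 5 ^ r) {a b : F} (ha : a ≠ 0) :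
    ∃ u : ℂ, (∑ x, ψ (a * x ^ 3 + b * x)) ^ 2 = Nat.card F * u ∧
      (u = 0 ∨ u = 1 ∨ u = 4 ∨ u ^ 2 - 3 * u + 1 = 0) := by
  classical
  obtain ⟨u, hu, h | h | h | h | h⟩ := cubicSum_sq_mem hψ hfrob hF (b := b) ha
  · exact ⟨u, hu, Or.inl h⟩
  · exact ⟨u, hu, Or.inr (Or.inl h)⟩
  · exact ⟨u, hu, Or.inr (Or.inr (Or.inl h))⟩
  · exfalso
    obtain ⟨v, hv, hmem⟩ := exists_cubicSum_quadraticExtension hψ hfrob hF (b := b) ha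
    have hq : (Nat.card F : ℂ) ^ 2 ≠ 0 := by
      rw [hF]
      simp
    rw [hu, h] at hv
    have h49 : v = 49 := by
      refine mul_left_cancel₀ hq ?_
      rw [← hv]
      ring
    rw [h49] at hmem
    norm_num at hmem
  · exact ⟨u, hu, Or.inr (Or.inr (Or.inr h))⟩

end QuadraticExtension

/-- In the four cases `δ / E` is -1, a cube root of unity, 1, or a fifth root of unity. -/
theorem pow_thirty_eq_of_quadratic {δ E u : ℂ} (h : δ ^ 2 + (2 - u) * E * δ + E ^ 2 = 0)
    (hu : u = 0 ∨ u = 1 ∨ u = 4 ∨ u ^ 2 - 3 * u + 1 = 0) : δ ^ 30 = E ^ 30 := by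
  rcases hu with rfl | rfl | rfl | hu
  · have h1 : (δ + E) ^ 2 = 0 := by linear_combination h
    rw [eq_neg_of_add_eq_zero_left (pow_eq_zero_iff two_ne_zero |>.1 h1),
      Even.neg_pow (by decide)]
  · have h1 : δ ^ 3 = E ^ 3 := by linear_combination (δ - E) * h
    rw [show 30 = 3 * 10 from rfl, pow_mul, h1, ← pow_mul]
  · have h1 : (δ - E) ^ 2 = 0 := by linear_combination h
    rw [sub_eq_zero.1 (pow_eq_zero_iff two_ne_zero |>.1 h1)]
  · have h1 : δ ^ 5 = E ^ 5 := by
      linear_combination (δ - E) * (δ ^ 2 + (u - 1) * E * δ + E ^ 2) * h +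
        (δ - E) * E ^ 2 * δ ^ 2 * hu
    rw [show 30 = 5 * 6 from rfl, pow_mul, h1, ← pow_mul]

namespace IsTripleChar

variable {F : Type*} [Field F] {T : F → F → F → ℂ} (hT : IsTripleChar T) [CharP F 5]
include hT

/-- In characteristic 5 the truncated exponential is `1 + y t + 3 y ^ 2 t ^ 2 + y ^ 3 t ^ 3`.
Dividing it out makes `T a 0 0` a character of a cubic polynomial, and the shift `s` removes its
quadratic term. -/
theorem exists_eq_addChar_cubic [Finite F] {ψ : AddChar F ℂ} (hψ : ψ ≠ 1) (h3 : hT.third ≠ 1) :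
    ∃ A b s d : F, A ≠ 0 ∧ ∀ a, T a 0 0 = ψ d * ψ (A * (a + s) ^ 3 + b * (a + s)) := by
  have h5 := five_eq_zero (F := F)
  let φ : AddChar F ℂ :=
    { toFun := fun y => T y (3 * y ^ 2) (y ^ 3)
      map_zero_eq_one' := by simpa using hT.one
      map_add_eq_mul' := fun y z => by
        rw [hT.mul]
        congr 1
        · linear_combination (y * z) * h5
        · ring }
  obtain ⟨n, hn⟩ := exists_eq_mul_left hψ φ
  obtain ⟨m, hm⟩ := exists_eq_mul_left hψ hT.second
  obtain ⟨l, hl⟩ := exists_eq_mul_left hψ hT.third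
  have hl0 : l ≠ 0 := by
    rintro rfl
    apply h3
    ext y
    simp [hl]
  have hA : 2 * l ≠ 0 := mul_ne_zero two_ne_zero_of_charP_five hl0
  have hval : ∀ a, T a 0 0 = ψ (n * a - 3 * m * a ^ 2 + 2 * l * a ^ 3) := by
    intro a
    have h1 : T a 0 0 = φ a * (hT.second (-3 * a ^ 2) * hT.third (2 * a ^ 3)) := by
      change T a 0 0 = T a (3 * a ^ 2) (a ^ 3) * (T 0 (-3 * a ^ 2) 0 * T 0 0 (2 * a ^ 3))
      rw [hT.mul, hT.mul]
      congr 1 <;> ring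
    rw [h1, hn, hm, hl, ← AddChar.map_add_eq_mul, ← AddChar.map_add_eq_mul]
    congr 1
    ring
  refine ⟨2 * l, n - 3 * (2 * l) * (-(m / (2 * l))) ^ 2, -(m / (2 * l)),
    -((2 * l) * (-(m / (2 * l))) ^ 3 + (n - 3 * (2 * l) * (-(m / (2 * l))) ^ 2) *
      -(m / (2 * l))), hA, fun a => ?_⟩
  rw [hval, ← AddChar.map_add_eq_mul]
  congr 1
  have h1 : 2 * l * (m / (2 * l)) = m := mul_div_cancel₀ _ hA
  linear_combination (3 * a ^ 2) * h1

/-- The inverse roots of the L-function of a primitive character of level three. -/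
theorem root_pow_of_charP_five [Fintype F] {r : ℕ} (hF : Nat.card F = 5 ^ r) (h3 : hT.third ≠ 1)
    {α : ℂ} (hα : α ^ 2 + (∑ a, T a 0 0) * α + ∑ a, ∑ b, T a b 0 = 0) :
    α ^ 60 = (Nat.card F : ℂ) ^ 30 := by
  have : Fact (Nat.Prime 5) := ⟨by norm_num⟩
  obtain ⟨ψ, hψ, hfrob⟩ := exists_frobenius_invariant_addChar F 5
  obtain ⟨A, b, s, d, hA, hval⟩ := hT.exists_eq_addChar_cubic hψ h3
  obtain ⟨u, hu, hmem⟩ := cubicSum_sq_mem_of_ne_nine hψ hfrob hF (b := b) hA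
  obtain ⟨a₀, ha₀⟩ := hT.exists_sum_sum_eq h3
  have hc2 := hT.sum_sum_mul_conj h3
  have hρ : T a₀ 0 0 ^ 5 = 1 := by
    rw [hval, ← AddChar.map_add_eq_mul]
    exact addChar_pow_five ψ _
  have hD : ψ d ^ 5 = 1 := addChar_pow_five ψ d
  have hq0 : (Nat.card F : ℂ) ≠ 0 := by
    rw [hF]
    simp
  have hc1 : ∑ a, T a 0 0 = ψ d * ∑ x, ψ (A * x ^ 3 + b * x) := by
    rw [Finset.sum_congr rfl fun a _ => hval a, ← Finset.mul_sum,
      ← Equiv.sum_comp (Equiv.addRight s) fun x => ψ (A * x ^ 3 + b * x)]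
    rfl
  -- The exponent is an odd polynomial, so `x ↦ -x` realizes complex conjugation.
  have hreal : (starRingEnd ℂ) (∑ x, ψ (A * x ^ 3 + b * x)) = ∑ x, ψ (A * x ^ 3 + b * x) := by
    rw [map_sum, ← Equiv.sum_comp (Equiv.neg F) fun x => ψ (A * x ^ 3 + b * x)]
    refine Finset.sum_congr rfl fun x _ => ?_
    rw [← AddChar.map_neg_eq_conj, Equiv.neg_apply]
    congr 1
    ring
  have hDconj := conj_addChar_mul_self ψ d
  rw [hc1, ha₀] at hα
  rw [hc1, ha₀, map_mul, hreal] at hc2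
  revert hα hu hc2 hDconj hD hρ
  generalize (∑ x, ψ (A * x ^ 3 + b * x)) = w, T a₀ 0 0 = ρ, ψ d = D, (Nat.card F : ℂ) = q at *
  intro hu hα hc2 hρ hD hDconj
  by_cases hw : w = 0
  · have h1 : α ^ 2 = -(q * ρ) := by
      rw [hw] at hα
      linear_combination hα
    rw [show 60 = 2 * 30 from rfl, pow_mul, h1, Even.neg_pow (by decide), mul_pow,
      show ρ ^ 30 = (ρ ^ 5) ^ 6 by ring, hρ, one_pow, mul_one]
  -- When w ≠ 0 the functional equation fixes the constant term as `q D ^ 2`. Multiplying the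
  -- quadratic in α by the one with w negated then gives a quadratic in `α ^ 2` involving only `w ^
  -- 2`.
  · have hρD : ρ = D ^ 2 := by
      refine mul_left_cancel₀ (mul_ne_zero hq0 hw) ?_
      linear_combination D * hc2 - q * w * ρ * hDconj
    rw [hρD] at hα
    have h1 : (α ^ 2) ^ 2 + (2 - u) * (q * D ^ 2) * α ^ 2 + (q * D ^ 2) ^ 2 = 0 := by
      linear_combination (α ^ 2 + q * D ^ 2 - D * w * α) * hα + D ^ 2 * α ^ 2 * hu
    have h2 := pow_thirty_eq_of_quadratic h1 hmem
    rw [show 60 = 2 * 30 from rfl, pow_mul, h2, mul_pow,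
      show (D ^ 2) ^ 30 = (D ^ 5) ^ 12 by ring, hD, one_pow, mul_one]

end IsTripleChar

end ShortInterval
end

noncomputable section
namespace ShortInterval

/-! ### Periodicity in small levels -/

section Periodic

variable {F : Type*} [Field F] [Finite F]

/-- At level 1 the L-polynomial of a nontrivial character is the constant 1, so there are no inverse
roots and the function vanishes. -/
theorem periodic_normalizedPsi_one : Function.Periodic (normalizedPsi F 1) (1 : ℕ+) := by
  rw [periodic_normalizedPsi_iff]
  intro χ hχ hne n hn
  obtain ⟨s, hs, hsum⟩ := exists_inverse_roots hχ hne
  have h0 : s = 0 := by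
    refine Multiset.eq_zero_of_forall_notMem fun α hα => ?_
    have h := (hs α hα).2
    rw [Finset.sum_range_one, charSum_zero hχ] at h
    simp at h
  rw [hsum _ (by omega), hsum n hn, h0]
  simp

omit [Finite F] in
theorem IsLevelChar.exists_cubic_ne_one {χ : F[X] → ℂ} (hχ : IsLevelChar 3 χ)
    (hne : ∃ g : F[X], g.Monic ∧ χ g ≠ 1) : ∃ a b c, χ (cubic a b c) ≠ 1 := by
  obtain ⟨g, hg, h⟩ := hne
  rw [hχ.eq_cubic hg] at h
  exact ⟨_, _, _, h⟩

theorem IsLevelChar.third_eq_one {χ : F[X] → ℂ} (hχ : IsLevelChar 2 χ) (hχ3 : IsLevelChar 3 χ) :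
    hχ3.isTripleChar.third = 1 := by
  ext c
  rw [IsTripleChar.third_apply, AddChar.one_apply, ← hχ3.isTripleChar.one]
  refine hχ.congr (monic_cubic _ _ _) (monic_cubic _ _ _) (agree_iff.2 fun j hj => ?_)
  obtain ⟨h1, h2, -⟩ := coeff_reverse_cubic 0 0 c
  obtain ⟨h1', h2', -⟩ := coeff_reverse_cubic (0 : F) 0 0
  interval_cases j
  · rw [coeff_zero_reverse, coeff_zero_reverse, monic_cubic, monic_cubic]
  · rw [h1, h1']
  · rw [h2, h2']

theorem periodic_normalizedPsi_of_forall_root {ℓ m : ℕ} {M : ℕ+} (hℓ : ℓ ≤ 3) (hM : (M : ℕ) = 2 * m)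
    (h : ∀ χ : F[X] → ℂ, IsLevelChar ℓ χ → IsLevelChar 3 χ → (∃ g : F[X], g.Monic ∧ χ g ≠ 1) →
      ∀ α : ℂ, α ≠ 0 → α ^ 2 + charSum χ 1 * α + charSum χ 2 = 0 →
        α ^ (2 * m) = (Nat.card F : ℂ) ^ m) :
    Function.Periodic (normalizedPsi F ℓ) M := by
  rw [periodic_normalizedPsi_iff, hM]
  intro χ hχ hne n hn
  have hχ3 := hχ.mono hℓ
  have hsq : ((√(Nat.card F) : ℝ) : ℂ) ^ (2 * m) = (Nat.card F : ℂ) ^ m := by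
    rw [pow_mul, ← Complex.ofReal_pow, Real.sq_sqrt (Nat.cast_nonneg _), Complex.ofReal_natCast]
  exact mangoldtSum_add_of_forall_root hχ3 hne
    (fun α h0 hα => (h χ hχ hχ3 hne α h0 hα).trans hsq.symm) hn

theorem periodic_normalizedPsi_two {p r : ℕ} [hp : Fact p.Prime] [CharP F p]
    (hF : Nat.card F = p ^ r) {M : ℕ+} (hM : (M : ℕ) = 4 * p) :
    Function.Periodic (normalizedPsi F 2) M := by
  have := Fintype.ofFinite F
  refine periodic_normalizedPsi_of_forall_root (m := 2 * p) (by norm_num) (by omega) ?_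
  intro χ hχ hχ3 hne α h0 hα
  rw [hχ3.charSum_one_eq, hχ3.charSum_two_eq] at hα
  have hT := hχ3.isTripleChar
  have h3 := hχ.third_eq_one hχ3
  have hne' := hχ3.exists_cubic_ne_one hne
  rcases eq_or_ne p 2 with rfl | hp2
  · exact hT.root_pow_of_charTwo_of_third_eq_one hF h3 hne' h0 hα
  · have h2 : (2 : F) ≠ 0 := Ring.two_ne_zero (by rwa [ringChar.eq F p])
    have h4 := hT.root_pow_of_third_eq_one (p := p) h2 h3 hne' h0 hα
    rwa [show 4 * p = 2 * (2 * p) by ring] at h4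

theorem periodic_normalizedPsi_three_of_charP_two {r : ℕ} [CharP F 2] (hF : Nat.card F = 2 ^ r) :
    Function.Periodic (normalizedPsi F 3) (24 : ℕ+) := by
  have := Fintype.ofFinite F
  refine periodic_normalizedPsi_of_forall_root (m := 12) le_rfl rfl ?_
  intro χ _ hχ3 hne α h0 hα
  rw [hχ3.charSum_one_eq, hχ3.charSum_two_eq] at hα
  have hT := hχ3.isTripleChar
  by_cases h3 : hT.third = 1
  · have h := hT.root_pow_of_charTwo_of_third_eq_one hF h3 (hχ3.exists_cubic_ne_one hne) h0 hα
    -- Characters of level at most 2 also occur at level 3; their exponent 8 divides 24.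
    rw [show 2 * 12 = 8 * 3 from rfl, pow_mul, h, ← pow_mul]
  · exact hT.root_pow_of_charTwo hF h3 hα

theorem periodic_normalizedPsi_three_of_charP_five {r : ℕ} [CharP F 5]
    (hF : Nat.card F = 5 ^ r) :
    Function.Periodic (normalizedPsi F 3) (60 : ℕ+) := by
  have := Fintype.ofFinite F
  refine periodic_normalizedPsi_of_forall_root (m := 30) le_rfl rfl ?_
  intro χ _ hχ3 hne α h0 hα
  rw [hχ3.charSum_one_eq, hχ3.charSum_two_eq] at hα
  have hT := hχ3.isTripleChar
  by_cases h3 : hT.third = 1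
  · have h := hT.root_pow_of_third_eq_one (p := 5) two_ne_zero_of_charP_five h3
      (hχ3.exists_cubic_ne_one hne) h0 hα
    rw [show 2 * 30 = 4 * 5 * 3 from rfl, pow_mul, h, ← pow_mul]
  · exact hT.root_pow_of_charP_five hF h3 hα

theorem not_isPeriodic_normalizedPsi {p r ℓ : ℕ} [hp : Fact p.Prime] [Algebra (ZMod p) F]
    (hr : 0 < r) (hF : Nat.card F = p ^ r) (hℓ : 3 ≤ ℓ) (h : ¬(ℓ = 3 ∧ (p = 2 ∨ p = 5))) :
    ¬ IsPeriodic (normalizedPsi F ℓ) := by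
  rintro ⟨N, hN⟩
  rcases lt_or_ge p 7 with hp7 | hp7
  · have h2 := hp.out.two_le
    have h4 : p ≠ 4 := by
      rintro rfl
      exact absurd hp.out (by norm_num)
    have h6 : p ≠ 6 := by
      rintro rfl
      exact absurd hp.out (by norm_num)
    obtain rfl | rfl | rfl : p = 2 ∨ p = 3 ∨ p = 5 := by omega
    · exact not_periodic_two hr hF (by omega) hN
    · exact not_periodic_three hr hF hℓ hN
    · exact not_periodic_five hr hF (by omega) hN
  · exact not_periodic_of_ge_seven hr hF hp7 hℓ hN

end Periodic

end ShortInterval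
end

theorem mainTheorem4 (p r ℓ : ℕ) (hp : p.Prime) (hℓ : 0 < ℓ)
    (F : Type*) [Field F] [Finite F] (hF : Nat.card F = p ^ r) :
    (ShortInterval.IsPeriodic (ShortInterval.normalizedPsi F ℓ) ↔
      ℓ = 1 ∨ ℓ = 2 ∨ (ℓ = 3 ∧ (p = 2 ∨ p = 5))) ∧
    (ℓ = 1 → ShortInterval.IsThePeriod (ShortInterval.normalizedPsi F ℓ) 1) ∧
    (ℓ = 2 → ∃ N : ℕ+, ShortInterval.IsThePeriod (ShortInterval.normalizedPsi F ℓ) N ∧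
      (N : ℕ) ∣ 4 * p) ∧
    (ℓ = 3 → (p = 2 ∨ p = 5) →
      ∃ N : ℕ+, ShortInterval.IsThePeriod (ShortInterval.normalizedPsi F ℓ) N ∧
        (N : ℕ) ∣ 12 * p) := by
  have hp' : Fact p.Prime := ⟨hp⟩
  have hr : 0 < r := by
    refine Nat.pos_of_ne_zero fun h => ?_
    have h1 := Finite.one_lt_card (α := F)
    rw [hF, h, pow_zero] at h1
    exact lt_irrefl 1 h1
  have hchar : CharP F p := by
    have := Fintype.ofFinite F
    obtain ⟨p', hp''⟩ := CharP.exists F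
    obtain ⟨n, hpr, hn⟩ := FiniteField.card F p'
    rw [← Nat.card_eq_fintype_card, hF] at hn
    have h1 : p ∣ p' ^ (n : ℕ) := hn ▸ dvd_pow_self p hr.ne'
    rwa [(Nat.prime_dvd_prime_iff_eq hp hpr).1 (hp.dvd_of_dvd_pow h1)]
  have h1 := ShortInterval.periodic_normalizedPsi_one (F := F)
  have h2 : Function.Periodic (ShortInterval.normalizedPsi F 2) (⟨4 * p, Nat.mul_pos four_pos hp.pos⟩ : ℕ+) :=
    ShortInterval.periodic_normalizedPsi_two hF rfl
  have h3 : (p = 2 ∨ p = 5) → ∃ M : ℕ+, (M : ℕ) = 12 * p ∧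
      Function.Periodic (ShortInterval.normalizedPsi F 3) M := by
    rintro (rfl | rfl)
    · exact ⟨_, rfl, ShortInterval.periodic_normalizedPsi_three_of_charP_two hF⟩
    · exact ⟨_, rfl, ShortInterval.periodic_normalizedPsi_three_of_charP_five hF⟩
  refine ⟨⟨fun h => ?_, ?_⟩, ?_, ?_, ?_⟩
  · by_contra hcon
    let _ : Algebra (ZMod p) F := ZMod.algebra F p
    exact ShortInterval.not_isPeriodic_normalizedPsi hr hF (by omega) (by tauto) h
  · rintro (rfl | rfl | ⟨rfl, hp25⟩)
    · exact ⟨1, h1⟩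
    · exact ⟨_, h2⟩
    · obtain ⟨M, -, hM⟩ := h3 hp25
      exact ⟨M, hM⟩
  · rintro rfl
    exact ⟨h1, fun m _ => one_le⟩
  · rintro rfl
    exact ShortInterval.exists_isThePeriod_dvd h2
  · rintro rfl hp25
    obtain ⟨M, hMp, hM⟩ := h3 hp25
    rw [← hMp]
    exact ShortInterval.exists_isThePeriod_dvd hM
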